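/- Let $d\ge 1$, $0<s<1$, and let $\Omega\subset\mathbb R^d$ be a bounded open set. For $u:\mathbb R^d\to\mathbb R$ write $\delta^s u(x,y)=\frac{u(x)-u(y)}{|x-y|^s}$. Let $H^s_0(\Omega)$ be the closure of $C_c^\infty(\Omega)$ in $H^s(\mathbb R^d)$ (functions extended by $0$ outside $\Omega$), normed by $\|u\|_{H^s_0}^2=\int_{\mathbb R^d}\int_{\mathbb R^d}|\delta^su(x,y)|^2\frac{dx\,dy}{|x-y|^d}$. Let $g(x,y,r)$ be a measurable function which for a.e. $(x,y)\in\mathbb R^d\times\mathbb R^d$ is locally Lipschitz in $r\in(0,\infty)$ and satisfies $$0<\gamma_*\le g(x,y,r)\le\gamma^*\quad(r>0),\qquad 0<g_*\le \frac{r\,\partial_r g(x,y,r)}{g(x,y,r)}+1\le g^*\quad(\text{a.e. } r>0)$$ with constants $\gamma_*\le\gamma^*$, $g_*\le g^*$, and put $$\langle\mathcal L_g^su,v\rangle=\int_{\mathbb R^d}\int_{\mathbb R^d}g(x,y,|\delta^su|)\,\delta^su\,\delta^sv\,\frac{dx\,dy}{|x-y|^d},\qquad u,v\in H^s_0(\Omega).$$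 Capacities. For compact $K\subset\Omega$ let $\mathbb K_K^s$ be the set of all $v\in H^s_0(\Omega)$ that are limits in the $H^s$ norm of Lipschitz functions with compact support in $\Omega$ that are $\ge1$ on $K$; let $C_s(K)=\inf_{v\in\mathbb K_K^s}\|v\|_{H^s_0}^2$ and $C_s^g(K)=\langle\mathcal L_g^sw,w\rangle$, where $w\in\mathbb K^s_K$ is the unique solution of $\langle\mathcal L_g^sw,v-w\rangle\ge0$ for all $v\in\mathbb K_K^s$. For arbitrary $F\subset\Omega$, $C_s(F)$ and $C_s^g(F)$ are the suprema over the compact subsets of $F$. "Quasi-everywhere" (q.e.) in $\Omega$ means outside a set of $C_s$-capacity zero. A function is quasi-continuous in $\Omega$ if for each $\varepsilon>0$ it is continuous on $\Omega\setminus G$ for some open $G\subset\Omega$ with $C_s(G)<\varepsilon$; $\bar v$ denotes a quasi-continuous function with $\bar v=v$ a.e. in $\Omega$. Let $L^2_{C_s}(\Omega)$ be the set of quasi-continuous $\phi$ for which some $v\in H^s_0(\Omega)$ satisfies $\bar v\ge|\phi|$ q.e. in $\Omega$, with $\|\phi\|_{L^2_{C_s}}=\inf\{\|v\|_{H^s_0}: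 v\in H^s_0(\Omega),\ \bar v\ge|\phi|\text{ q.e. in }\Omega\}$. Let $\psi\in L^2_{C_s}(\Omega)$ and $\bar{\mathbb K}^s=\{v\in H^s_0(\Omega):\bar v\ge\psi\text{ q.e. in }\Omega\}$. Then every $v\in H^s_0(\Omega)$ has a quasi-continuous representative $\bar v$, and there is a unique $u\in\bar{\mathbb K}^s$ with $$\langle\mathcal L_g^su,v-u\rangle\ge0\quad\text{for all }v\in\bar{\mathbb K}^s.$$ It satisfies $u\ge0$ a.e. and $\|u\|_{H^s_0}\le\frac{\gamma^*}{\gamma_*}\|\psi^+\|_{L^2_{C_s}}$. Moreover, there is a unique nonnegative Radon measure $\mu$ on $\Omega$ (finite on compact subsets of $\Omega$) that represents $\mathcal L_g^su$ in the sense that, for every $v\in H^s_0(\Omega)$ and every quasi-continuous representative $\bar v$ of $v$, $\bar v$ is $\mu$-integrable and $$\langle\mathcal L_g^su,v\rangle=\int_\Omega\bar v\,d\mu.$$ The measure $\mu$ is concentrated on the coincidence set: $\bar u=\psi=\psi^+$ $\mu$-almost everywhere. If $\psi^+$ is not zero q.e. in $\Omega$, then the sets $\{\bar u=\psi\}$ and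 $\{\bar u=\psi^+\}$ coincide up to a set of $C_s$-capacity zero. Furthermore, for every Borel set $A\Subset\Omega$, $$\mu(A)\le\frac{(\gamma^*)^2}{\gamma_*^{3/2}}\,\|\psi^+\|_{L^2_{C_s}}\,[C_s^g(A)]^{1/2},$$ and $\mu(A)=0$ for every Borel set $A\subset\Omega$ with $C_s(A)=0$ or $C_s^g(A)=0$. -/

import Mathlib

open MeasureTheory Set
open scoped ENNReal ContDiff

noncomputable section

namespace FracObstacle

/-- The Euclidean space `ℝᵈ`. -/
abbrev E (d : ℕ) := EuclideanSpace ℝ (Fin d)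

/-- Square integrable functions on `ℝᵈ`, modulo equality almost everywhere. -/
abbrev L2 (d : ℕ) := Lp ℝ 2 (volume : Measure (E d))

variable {d : ℕ}

/-- The fractional difference quotient `δˢu(x,y) = (u(x) - u(y)) / |x - y|ˢ`. -/
def delta (s : ℝ) (u : E d → ℝ) (x y : E d) : ℝ :=
  (u x - u y) / ‖x - y‖ ^ s

/-- `∬ |δˢu(x,y)|² |x - y|⁻ᵈ dx dy` over `ℝᵈ × ℝᵈ`, with values in `[0,∞]`. -/
def gagliardoSq (s : ℝ) (u : E d → ℝ) : ℝ≥0∞ :=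
  ∫⁻ p : E d × E d, ENNReal.ofReal ((delta s u p.1 p.2) ^ 2 / ‖p.1 - p.2‖ ^ d)

/-- The square of the full `Hˢ(ℝᵈ)` norm, with values in `[0,∞]`. -/
def fullSq (s : ℝ) (u : E d → ℝ) : ℝ≥0∞ :=
  eLpNorm u 2 volume ^ 2 + gagliardoSq s u

/-- `Hˢ₀(Ω)`: the closure of `C_c^∞(Ω)` in the norm of `Hˢ(ℝᵈ)`; its elements are defined on
all of `ℝᵈ` and vanish outside `Ω`. -/
def Hs0 (s : ℝ) (Ω : Set (E d)) : Set (L2 d) :=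
  {u | ∀ ε : ℝ≥0∞, 0 < ε → ∃ φ : E d → ℝ, ContDiff ℝ ∞ φ ∧ HasCompactSupport φ ∧
    tsupport φ ⊆ Ω ∧ fullSq s (fun x => u x - φ x) < ε}

/-- The norm of `Hˢ₀(Ω)`, coming from the inner product
`∬ (u(x) - u(y)) (v(x) - v(y)) |x - y|^(-d-2s) dx dy`. -/
def hsNorm (s : ℝ) (u : L2 d) : ℝ :=
  Real.sqrt (gagliardoSq s u).toReal

/-- The assumptions on the nonlinearity `g(x,y,r)`, of which only the values at `r > 0` matter.
The behaviour `r g → 0` as `r → 0` and `r g → ∞` as `r → ∞` follows from the two-sided bound.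
The derivative in `r` exists for almost every `r > 0` by local Lipschitz continuity. -/
structure IsKernel (g : E d → E d → ℝ → ℝ) (gLow gUp γLow γUp : ℝ) : Prop where
  measurable : Measurable (fun p : E d × E d × ℝ => g p.1 p.2.1 p.2.2)
  gLow_pos : 0 < gLow
  gLow_le : gLow ≤ gUp
  γLow_pos : 0 < γLow
  locallyLipschitz : ∀ᵐ p : E d × E d, LocallyLipschitzOn (Ioi 0) (g p.1 p.2)
  growth : ∀ᵐ p : E d × E d, ∀ᵐ r : ℝ, 0 < r →
    gLow ≤ r * deriv (g p.1 p.2) r / g p.1 p.2 r + 1 ∧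
      r * deriv (g p.1 p.2) r / g p.1 p.2 r + 1 ≤ gUp
  bounds : ∀ᵐ p : E d × E d, ∀ r : ℝ, 0 < r → γLow ≤ g p.1 p.2 r ∧ g p.1 p.2 r ≤ γUp

/-- `⟨𝓛ˢ_g u, v⟩ = ∬ g(x,y,|δˢu|) δˢu δˢv |x - y|⁻ᵈ dx dy` over `ℝᵈ × ℝᵈ`. -/
def opL (s : ℝ) (g : E d → E d → ℝ → ℝ) (u v : E d → ℝ) : ℝ :=
  ∫ p : E d × E d, g p.1 p.2 |delta s u p.1 p.2| * delta s u p.1 p.2 * delta s v p.1 p.2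
    / ‖p.1 - p.2‖ ^ d

/-- `v ≥ 1` on `K` in the sense of `Hˢ₀(Ω)`: `v` is a limit in the `Hˢ` norm of Lipschitz
functions with compact support in `Ω` that are at least `1` everywhere on `K`. -/
def GeOneOn (s : ℝ) (Ω K : Set (E d)) (v : L2 d) : Prop :=
  ∀ ε : ℝ≥0∞, 0 < ε → ∃ φ : E d → ℝ, (∃ C, LipschitzWith C φ) ∧ HasCompactSupport φ ∧
    tsupport φ ⊆ Ω ∧ (∀ x ∈ K, 1 ≤ φ x) ∧ fullSq s (fun x => v x - φ x) < ε

/-- The closed convex set `𝕂ˢ_K` of all `v ∈ Hˢ₀(Ω)` with `v ≥ 1` on `K`. -/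
def capSet (s : ℝ) (Ω K : Set (E d)) : Set (L2 d) :=
  {v | v ∈ Hs0 s Ω ∧ GeOneOn s Ω K v}

/-- `C_s(F)`: for compact `K ⊆ Ω` the infimum of `‖v‖²` over `𝕂ˢ_K`; for any `F ⊆ Ω` the
supremum over the compact subsets of `F`. -/
def capS (s : ℝ) (Ω F : Set (E d)) : ℝ≥0∞ :=
  ⨆ (K : Set (E d)) (_ : IsCompact K) (_ : K ⊆ F), ⨅ v ∈ capSet s Ω K, gagliardoSq s v

/-- `u` is the capacitary potential of `K`: the solution of the variational inequality
`⟨𝓛ˢ_g u, v - u⟩ ≥ 0` for all `v ∈ 𝕂ˢ_K`. -/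
def IsCapPotential (s : ℝ) (g : E d → E d → ℝ → ℝ) (Ω K : Set (E d)) (u : L2 d) : Prop :=
  u ∈ capSet s Ω K ∧ ∀ v ∈ capSet s Ω K, 0 ≤ opL s g u (v - u : L2 d)

/-- `C_s^g(F)`: for compact `K ⊆ Ω` the number `⟨𝓛ˢ_g u, u⟩` with `u` the (unique) capacitary
potential of `K`; for any `F ⊆ Ω` the supremum over the compact subsets of `F`. -/
def capG (s : ℝ) (g : E d → E d → ℝ → ℝ) (Ω F : Set (E d)) : ℝ≥0∞ :=
  ⨆ (K : Set (E d)) (_ : IsCompact K) (_ : K ⊆ F) (u : L2 d) (_ : IsCapPotential s g Ω K u),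
    ENNReal.ofReal (opL s g u u)

/-- `P` holds quasi-everywhere in `Ω`: outside a set of `C_s`-capacity zero. -/
def QE (s : ℝ) (Ω : Set (E d)) (P : E d → Prop) : Prop :=
  capS s Ω {x | x ∈ Ω ∧ ¬ P x} = 0

/-- `f` is quasi-continuous in `Ω`: continuous on the complement of open sets of arbitrarily
small capacity. -/
def QuasiCont (s : ℝ) (Ω : Set (E d)) (f : E d → ℝ) : Prop :=
  ∀ ε : ℝ≥0∞, 0 < ε → ∃ G : Set (E d), IsOpen G ∧ G ⊆ Ω ∧ capS s Ω G < ε ∧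
    ContinuousOn f (Ω \ G)

/-- `f` is a quasi-continuous representative of `v` in `Ω`. -/
def IsQCRep (s : ℝ) (Ω : Set (E d)) (v : L2 d) (f : E d → ℝ) : Prop :=
  QuasiCont s Ω f ∧ ∀ᵐ x ∂(volume.restrict Ω), f x = v x

/-- The set of all `v ∈ Hˢ₀(Ω)` whose quasi-continuous representative is `≥ ψ` quasi-everywhere
in `Ω`. -/
def obstacleSet (s : ℝ) (Ω : Set (E d)) (ψ : E d → ℝ) : Set (L2 d) :=
  {v | v ∈ Hs0 s Ω ∧ ∃ f, IsQCRep s Ω v f ∧ QE s Ω (fun x => ψ x ≤ f x)}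

/-- Membership in `L²_{C_s}(Ω)`: quasi-continuous functions dominated in absolute value,
quasi-everywhere, by an element of `Hˢ₀(Ω)`. -/
def MemL2Cap (s : ℝ) (Ω : Set (E d)) (φ : E d → ℝ) : Prop :=
  QuasiCont s Ω φ ∧ (obstacleSet s Ω (fun x => |φ x|)).Nonempty

/-- The norm of `L²_{C_s}(Ω)`: the infimum of `‖v‖` over all `v ∈ Hˢ₀(Ω)` that dominate `|φ|`
quasi-everywhere. -/
def l2CapNorm (s : ℝ) (Ω : Set (E d)) (φ : E d → ℝ) : ℝ :=
  sInf (hsNorm s '' obstacleSet s Ω (fun x => |φ x|))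

/-- `u` solves the obstacle problem `⟨𝓛ˢ_g u, v - u⟩ ≥ 0` for all `v ≥ ψ`. -/
def IsObstacleSol (s : ℝ) (g : E d → E d → ℝ → ℝ) (Ω : Set (E d)) (ψ : E d → ℝ)
    (u : L2 d) : Prop :=
  u ∈ obstacleSet s Ω ψ ∧ ∀ v ∈ obstacleSet s Ω ψ, 0 ≤ opL s g u (v - u : L2 d)

/-- `μ` is a (nonnegative) Radon measure on `Ω` that represents `𝓛ˢ_g u` on `Hˢ₀(Ω)` through
quasi-continuous representatives. Measures on `Ω` are measures on `ℝᵈ` with `μ(Ωᶜ) = 0`. -/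
structure Represents (s : ℝ) (g : E d → E d → ℝ → ℝ) (Ω : Set (E d)) (u : L2 d)
    (μ : Measure (E d)) : Prop where
  compl_null : μ Ωᶜ = 0
  finite_compact : ∀ K : Set (E d), IsCompact K → K ⊆ Ω → μ K < ⊤
  formula : ∀ v ∈ Hs0 s Ω, ∀ f, IsQCRep s Ω v f →
    Integrable f μ ∧ opL s g u v = ∫ x, f x ∂μ

end FracObstacle

end

open FracObstacle

noncomputable section

namespace FracObstacle

open Filter Topology
open scoped NNReal

section

/-! ### Convexity and variational inequalities in Hilbert space -/

section Hilbert

variable {H : Type*} [NormedAddCommGroup H] [InnerProductSpace ℝ H] [CompleteSpace H]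

/-! Sending a function to its weighted difference quotient `dq` realises Hˢ₀(Ω) as a closed graph in
L² × L², the Hilbert space `HS`. Since Ω is bounded, `exists_poincare` makes the Gagliardo seminorm
an equivalent norm. The conditions on g say that r ↦ r g(x,y,r) has slopes between two positive
constants, so the operator is strongly monotone and Lipschitz, and `exists_variationalInequality`
solves variational inequalities on closed convex sets. Weak compactness enters only through
`exists_forall_mem_of_antitone` and `HS.exists_val_eq_of_tendsto`: bounded energy and L² convergence
put the limit in the space, and closed convex constraints survive.

The capacity of the statement is an inner one, built on the seminorm. The arguments run on the outer
capacity `ocap`, which is countably subadditive and obeys a Chebyshev inequality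
(`Admissible.ocap_abs_ge_le`). The two are comparable on compact sets and on open subsets of Ω
(`Admissible.exists_const`), and for inequalities between quasi-continuous functions being null has
the same meaning for both (`Admissible.ocap_lt_eq_zero_of_QE`). Hence quasi-continuous
representatives exist and the obstacle set is closed and convex.

If u solves the obstacle problem and v ≥ 0, then u + v is admissible, so 𝓛u is a positive functional
and `exists_measure_of_nonneg` turns it into a Radon measure μ. Testing with Lipschitz functions
that are at least 1 on K gives μ(K) ≤ γ* ‖u‖ ‖w‖ for every w in 𝕂ˢ_K. This yields the capacity
bound, shows that μ ignores sets of capacity zero, and lets the representation extend to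
quasi-continuous representatives (`RepresentsLip.formula`). Where u exceeds ψ by a margin, u can be
lowered a little and stay admissible, so μ does not live there (`RepresentsLip.measure_gap_le`).

The coincidence sets are compared through a strong minimum principle
(`Admissible.ocap_nonpos_eq_zero`): a Caccioppoli estimate for (1 - cu)⁺ as c → ∞ places a cut-off
of {u = 0} in the energy space, and testing with it forces either u or the cut-off to vanish. The
operator couples every pair of points, so connectedness of Ω plays no role. -/

theorem exists_minimal_inner {C : Set H} (hne : C.Nonempty) (hcl : IsClosed C)
    (hconv : Convex ℝ C) (x : H) : ∃ p ∈ C, ∀ w ∈ C, inner ℝ (x - p) (w - p) ≤ 0 := by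
  obtain ⟨p, hp, h⟩ := exists_norm_eq_iInf_of_complete_convex hne hcl.isComplete hconv x
  exact ⟨p, hp, (norm_eq_iInf_iff_real_inner_le_zero hconv hp).1 h⟩

/-- A decreasing sequence of closed convex sets that all meet a fixed ball has a common point in
that ball. -/
theorem exists_forall_mem_of_antitone {C : ℕ → Set H} (hanti : Antitone C)
    (hcl : ∀ n, IsClosed (C n)) (hconv : ∀ n, Convex ℝ (C n)) {R : ℝ}
    (hR : ∀ n, ∃ x ∈ C n, ‖x‖ ≤ R) : ∃ p, (∀ n, p ∈ C n) ∧ ‖p‖ ≤ R := by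
  let D : ℕ → Set H := fun n => C n ∩ Metric.closedBall 0 R
  have hDcl : ∀ n, IsClosed (D n) := fun n => (hcl n).inter Metric.isClosed_closedBall
  have hDconv : ∀ n, Convex ℝ (D n) := fun n => (hconv n).inter (convex_closedBall 0 R)
  have hDanti : Antitone D := fun m n h => inter_subset_inter_left _ (hanti h)
  have hDne : ∀ n, (D n).Nonempty := fun n => by
    obtain ⟨x, hx, hxR⟩ := hR n
    exact ⟨x, hx, by simpa using hxR⟩
  choose p hp hmin using fun n => exists_minimal_inner (hDne n) (hDcl n) (hDconv n) 0
  -- Each `p n` is the point of least norm in `D n`. The obtuse-angle condition bounds the distances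
  -- by differences of the squared norms, which increase and are bounded, so the sequence is Cauchy.
  have key : ∀ n m, n ≤ m → ‖p m - p n‖ ^ 2 ≤ ‖p m‖ ^ 2 - ‖p n‖ ^ 2 := by
    intro n m hnm
    have h1 := hmin n (p m) (hDanti hnm (hp m))
    have h2 := norm_sub_sq_real (p m) (p n)
    rw [zero_sub, inner_neg_left, inner_sub_right, real_inner_self_eq_norm_sq,
      real_inner_comm] at h1
    linarith
  have hmono : Monotone fun n => ‖p n‖ ^ 2 := fun n m hnm => by
    have := key n m hnm
    have := sq_nonneg ‖p m - p n‖
    simp only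
    linarith
  have hbdd : BddAbove (range fun n => ‖p n‖ ^ 2) := ⟨R ^ 2, by
    rintro _ ⟨n, rfl⟩
    have : ‖p n‖ ≤ R := by simpa using (hp n).2
    exact pow_le_pow_left₀ (norm_nonneg _) this 2⟩
  have hlim := tendsto_atTop_ciSup hmono hbdd
  set L := ⨆ n, ‖p n‖ ^ 2
  have hle : ∀ n, ‖p n‖ ^ 2 ≤ L := fun n => le_ciSup hbdd n
  have hd : ∀ N n, N ≤ n → ‖p n - p N‖ ≤ √(L - ‖p N‖ ^ 2) := fun N n h =>
    Real.le_sqrt_of_sq_le ((key N n h).trans (by linarith [hle n]))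
  have hcau : CauchySeq p := by
    refine cauchySeq_of_le_tendsto_0 (fun N => √(L - ‖p N‖ ^ 2) + √(L - ‖p N‖ ^ 2)) ?_ ?_
    · intro n m N hn hm
      rw [dist_eq_norm]
      calc ‖p n - p m‖ = ‖(p n - p N) - (p m - p N)‖ := by congr 1; abel
        _ ≤ ‖p n - p N‖ + ‖p m - p N‖ := norm_sub_le _ _
        _ ≤ _ := add_le_add (hd N n hn) (hd N m hm)
    · have : Tendsto (fun N => √(L - ‖p N‖ ^ 2)) atTop (𝓝 0) := by
        have := (Real.continuous_sqrt.tendsto _).comp ((tendsto_const_nhds (x := L)).sub hlim)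
        simpa [Function.comp_def] using this
      simpa using this.add this
  obtain ⟨q, hq⟩ := cauchySeq_tendsto_of_complete hcau
  have hqD : ∀ n, q ∈ D n := fun n => (hDcl n).mem_of_tendsto hq
    (eventually_atTop.2 ⟨n, fun m hm => hDanti hm (hp m)⟩)
  exact ⟨q, fun n => (hqD n).1, by simpa using (hqD 0).2⟩

/-- Stampacchia's theorem for a strongly monotone Lipschitz operator. -/
theorem exists_variationalInequality {C : Set H} (hne : C.Nonempty) (hcl : IsClosed C)
    (hconv : Convex ℝ C) (a : H → H) {c K : ℝ} (hc : 0 < c)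
    (hmono : ∀ u v, c * ‖u - v‖ ^ 2 ≤ inner ℝ (a u - a v) (u - v))
    (hlip : ∀ u v, ‖a u - a v‖ ≤ K * ‖u - v‖) :
    ∃ u ∈ C, ∀ v ∈ C, 0 ≤ inner ℝ (a u) (v - u) := by
  choose P hPC hP using fun x => exists_minimal_inner hne hcl hconv x
  have hP1 : ∀ x y, ‖P x - P y‖ ≤ ‖x - y‖ := by
    intro x y
    have h1 := hP x (P y) (hPC y)
    have h2 := hP y (P x) (hPC x)
    have h3 : ‖P x - P y‖ ^ 2 ≤ inner ℝ (x - y) (P x - P y) := by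
      rw [← real_inner_self_eq_norm_sq]
      have e : inner ℝ (P x - P y) (P x - P y) = inner ℝ (x - y) (P x - P y)
        + inner ℝ (x - P x) (P y - P x) + inner ℝ (y - P y) (P x - P y) := by
        simp only [inner_sub_left, inner_sub_right]; ring
      linarith
    have h4 := real_inner_le_norm (x - y) (P x - P y)
    by_contra! h
    have : 0 < ‖P x - P y‖ := (norm_nonneg _).trans_lt h
    nlinarith
  -- Enlarging the Lipschitz constant to at least c makes it positive and puts the contraction
  -- factor q = 1 - c²/K'² in [0,1).
  set K' := max K c
  have hK' : 0 < K' := hc.trans_le (le_max_right _ _)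
  have hcK' : c ≤ K' := le_max_right _ _
  -- This step size minimises 1 - 2ρc + ρ²K'², the squared Lipschitz bound of u ↦ u - ρ a(u). Fixed
  -- points of its composition with the projection solve the variational inequality.
  set ρ := c / K' ^ 2
  have hρ : 0 < ρ := by positivity
  set q := 1 - c ^ 2 / K' ^ 2
  have hq0 : 0 ≤ q := by
    have : c ^ 2 / K' ^ 2 ≤ 1 := (div_le_one (by positivity)).2 (by gcongr)
    simp only [q]; linarith
  have hq1 : q < 1 := by
    have : 0 < c ^ 2 / K' ^ 2 := by positivity
    simp only [q]; linarith
  have hT : ∀ u v, ‖P (u - ρ • a u) - P (v - ρ • a v)‖ ≤ √q * ‖u - v‖ := by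
    intro u v
    refine (hP1 _ _).trans ?_
    refine abs_le_of_sq_le_sq' ?_ (by positivity) |>.2
    rw [mul_pow, Real.sq_sqrt hq0]
    have e : u - ρ • a u - (v - ρ • a v) = (u - v) - ρ • (a u - a v) := by
      rw [smul_sub]; abel
    rw [e, norm_sub_sq_real, norm_smul, inner_smul_right, real_inner_comm, mul_pow,
      Real.norm_eq_abs, sq_abs]
    have h1 := hmono u v
    have h2 : ‖a u - a v‖ ^ 2 ≤ K' ^ 2 * ‖u - v‖ ^ 2 := by
      rw [← mul_pow]
      exact pow_le_pow_left₀ (norm_nonneg _) ((hlip u v).trans (by gcongr; exact le_max_left _ _)) 2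
    have h3 : ρ ^ 2 * ‖a u - a v‖ ^ 2 ≤ ρ ^ 2 * (K' ^ 2 * ‖u - v‖ ^ 2) := by gcongr
    have h4 : ρ * (c * ‖u - v‖ ^ 2) ≤ ρ * inner ℝ (a u - a v) (u - v) := by gcongr
    have e1 : ρ ^ 2 * K' ^ 2 = c ^ 2 / K' ^ 2 := by simp only [ρ]; field_simp
    have e2 : ρ * c = c ^ 2 / K' ^ 2 := by simp only [ρ]; ring
    calc _ ≤ ‖u - v‖ ^ 2 - 2 * ((ρ * c) * ‖u - v‖ ^ 2) + (ρ ^ 2 * K' ^ 2) * ‖u - v‖ ^ 2 := by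
          linarith
      _ = q * ‖u - v‖ ^ 2 := by rw [e1, e2]; simp only [q]; ring
  have hcontr : ContractingWith (Real.toNNReal (√q)) fun u => P (u - ρ • a u) := by
    refine ⟨?_, LipschitzWith.of_dist_le_mul fun u v => ?_⟩
    · rw [← NNReal.coe_lt_coe, Real.coe_toNNReal _ (Real.sqrt_nonneg _)]
      simpa using (Real.sqrt_lt_sqrt hq0 hq1)
    · rw [Real.coe_toNNReal _ (Real.sqrt_nonneg _), dist_eq_norm, dist_eq_norm]
      exact hT u v
  have : Nonempty H := ⟨0⟩
  set u := ContractingWith.fixedPoint _ hcontr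
  have hu : P (u - ρ • a u) = u := hcontr.fixedPoint_isFixedPt
  refine ⟨u, hu ▸ hPC _, fun v hv => ?_⟩
  have h := hP (u - ρ • a u) v hv
  rw [hu] at h
  rw [show u - ρ • a u - u = -(ρ • a u) by abel, inner_neg_left, inner_smul_left] at h
  simp only [conj_trivial] at h
  by_contra! hneg
  nlinarith

end Hilbert

/-! ### Monotonicity of the scalar flux -/

section Scalar

/-- The function r h(r) is absolutely continuous on [a,b], and its derivative is (r h'/h + 1) h, a
product of two factors that are both controlled. Integrating the bounds over [a,b] gives the claim.
-/
theorem kernel_increment {h : ℝ → ℝ} {gLow gUp γLow γUp : ℝ} (hgL : 0 < gLow) (hγ : 0 < γLow)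
    (hlip : LocallyLipschitzOn (Ioi 0) h)
    (hgrow : ∀ᵐ r : ℝ, 0 < r → gLow ≤ r * deriv h r / h r + 1 ∧ r * deriv h r / h r + 1 ≤ gUp)
    (hb : ∀ r : ℝ, 0 < r → γLow ≤ h r ∧ h r ≤ γUp) {a b : ℝ} (ha : 0 < a) (hab : a ≤ b) :
    gLow * γLow * (b - a) ≤ b * h b - a * h a ∧ b * h b - a * h a ≤ gUp * γUp * (b - a) := by
  have hsub : Icc a b ⊆ Ioi 0 := fun x hx => ha.trans_le hx.1
  obtain ⟨K, hK⟩ := (hlip.mono hsub).exists_lipschitzOnWith_of_compact isCompact_Icc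
  have hac1 : AbsolutelyContinuousOnInterval h a b :=
    LipschitzOnWith.absolutelyContinuousOnInterval (by rwa [uIcc_of_le hab])
  have hac2 : AbsolutelyContinuousOnInterval (fun r : ℝ => r) a b :=
    LipschitzOnWith.absolutelyContinuousOnInterval (K := 1) (LipschitzWith.id.lipschitzOnWith)
  have hac := hac2.mul hac1
  have hint := hac.integral_deriv_eq_sub
  have hder : ∀ᵐ r : ℝ, r ∈ Icc a b →
      gLow * γLow ≤ deriv ((fun r : ℝ => r) * h) r ∧
        deriv ((fun r : ℝ => r) * h) r ≤ gUp * γUp := by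
    filter_upwards [hac1.ae_differentiableAt, hgrow] with r hr1 hr2 hr
    have hr0 : 0 < r := hsub hr
    have hd := hr1 (by rwa [uIcc_of_le hab])
    obtain ⟨h1, h2⟩ := hr2 hr0
    obtain ⟨h3, h4⟩ := hb r hr0
    have hpos : 0 < h r := hγ.trans_le h3
    have e : deriv ((fun r : ℝ => r) * h) r = (r * deriv h r / h r + 1) * h r := by
      have := ((hasDerivAt_id' r).mul hd.hasDerivAt).deriv
      rw [show (fun r : ℝ => r) * h = fun y => y * h y from rfl] at *
      rw [show deriv (fun y => y * h y) r = 1 * h r + r * deriv h r from this]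
      field_simp
      ring
    rw [e]
    have : 0 ≤ r * deriv h r / h r + 1 := hgL.le.trans h1
    constructor
    · gcongr
    · gcongr
      exact this.trans h2
  have hii := hac.intervalIntegrable_deriv
  have e1 : ∫ _ in a..b, gLow * γLow = gLow * γLow * (b - a) := by
    rw [intervalIntegral.integral_const, smul_eq_mul]; ring
  have e2 : ∫ _ in a..b, gUp * γUp = gUp * γUp * (b - a) := by
    rw [intervalIntegral.integral_const, smul_eq_mul]; ring
  have hint' : ∫ x in a..b, deriv ((fun r : ℝ => r) * h) x = b * h b - a * h a := hint
  rw [← hint', ← e1, ← e2]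
  have hder' := (ae_restrict_iff' (μ := volume) (measurableSet_Icc (a := a) (b := b))).2 hder
  constructor
  · refine intervalIntegral.integral_mono_ae_restrict hab (by simp) hii ?_
    filter_upwards [hder'] with r hr using hr.1
  · refine intervalIntegral.integral_mono_ae_restrict hab hii (by simp) ?_
    filter_upwards [hder'] with r hr using hr.2

/-- The flux h(|r|) r is odd, so increments on one side of 0 reduce to `kernel_increment`. For
increments across 0 one compares each endpoint with 0, using the bounds on h alone; this is why 1
enters the minimum and the maximum. The value h(0) is harmless because it is multiplied by 0. -/
theorem kernel_flux_increment {h : ℝ → ℝ} {gLow gUp γLow γUp : ℝ} (hgL : 0 < gLow)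
    (hγ : 0 < γLow) (hlip : LocallyLipschitzOn (Ioi 0) h)
    (hgrow : ∀ᵐ r : ℝ, 0 < r → gLow ≤ r * deriv h r / h r + 1 ∧ r * deriv h r / h r + 1 ≤ gUp)
    (hb : ∀ r : ℝ, 0 < r → γLow ≤ h r ∧ h r ≤ γUp) {a b : ℝ} (hab : a ≤ b) :
    γLow * min 1 gLow * (b - a) ≤ h |b| * b - h |a| * a ∧
      h |b| * b - h |a| * a ≤ γUp * max 1 gUp * (b - a) := by
  have hγU : 0 < γUp := hγ.trans_le ((hb 1 one_pos).1.trans (hb 1 one_pos).2)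
  have k1 : γLow * min 1 gLow ≤ γLow := by nlinarith [min_le_left 1 gLow]
  have k2 : γLow * min 1 gLow ≤ gLow * γLow := by nlinarith [min_le_right 1 gLow]
  have k3 : γUp ≤ γUp * max 1 gUp := by nlinarith [le_max_left 1 gUp]
  have k4 : gUp * γUp ≤ γUp * max 1 gUp := by nlinarith [le_max_right 1 gUp]
  have pos : ∀ a b : ℝ, 0 < a → a ≤ b → γLow * min 1 gLow * (b - a) ≤ h |b| * b - h |a| * a ∧
      h |b| * b - h |a| * a ≤ γUp * max 1 gUp * (b - a) := by
    intro a b ha hab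
    obtain ⟨h1, h2⟩ := kernel_increment hgL hγ hlip hgrow hb ha hab
    rw [abs_of_pos ha, abs_of_pos (ha.trans_le hab)]
    have := sub_nonneg.2 hab
    constructor <;> nlinarith
  have zer : ∀ b : ℝ, 0 ≤ b → γLow * min 1 gLow * b ≤ h |b| * b ∧
      h |b| * b ≤ γUp * max 1 gUp * b := by
    intro b hb0
    rcases hb0.eq_or_lt with rfl | hb0
    · simp
    · obtain ⟨h1, h2⟩ := hb b hb0
      rw [abs_of_pos hb0]
      constructor <;> nlinarith
  rcases le_or_gt a 0 with ha | ha
  · rcases le_or_gt 0 b with hb0 | hb0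
    · have h1 := zer b hb0
      have h2 := zer (-a) (by linarith)
      rw [abs_neg] at h2
      constructor <;> nlinarith [h1.1, h1.2, h2.1, h2.2]
    · have := pos (-b) (-a) (by linarith) (by linarith)
      rw [abs_neg, abs_neg] at this
      constructor <;> nlinarith [this.1, this.2]
  · exact pos a b ha hab

end Scalar

end

section

variable {d : ℕ}

/-! ### The energy as an L² norm of weighted difference quotients -/

section Energy

/-- The radial profile of the singular weight, whose square is `r ^ (-2 s - d)`. -/
def radialWeight (d : ℕ) (s r : ℝ) : ℝ := (r ^ s * √(r ^ d))⁻¹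

/-- The weighted difference quotient, whose square is the integrand of `gagliardoSq`. -/
def dq (s : ℝ) (u : E d → ℝ) (p : E d × E d) : ℝ :=
  (u p.1 - u p.2) * radialWeight d s ‖p.1 - p.2‖

theorem radialWeight_nonneg {s r : ℝ} (hr : 0 ≤ r) : 0 ≤ radialWeight d s r := by
  unfold radialWeight; positivity

theorem measurable_radialWeight (s : ℝ) : Measurable (radialWeight d s) := by
  unfold radialWeight; fun_prop

theorem measurable_dq (s : ℝ) {u : E d → ℝ} (hu : Measurable u) : Measurable (dq s u) := by
  have := measurable_radialWeight (d := d) s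
  unfold dq; fun_prop

theorem delta_div_sqrt (s : ℝ) (u : E d → ℝ) (p : E d × E d) :
    delta s u p.1 p.2 / √(‖p.1 - p.2‖ ^ d) = dq s u p := by
  unfold delta dq radialWeight
  rw [mul_inv, div_div, div_eq_mul_inv, mul_inv]

theorem gagliardoSq_eq_lintegral (s : ℝ) (u : E d → ℝ) :
    gagliardoSq s u = ∫⁻ p : E d × E d, ‖dq s u p‖ₑ ^ 2 := by
  unfold gagliardoSq
  congr 1 with p
  rw [← delta_div_sqrt, ← ofReal_norm, ← ENNReal.ofReal_pow (norm_nonneg _), Real.norm_eq_abs,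
    sq_abs, div_pow, Real.sq_sqrt (by positivity)]

theorem eLpNorm_two_sq {α : Type*} [MeasurableSpace α] {μ : Measure α} (f : α → ℝ) :
    eLpNorm f 2 μ ^ 2 = ∫⁻ x, ‖f x‖ₑ ^ 2 ∂μ := by
  have := eLpNorm_nnreal_pow_eq_lintegral (μ := μ) (f := f) (p := 2) (by norm_num)
  simpa using this

theorem gagliardoSq_eq_eLpNorm (s : ℝ) (u : E d → ℝ) :
    gagliardoSq s u = eLpNorm (dq s u) 2 volume ^ 2 := by
  rw [gagliardoSq_eq_lintegral, eLpNorm_two_sq]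

/-- Both coordinate projections pull null sets back to null sets, so the energy is well defined on
classes modulo a.e. equality. -/
theorem dq_congr (s : ℝ) {u v : E d → ℝ} (h : u =ᵐ[volume] v) : dq s u =ᵐ[volume] dq s v := by
  have h1 : ∀ᵐ p : E d × E d, u p.1 = v p.1 :=
    Measure.quasiMeasurePreserving_fst.ae h
  have h2 : ∀ᵐ p : E d × E d, u p.2 = v p.2 :=
    Measure.quasiMeasurePreserving_snd.ae h
  filter_upwards [h1, h2] with p h1 h2
  unfold dq
  rw [h1, h2]

theorem gagliardoSq_congr (s : ℝ) {u v : E d → ℝ} (h : u =ᵐ[volume] v) :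
    gagliardoSq s u = gagliardoSq s v := by
  rw [gagliardoSq_eq_eLpNorm, gagliardoSq_eq_eLpNorm, eLpNorm_congr_ae (dq_congr s h)]

theorem fullSq_congr (s : ℝ) {u v : E d → ℝ} (h : u =ᵐ[volume] v) :
    fullSq s u = fullSq s v := by
  unfold fullSq
  rw [gagliardoSq_congr s h, eLpNorm_congr_ae h]

theorem gagliardoSq_le_fullSq (s : ℝ) (u : E d → ℝ) : gagliardoSq s u ≤ fullSq s u :=
  le_add_self

theorem enorm_sq_le {a b c A B : ℝ} (hA : 0 ≤ A) (hB : 0 ≤ B) (h : a ^ 2 ≤ A * b ^ 2 + B * c ^ 2) :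
    ‖a‖ₑ ^ 2 ≤ ENNReal.ofReal A * ‖b‖ₑ ^ 2 + ENNReal.ofReal B * ‖c‖ₑ ^ 2 := by
  have e : ∀ x : ℝ, ‖x‖ₑ ^ 2 = ENNReal.ofReal (x ^ 2) := fun x => by
    rw [← ofReal_norm, ← ENNReal.ofReal_pow (norm_nonneg _), Real.norm_eq_abs, sq_abs]
  rw [e, e, e, ← ENNReal.ofReal_mul hA, ← ENNReal.ofReal_mul hB,
    ← ENNReal.ofReal_add (by positivity) (by positivity)]
  exact ENNReal.ofReal_le_ofReal h

theorem gagliardoSq_le_of {s : ℝ} {u v w : E d → ℝ} (hu : Measurable u) {A B : ℝ}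
    (hA : 0 ≤ A) (hB : 0 ≤ B)
    (h : ∀ x y, (w x - w y) ^ 2 ≤ A * (u x - u y) ^ 2 + B * (v x - v y) ^ 2) :
    gagliardoSq s w ≤ ENNReal.ofReal A * gagliardoSq s u + ENNReal.ofReal B * gagliardoSq s v := by
  simp only [gagliardoSq_eq_lintegral]
  have hm := (measurable_dq s hu).enorm.pow_const 2
  rw [← lintegral_const_mul' _ _ ENNReal.ofReal_ne_top,
    ← lintegral_const_mul' _ _ ENNReal.ofReal_ne_top,
    ← lintegral_add_left (hm.const_mul _)]
  refine lintegral_mono fun p => enorm_sq_le hA hB ?_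
  simp only [dq, mul_pow]
  have := mul_le_mul_of_nonneg_right (h p.1 p.2) (sq_nonneg (radialWeight d s ‖p.1 - p.2‖))
  linarith

/-- A pointwise comparison of values and of increments passes to the full norm. The estimates for
sums, multiples, positive parts and maxima below are instances. -/
theorem fullSq_le_of {s : ℝ} {u v w : E d → ℝ} (hu : Measurable u) {A B : ℝ}
    (hA : 0 ≤ A) (hB : 0 ≤ B)
    (h0 : ∀ x, w x ^ 2 ≤ A * u x ^ 2 + B * v x ^ 2)
    (h : ∀ x y, (w x - w y) ^ 2 ≤ A * (u x - u y) ^ 2 + B * (v x - v y) ^ 2) :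
    fullSq s w ≤ ENNReal.ofReal A * fullSq s u + ENNReal.ofReal B * fullSq s v := by
  have h1 := gagliardoSq_le_of (s := s) hu hA hB h
  have h2 : eLpNorm w 2 volume ^ 2 ≤ ENNReal.ofReal A * eLpNorm u 2 volume ^ 2
      + ENNReal.ofReal B * eLpNorm v 2 volume ^ 2 := by
    simp only [eLpNorm_two_sq]
    have hm := hu.enorm.pow_const 2
    rw [← lintegral_const_mul' _ _ ENNReal.ofReal_ne_top,
      ← lintegral_const_mul' _ _ ENNReal.ofReal_ne_top,
      ← lintegral_add_left (hm.const_mul _)]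
    exact lintegral_mono fun x => enorm_sq_le hA hB (h0 x)
  calc fullSq s w ≤ _ := add_le_add h2 h1
    _ = _ := by unfold fullSq; ring

theorem fullSq_add_le {s : ℝ} {u v : E d → ℝ} (hu : Measurable u) :
    fullSq s (fun x => u x + v x) ≤ 2 * fullSq s u + 2 * fullSq s v := by
  have := fullSq_le_of (s := s) (v := v) (w := fun x => u x + v x) hu (A := 2) (B := 2)
    (by norm_num) (by norm_num) (fun x => by nlinarith [sq_nonneg (u x - v x)])
    (fun x y => by nlinarith [sq_nonneg ((u x - u y) - (v x - v y))])
  simpa using this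

theorem fullSq_neg_sub (s : ℝ) (u v : E d → ℝ) :
    fullSq s (fun x => u x - v x) = fullSq s (fun x => v x - u x) := by
  unfold fullSq
  simp only [eLpNorm_two_sq, gagliardoSq_eq_lintegral]
  congr 2
  · ext x; rw [← enorm_neg]; congr 3; ring
  · ext x; rw [← enorm_neg]; congr 3; unfold dq; ring

end Energy

/-! ### Integrability of the singular weight and the Poincaré inequality -/

section RadialWeight

/-- In polar coordinates the integrand is at most r^(1-2s) near 0 and r^(-1-2s) at infinity. The
first is integrable because s < 1, the second because s > 0. -/
theorem lintegral_min_radialWeight_lt_top (hd : 0 < d) {s : ℝ} (hs0 : 0 < s) (hs1 : s < 1) :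
    ∫⁻ h : E d, ENNReal.ofReal (min (‖h‖ ^ 2) 1 * radialWeight d s ‖h‖ ^ 2) < ⊤ := by
  have : Nonempty (Fin d) := ⟨⟨0, hd⟩⟩
  let f : ℝ → ℝ := fun r => min (r ^ 2) 1 * radialWeight d s r ^ 2
  have hsq : ∀ r : ℝ, 0 < r → radialWeight d s r ^ 2 = r ^ (-2 * s) * (r ^ d)⁻¹ := by
    intro r hr
    unfold radialWeight
    rw [inv_pow, mul_pow, Real.sq_sqrt (by positivity), mul_inv, ← Real.rpow_natCast (r ^ s),
      ← Real.rpow_mul hr.le, ← Real.rpow_neg hr.le]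
    congr 2
    push_cast; ring
  have hpow : ∀ r : ℝ, 0 < r → r ^ (d - 1) * (r ^ d)⁻¹ = r ^ (-1 : ℝ) := by
    intro r hr
    rw [Real.rpow_neg_one]
    obtain ⟨k, rfl⟩ : ∃ k, d = k + 1 := ⟨d - 1, by omega⟩
    simp only [Nat.add_sub_cancel, pow_succ]
    field_simp
  have hint : Integrable (fun h : E d => f ‖h‖) volume := by
    rw [integrable_fun_norm_addHaar, finrank_euclideanSpace, Fintype.card_fin]
    have hsplit : Ioi (0 : ℝ) = Ioo 0 2 ∪ Ioi 1 := by
      ext x; simp only [mem_Ioi, mem_union, mem_Ioo]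
      constructor
      · intro h; rcases lt_or_ge x 2 with h2 | h2
        · exact Or.inl ⟨h, h2⟩
        · right; linarith
      · rintro (h | h) <;> [exact h.1; linarith]
    have hmeas : AEStronglyMeasurable (fun y : ℝ => y ^ (d - 1) • f y) volume := by
      have := measurable_radialWeight (d := d) s
      have : Measurable (fun y : ℝ => y ^ (d - 1) • f y) := by
        simp only [f, smul_eq_mul]; fun_prop
      exact this.aestronglyMeasurable
    rw [hsplit]
    refine IntegrableOn.union ?_ ?_
    · have h1 : IntegrableOn (fun x : ℝ => x ^ (1 - 2 * s)) (Ioo 0 2) :=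
        (intervalIntegral.integrableOn_Ioo_rpow_iff (by norm_num)).2 (by linarith)
      refine Integrable.mono' h1 hmeas.restrict ?_
      filter_upwards [ae_restrict_mem measurableSet_Ioo] with r hr
      have hr0 := hr.1
      rw [Real.norm_eq_abs, abs_of_nonneg (by simp only [f, smul_eq_mul]; positivity)]
      simp only [f, smul_eq_mul, hsq r hr0]
      calc _ ≤ r ^ (d - 1) * (r ^ 2 * (r ^ (-2 * s) * (r ^ d)⁻¹)) := by
            gcongr; exact min_le_left _ _
        _ = (r ^ (d - 1) * (r ^ d)⁻¹) * (r ^ (2 : ℝ) * r ^ (-2 * s)) := by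
            rw [show (2 : ℝ) = ((2 : ℕ) : ℝ) by norm_num, Real.rpow_natCast]; ring
        _ = _ := by
            rw [hpow r hr0, ← Real.rpow_add hr0, ← Real.rpow_add hr0]; congr 1; ring
    · have h1 : IntegrableOn (fun x : ℝ => x ^ (-1 - 2 * s)) (Ioi 1) :=
        (integrableOn_Ioi_rpow_iff (by norm_num)).2 (by linarith)
      refine Integrable.mono' h1 hmeas.restrict ?_
      filter_upwards [ae_restrict_mem measurableSet_Ioi] with r hr
      have hr0 : 0 < r := one_pos.trans hr
      rw [Real.norm_eq_abs, abs_of_nonneg (by simp only [f, smul_eq_mul]; positivity)]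
      simp only [f, smul_eq_mul, hsq r hr0]
      calc _ ≤ r ^ (d - 1) * (1 * (r ^ (-2 * s) * (r ^ d)⁻¹)) := by
            gcongr; exact min_le_right _ _
        _ = (r ^ (d - 1) * (r ^ d)⁻¹) * r ^ (-2 * s) := by ring
        _ = _ := by rw [hpow r hr0, ← Real.rpow_add hr0]; congr 1; ring
  have := hint.lintegral_lt_top
  exact this

/-- Lipschitz functions supported in a ball have finite energy, with a bound that depends only on
the Lipschitz constant, the supremum and the radius. -/
theorem exists_fullSq_le_of_lipschitz (hd : 0 < d) {s : ℝ} (hs0 : 0 < s) (hs1 : s < 1)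
    (L : ℝ≥0) (B R : ℝ) : ∃ M : ℝ, 0 ≤ M ∧ ∀ φ : E d → ℝ, LipschitzWith L φ → (∀ x, |φ x| ≤ B) →
      (∀ x, x ∉ Metric.closedBall (0 : E d) R → φ x = 0) → fullSq s φ ≤ ENNReal.ofReal M := by
  set I := ∫⁻ h : E d, ENNReal.ofReal (min (‖h‖ ^ 2) 1 * radialWeight d s ‖h‖ ^ 2) with hI
  have hItop : I < ⊤ := lintegral_min_radialWeight_lt_top hd hs0 hs1
  set b := volume (Metric.closedBall (0 : E d) R) with hb
  have hbtop : b < ⊤ := measure_closedBall_lt_top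
  -- The squared increment is at most both L²|x-y|² and 4B², hence at most A min(|x-y|², 1).
  let A : ℝ := L ^ 2 + 4 * B ^ 2
  let M' : ℝ≥0∞ := ENNReal.ofReal (B ^ 2) * b + ENNReal.ofReal A * (b * I + b * I)
  have hM' : M' < ⊤ := by
    simp only [M']
    have h1 : ENNReal.ofReal A < ⊤ := ENNReal.ofReal_lt_top
    have h2 : ENNReal.ofReal (B ^ 2) < ⊤ := ENNReal.ofReal_lt_top
    finiteness
  refine ⟨M'.toReal, ENNReal.toReal_nonneg, fun φ hφ hφB hφR => ?_⟩
  rw [ENNReal.ofReal_toReal hM'.ne]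
  have e : ∀ x : ℝ, ‖x‖ₑ ^ 2 = ENNReal.ofReal (x ^ 2) := fun x => by
    rw [← ofReal_norm, ← ENNReal.ofReal_pow (norm_nonneg _), Real.norm_eq_abs, sq_abs]
  refine add_le_add ?_ ?_
  · rw [eLpNorm_two_sq]
    calc ∫⁻ x, ‖φ x‖ₑ ^ 2 ≤ ∫⁻ x, (Metric.closedBall (0 : E d) R).indicator
          (fun _ => ENNReal.ofReal (B ^ 2)) x := by
          refine lintegral_mono fun x => ?_
          by_cases hx : x ∈ Metric.closedBall (0 : E d) R
          · rw [indicator_of_mem hx, e]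
            exact ENNReal.ofReal_le_ofReal (sq_le_sq' (abs_le.1 (hφB x)).1 (abs_le.1 (hφB x)).2)
          · simp [hφR x hx]
      _ = _ := by
          rw [lintegral_indicator Metric.isClosed_closedBall.measurableSet, setLIntegral_const]
  · rw [gagliardoSq_eq_lintegral]
    let m : E d → ℝ≥0∞ := fun h =>
      ENNReal.ofReal (min (‖h‖ ^ 2) 1 * radialWeight d s ‖h‖ ^ 2)
    have hm : Measurable m := by
      have := measurable_radialWeight (d := d) s
      simp only [m]; fun_prop
    let ind : E d → ℝ≥0∞ := (Metric.closedBall (0 : E d) R).indicator 1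
    have hind : Measurable ind := measurable_one.indicator Metric.isClosed_closedBall.measurableSet
    -- The quotient vanishes unless one of the two points lies in the ball; integrating out the
    -- other point leaves the volume of the ball times the integral of the weight, once for each
    -- coordinate.
    have hpt : ∀ p : E d × E d, ‖dq s φ p‖ₑ ^ 2 ≤
        ENNReal.ofReal A * (ind p.1 * m (p.1 - p.2) + ind p.2 * m (p.1 - p.2)) := by
      intro p
      have hA : (φ p.1 - φ p.2) ^ 2 ≤ A * min (‖p.1 - p.2‖ ^ 2) 1 := by
        have h1 : |φ p.1 - φ p.2| ≤ L * ‖p.1 - p.2‖ := by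
          have := hφ.dist_le_mul p.1 p.2
          rwa [Real.dist_eq, dist_eq_norm] at this
        have h2 : |φ p.1 - φ p.2| ≤ 2 * B :=
          (abs_sub _ _).trans (by linarith [hφB p.1, hφB p.2])
        have h1' : (φ p.1 - φ p.2) ^ 2 ≤ L ^ 2 * ‖p.1 - p.2‖ ^ 2 := by
          rw [← mul_pow, ← sq_abs]; exact pow_le_pow_left₀ (abs_nonneg _) h1 2
        have h2' : (φ p.1 - φ p.2) ^ 2 ≤ 4 * B ^ 2 := by
          rw [show 4 * B ^ 2 = (2 * B) ^ 2 by ring, ← sq_abs]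
          exact pow_le_pow_left₀ (abs_nonneg _) h2 2
        simp only [A]
        rcases le_total (‖p.1 - p.2‖ ^ 2) 1 with h | h
        · rw [min_eq_left h]; nlinarith [sq_nonneg B, sq_nonneg ‖p.1 - p.2‖]
        · rw [min_eq_right h]; nlinarith [sq_nonneg (L : ℝ)]
      have hgen : ‖dq s φ p‖ₑ ^ 2 ≤ ENNReal.ofReal A * m (p.1 - p.2) := by
        rw [e, ← ENNReal.ofReal_mul (by simp only [A]; positivity)]
        refine ENNReal.ofReal_le_ofReal ?_
        rw [dq, mul_pow, ← mul_assoc]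
        gcongr
      by_cases h1 : p.1 ∈ Metric.closedBall (0 : E d) R
      · refine hgen.trans ?_
        gcongr
        simp only [ind, indicator_of_mem h1, Pi.one_apply, one_mul]
        exact le_self_add
      · by_cases h2 : p.2 ∈ Metric.closedBall (0 : E d) R
        · refine hgen.trans ?_
          gcongr
          simp only [ind, indicator_of_mem h2, Pi.one_apply, one_mul]
          exact le_add_self
        · simp [dq, hφR _ h1, hφR _ h2]
    have hind1 : ∫⁻ x, ind x = b := by
      simp only [ind]
      rw [lintegral_indicator_one Metric.isClosed_closedBall.measurableSet]
    have hindtop : ∀ x, ind x ≠ ⊤ := fun x => by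
      simp only [ind, indicator]; split_ifs <;> simp
    have i1 : ∫⁻ p : E d × E d, ind p.1 * m (p.1 - p.2) = b * I := by
      rw [Measure.volume_eq_prod, lintegral_prod _ (by fun_prop)]
      simp only [lintegral_const_mul' _ _ (hindtop _)]
      have : ∀ x : E d, ∫⁻ y, m (x - y) = I := fun x => by
        rw [lintegral_sub_left_eq_self m x]
      simp only [this]
      rw [lintegral_mul_const _ hind, hind1]
    have i2 : ∫⁻ p : E d × E d, ind p.2 * m (p.1 - p.2) = b * I := by
      rw [Measure.volume_eq_prod, lintegral_prod_symm _ (by fun_prop)]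
      simp only [lintegral_const_mul' _ _ (hindtop _)]
      have : ∀ y : E d, ∫⁻ x, m (x - y) = I := fun y => by
        rw [lintegral_sub_right_eq_self m y]
      simp only [this]
      rw [lintegral_mul_const _ hind, hind1]
    calc _ ≤ _ := lintegral_mono hpt
      _ = _ := by
        rw [lintegral_const_mul' _ _ ENNReal.ofReal_ne_top, lintegral_add_left (by fun_prop),
          i1, i2]

/-- The Poincaré inequality for functions that vanish outside a bounded set. -/
theorem exists_poincare (hd : 0 < d) {s : ℝ} (hs0 : 0 < s) {Ω : Set (E d)}
    (hΩ : Bornology.IsBounded Ω) : ∃ C : ℝ, 0 < C ∧ ∀ u : E d → ℝ, Measurable u →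
      (∀ᵐ x, x ∉ Ω → u x = 0) → eLpNorm u 2 volume ^ 2 ≤ ENNReal.ofReal C * gagliardoSq s u := by
  have : Nonempty (Fin d) := ⟨⟨0, hd⟩⟩
  obtain ⟨R, hR0, hR⟩ := hΩ.subset_ball_lt 0 0
  -- A unit ball outside the ball of radius R that contains Ω. On it the function vanishes, so
  -- restricting the second variable to it bounds the energy below by a multiple of the L² norm.
  obtain ⟨e, he⟩ := exists_norm_eq (E d) (c := R + 1) (by positivity)
  set B := Metric.ball e 1
  have hB0 : 0 < volume B := Metric.measure_ball_pos _ _ one_pos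
  have hBtop : volume B ≠ ⊤ := measure_ball_lt_top.ne
  have hBR : ∀ y ∈ B, R < ‖y‖ ∧ ‖y‖ < R + 2 := by
    intro y hy
    rw [mem_ball_iff_norm] at hy
    have h1 := norm_sub_norm_le e y
    have h2 := norm_sub_norm_le y e
    rw [he] at h1 h2
    constructor <;> linarith [norm_sub_rev e y]
  -- The largest distance between a point of norm below R and a point of the auxiliary ball, whose
  -- points have norm below R + 2.
  set T := 2 * R + 2
  set c := radialWeight d s T ^ 2
  have hc : 0 < c := by simp only [c, radialWeight]; positivity
  set k : ℝ≥0∞ := ENNReal.ofReal c * volume B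
  have hk0 : k ≠ 0 := mul_ne_zero (by simpa using hc) hB0.ne'
  have hktop : k ≠ ⊤ := ENNReal.mul_ne_top ENNReal.ofReal_ne_top hBtop
  refine ⟨(k⁻¹).toReal, ENNReal.toReal_pos (by simpa using hktop) (by simpa using hk0), ?_⟩
  intro u hu hzero
  rw [ENNReal.ofReal_toReal (by simpa using hk0)]
  have hball : MeasurableSet (Metric.ball (0 : E d) R) := measurableSet_ball
  let w : E d → ℝ := (Metric.ball (0 : E d) R).indicator u
  have huw : u =ᵐ[volume] w := by
    filter_upwards [hzero] with x hx
    by_cases h : x ∈ Metric.ball (0 : E d) R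
    · simp [w, h]
    · simp [w, h, hx fun h' => h (hR h')]
  rw [eLpNorm_congr_ae huw, gagliardoSq_congr s huw, eLpNorm_two_sq, gagliardoSq_eq_lintegral]
  have hw : Measurable w := hu.indicator hball
  rw [← ENNReal.div_eq_inv_mul, ENNReal.le_div_iff_mul_le (Or.inl hk0) (Or.inl hktop)]
  have hpt : ∀ p : E d × E d, ‖w p.1‖ₑ ^ 2 * B.indicator (fun _ => ENNReal.ofReal c) p.2
      ≤ ‖dq s w p‖ₑ ^ 2 := by
    intro p
    by_cases h2 : p.2 ∈ B
    · have hp2 : w p.2 = 0 := by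
        have := (hBR _ h2).1
        simp only [w, indicator_of_notMem (show p.2 ∉ Metric.ball (0 : E d) R by
          simpa using this.le)]
      by_cases h1 : p.1 ∈ Metric.ball (0 : E d) R
      · rw [indicator_of_mem h2, dq, hp2, sub_zero, enorm_mul, mul_pow]
        gcongr
        rw [← ofReal_norm, ← ENNReal.ofReal_pow (norm_nonneg _)]
        refine ENNReal.ofReal_le_ofReal ?_
        simp only [c]
        have hn1 : ‖p.1‖ < R := by simpa using h1
        have hpos : 0 < ‖p.1 - p.2‖ := by
          rw [norm_pos_iff, sub_ne_zero]; intro h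
          rw [h] at hn1; linarith [(hBR _ h2).1]
        have hle : ‖p.1 - p.2‖ ≤ T := (norm_sub_le _ _).trans (by
          simp only [T]; linarith [(hBR _ h2).2])
        rw [Real.norm_eq_abs, abs_of_nonneg (radialWeight_nonneg hpos.le)]
        unfold radialWeight
        gcongr
      · simp [w, h1]
    · simp [h2]
  calc _ = ∫⁻ p : E d × E d, ‖w p.1‖ₑ ^ 2 * B.indicator (fun _ => ENNReal.ofReal c) p.2 := by
        rw [Measure.volume_eq_prod, lintegral_prod_mul (hw.enorm.pow_const 2).aemeasurable
          (measurable_const.indicator measurableSet_ball).aemeasurable,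
          lintegral_indicator measurableSet_ball, setLIntegral_const]
    _ ≤ _ := lintegral_mono hpt

end RadialWeight

end

section

variable {d : ℕ} {s : ℝ} {Ω : Set (E d)}

/-! ### Compactly supported Lipschitz functions -/

section Lipschitz

/-- Lipschitz functions with compact support in `Ω`. -/
structure LipC (Ω : Set (E d)) (φ : E d → ℝ) : Prop where
  lip : ∃ C, LipschitzWith C φ
  compact : HasCompactSupport φ
  subset : tsupport φ ⊆ Ω

theorem LipC.of_contDiff {φ : E d → ℝ} (h : ContDiff ℝ ∞ φ) (hc : HasCompactSupport φ)
    (hs : tsupport φ ⊆ Ω) : LipC Ω φ :=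
  ⟨ContDiff.lipschitzWith_of_hasCompactSupport hc h (by simp), hc, hs⟩

theorem LipC.continuous {φ : E d → ℝ} (h : LipC Ω φ) : Continuous φ :=
  h.lip.choose_spec.continuous

theorem LipC.measurable {φ : E d → ℝ} (h : LipC Ω φ) : Measurable φ :=
  h.continuous.measurable

theorem LipC.eq_zero {φ : E d → ℝ} (h : LipC Ω φ) {x : E d} (hx : x ∉ Ω) : φ x = 0 :=
  image_eq_zero_of_notMem_tsupport fun h' => hx (h.subset h')

theorem LipC.memLp {φ : E d → ℝ} (h : LipC Ω φ) : MemLp φ 2 (volume : Measure (E d)) :=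
  h.continuous.memLp_of_hasCompactSupport h.compact

theorem LipC.bounded {φ : E d → ℝ} (h : LipC Ω φ) : ∃ B, ∀ x, |φ x| ≤ B :=
  h.compact.exists_bound_of_continuous h.continuous

theorem LipC.exists_closedBall {φ : E d → ℝ} (h : LipC Ω φ) :
    ∃ R, ∀ x, x ∉ Metric.closedBall (0 : E d) R → φ x = 0 := by
  obtain ⟨R, hR⟩ := h.compact.isCompact.isBounded.subset_closedBall 0
  exact ⟨R, fun x hx => image_eq_zero_of_notMem_tsupport fun h' => hx (hR h')⟩

theorem LipC.of_support {φ θ w : E d → ℝ} (hφ : LipC Ω φ) (hθ : LipC Ω θ)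
    (hw : ∃ C, LipschitzWith C w) (h : ∀ x, φ x = 0 → θ x = 0 → w x = 0) : LipC Ω w := by
  have hsub : tsupport w ⊆ tsupport φ ∪ tsupport θ := by
    refine closure_minimal (fun x hx => ?_) ((isClosed_tsupport _).union (isClosed_tsupport _))
    by_contra hx'
    simp only [mem_union, not_or] at hx'
    exact hx (h x (image_eq_zero_of_notMem_tsupport hx'.1)
      (image_eq_zero_of_notMem_tsupport hx'.2))
  exact ⟨hw, (hφ.compact.isCompact.union hθ.compact.isCompact).of_isClosed_subset
    (isClosed_tsupport _) hsub, hsub.trans (union_subset hφ.subset hθ.subset)⟩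

theorem LipC.add {φ θ : E d → ℝ} (hφ : LipC Ω φ) (hθ : LipC Ω θ) :
    LipC Ω (fun x => φ x + θ x) := by
  obtain ⟨A, hA⟩ := hφ.lip
  obtain ⟨B, hB⟩ := hθ.lip
  exact hφ.of_support hθ ⟨_, hA.add hB⟩ fun x h1 h2 => by simp [h1, h2]

theorem LipC.const_mul {φ : E d → ℝ} (hφ : LipC Ω φ) (c : ℝ) : LipC Ω (fun x => c * φ x) := by
  obtain ⟨A, hA⟩ := hφ.lip
  refine hφ.of_support hφ ⟨‖c‖₊ * A, LipschitzWith.of_dist_le_mul fun x y => ?_⟩ fun x h _ => by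
    simp [h]
  rw [Real.dist_eq, ← mul_sub, abs_mul, NNReal.coe_mul, coe_nnnorm, Real.norm_eq_abs, mul_assoc]
  gcongr
  exact hA.dist_le_mul x y

theorem LipC.max {φ θ : E d → ℝ} (hφ : LipC Ω φ) (hθ : LipC Ω θ) :
    LipC Ω (fun x => max (φ x) (θ x)) := by
  obtain ⟨A, hA⟩ := hφ.lip
  obtain ⟨B, hB⟩ := hθ.lip
  exact hφ.of_support hθ ⟨_, hA.max hB⟩ fun x h1 h2 => by simp [h1, h2]

theorem LipC.sub {φ θ : E d → ℝ} (hφ : LipC Ω φ) (hθ : LipC Ω θ) :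
    LipC Ω (fun x => φ x - θ x) := by
  simpa [sub_eq_add_neg] using hφ.add (hθ.const_mul (-1))

theorem LipC.pos {φ : E d → ℝ} (hφ : LipC Ω φ) : LipC Ω (fun x => Max.max (φ x) 0) := by
  simpa using hφ.max (hφ.const_mul 0)

theorem LipC.abs {φ : E d → ℝ} (hφ : LipC Ω φ) : LipC Ω (fun x => |φ x|) := by
  simpa [abs_eq_max_neg] using hφ.max (hφ.const_mul (-1))

theorem LipC.mul {φ θ : E d → ℝ} (hφ : LipC Ω φ) (hθ : LipC Ω θ) :
    LipC Ω (fun x => φ x * θ x) := by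
  obtain ⟨A, hA⟩ := hφ.lip
  obtain ⟨B, hB⟩ := hθ.lip
  obtain ⟨M, hM⟩ := hφ.bounded
  obtain ⟨N, hN⟩ := hθ.bounded
  have hM0 : 0 ≤ M := (abs_nonneg _).trans (hM 0)
  have hN0 : 0 ≤ N := (abs_nonneg _).trans (hN 0)
  refine hφ.of_support hφ ⟨M.toNNReal * B + N.toNNReal * A,
    LipschitzWith.of_dist_le_mul fun x y => ?_⟩ fun x h _ => by simp [h]
  rw [NNReal.coe_add, NNReal.coe_mul, NNReal.coe_mul, Real.coe_toNNReal _ hM0,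
    Real.coe_toNNReal _ hN0, Real.dist_eq]
  have h1 := hA.dist_le_mul x y
  have h2 := hB.dist_le_mul x y
  rw [Real.dist_eq] at h1 h2
  calc |φ x * θ x - φ y * θ y| = |φ x * (θ x - θ y) + θ y * (φ x - φ y)| := by congr 1; ring
    _ ≤ |φ x| * |θ x - θ y| + |θ y| * |φ x - φ y| := by
        rw [← abs_mul, ← abs_mul]; exact abs_add_le _ _
    _ ≤ M * (B * dist x y) + N * (A * dist x y) := by
        gcongr
        · exact hM x
        · exact hN y
    _ = _ := by ring

theorem LipC.fullSq_lt_top (hd : 0 < d) (hs0 : 0 < s) (hs1 : s < 1) {φ : E d → ℝ}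
    (h : LipC Ω φ) : fullSq s φ < ⊤ := by
  obtain ⟨L, hL⟩ := h.lip
  obtain ⟨B, hB⟩ := h.bounded
  obtain ⟨R, hR⟩ := h.exists_closedBall
  obtain ⟨M, -, hM⟩ := exists_fullSq_le_of_lipschitz hd hs0 hs1 L B R
  exact (hM φ hL hB hR).trans_lt ENNReal.ofReal_lt_top

/-- A Lipschitz cutoff function of a compact subset of an open set. -/
theorem exists_lipC_one (hΩ : IsOpen Ω) {K : Set (E d)} (hK : IsCompact K) (hKΩ : K ⊆ Ω) :
    ∃ θ : E d → ℝ, LipC Ω θ ∧ (∀ x, 0 ≤ θ x) ∧ (∀ x, θ x ≤ 1) ∧ ∀ x ∈ K, θ x = 1 := by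
  obtain ⟨δ, hδ, hsub⟩ := hK.exists_cthickening_subset_open hΩ hKΩ
  refine ⟨fun x => thickenedIndicator hδ K x, ⟨⟨_, lipschitzWith_thickenedIndicator hδ K⟩, ?_, ?_⟩,
    fun x => NNReal.coe_nonneg _, fun x => ?_, fun x hx => ?_⟩
  rotate_right 2
  · exact_mod_cast thickenedIndicator_le_one hδ K x
  · simp [thickenedIndicator_one hδ K hx]
  all_goals
    have hsupp : tsupport (fun x => (thickenedIndicator hδ K x : ℝ)) ⊆ Metric.cthickening δ K := by
      refine closure_minimal (fun x hx => ?_) Metric.isClosed_cthickening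
      by_contra h
      exact hx (by
        simp [thickenedIndicator_zero hδ K fun h' => h (Metric.thickening_subset_cthickening _ _ h')])
  · exact (hK.cthickening (r := δ)).of_isClosed_subset (isClosed_tsupport _) hsupp
  · exact hsupp.trans hsub

end Lipschitz

/-! ### The Hilbert space of finite-energy functions -/

section Space

/-- Square integrable functions of two variables. -/
abbrev L2P (d : ℕ) := Lp ℝ 2 (volume : Measure (E d × E d))

theorem fullSq_zero : fullSq s (fun _ : E d => (0 : ℝ)) = 0 := by
  unfold fullSq
  simp [gagliardoSq_eq_lintegral, dq]

theorem zero_mem_Hs0 : (0 : L2 d) ∈ Hs0 s Ω := by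
  intro ε hε
  refine ⟨fun _ => 0, contDiff_const, HasCompactSupport.zero, ?_, ?_⟩
  · simp [tsupport, Function.support_fun_zero]
  · rw [fullSq_congr s (v := fun _ => (0 : ℝ)) (by
      filter_upwards [Lp.coeFn_zero ℝ 2 (volume : Measure (E d))] with x hx
      simp), fullSq_zero]
    exact hε

theorem exists_pos_mul_lt_ennreal {ε : ℝ≥0∞} (hε : 0 < ε) (c : ℝ) :
    ∃ δ : ℝ≥0∞, 0 < δ ∧ ENNReal.ofReal c * δ < ε := by
  by_cases hc : ENNReal.ofReal c = 0
  · exact ⟨1, one_pos, by simpa [hc] using hε⟩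
  · rcases eq_or_ne ε ⊤ with rfl | htop
    · exact ⟨1, one_pos, by simp⟩
    refine ⟨ε / 2 / ENNReal.ofReal c, ENNReal.div_pos (ENNReal.half_pos hε.ne').ne'
      ENNReal.ofReal_ne_top, ?_⟩
    rw [ENNReal.mul_div_cancel hc ENNReal.ofReal_ne_top]
    exact ENNReal.half_lt_self hε.ne' htop

theorem add_mem_Hs0 {u v : L2 d} (hu : u ∈ Hs0 s Ω) (hv : v ∈ Hs0 s Ω) : u + v ∈ Hs0 s Ω := by
  intro ε hε
  obtain ⟨δ, hδ, hδε⟩ := exists_pos_mul_lt_ennreal hε 4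
  obtain ⟨φ, h1, h2, h3, h4⟩ := hu δ hδ
  obtain ⟨θ, k1, k2, k3, k4⟩ := hv δ hδ
  refine ⟨φ + θ, h1.add k1, h2.add k2, (tsupport_add _ _).trans (union_subset h3 k3), ?_⟩
  rw [fullSq_congr s (v := fun x => (u x - φ x) + (v x - θ x)) (by
      filter_upwards [Lp.coeFn_add u v] with x hx
      simp only [hx, Pi.add_apply]; ring)]
  have hm : Measurable fun x => u x - φ x :=
    (Lp.stronglyMeasurable u).measurable.sub h1.continuous.measurable
  calc _ ≤ _ := fullSq_add_le hm
    _ ≤ 2 * δ + 2 * δ := by gcongr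
    _ = ENNReal.ofReal 4 * δ := by
        rw [← add_mul]; congr 1; rw [show (4 : ℝ) = ((4 : ℕ) : ℝ) by norm_num, ENNReal.ofReal_natCast]
        norm_num
    _ < ε := hδε

theorem fullSq_const_mul {u : E d → ℝ} (hu : Measurable u) (c : ℝ) :
    fullSq s (fun x => c * u x) ≤ ENNReal.ofReal (c ^ 2) * fullSq s u := by
  have := fullSq_le_of (s := s) (v := u) (w := fun x => c * u x) hu (sq_nonneg c) le_rfl
    (fun x => by rw [mul_pow]; linarith) (fun x y => by rw [← mul_sub, mul_pow]; linarith)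
  simpa using this

theorem smul_mem_Hs0 (c : ℝ) {u : L2 d} (hu : u ∈ Hs0 s Ω) : c • u ∈ Hs0 s Ω := by
  intro ε hε
  obtain ⟨δ, hδ, hδε⟩ := exists_pos_mul_lt_ennreal hε (c ^ 2)
  obtain ⟨φ, h1, h2, h3, h4⟩ := hu δ hδ
  refine ⟨fun x => c * φ x, contDiff_const.mul h1, h2.mul_left,
    (tsupport_mul_subset_right (f := fun _ => c) (g := φ)).trans h3, ?_⟩
  rw [fullSq_congr s (v := fun x => c * (u x - φ x)) (by
      filter_upwards [Lp.coeFn_smul c u] with x hx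
      simp only [hx, Pi.smul_apply, smul_eq_mul]; ring)]
  have hm : Measurable fun x => u x - φ x :=
    (Lp.stronglyMeasurable u).measurable.sub h1.continuous.measurable
  exact (fullSq_const_mul hm c).trans_lt ((by gcongr : _ ≤ _).trans_lt hδε)

theorem dq_add (u v : E d → ℝ) (p : E d × E d) :
    dq s (fun x => u x + v x) p = dq s u p + dq s v p := by unfold dq; ring

theorem dq_sub (u v : E d → ℝ) (p : E d × E d) :
    dq s (fun x => u x - v x) p = dq s u p - dq s v p := by unfold dq; ring

theorem dq_const_mul (c : ℝ) (u : E d → ℝ) (p : E d × E d) :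
    dq s (fun x => c * u x) p = c * dq s u p := by unfold dq; ring

/-- The space `Hˢ₀(Ω)` as the graph of the weighted difference quotient. -/
def graphSpace (s : ℝ) (Ω : Set (E d)) : Submodule ℝ (WithLp 2 (L2 d × L2P d)) where
  carrier := {w | w.fst ∈ Hs0 s Ω ∧ w.snd =ᵐ[volume] dq s w.fst}
  add_mem' := by
    rintro a b ⟨ha, ha'⟩ ⟨hb, hb'⟩
    refine ⟨add_mem_Hs0 ha hb, ?_⟩
    have h1 := dq_congr s (Lp.coeFn_add a.fst b.fst)
    filter_upwards [ha', hb', h1, Lp.coeFn_add a.snd b.snd] with p h1 h2 h3 h4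
    rw [WithLp.add_fst, WithLp.add_snd, h4, h3, Pi.add_apply, h1, h2]
    exact (dq_add _ _ p).symm
  zero_mem' := by
    refine ⟨zero_mem_Hs0, ?_⟩
    have h1 := dq_congr s (Lp.coeFn_zero ℝ 2 (volume : Measure (E d)))
    filter_upwards [h1, Lp.coeFn_zero ℝ 2 (volume : Measure (E d × E d))] with p h1 h2
    rw [WithLp.zero_fst, WithLp.zero_snd, h1, h2]
    simp [dq]
  smul_mem' := by
    rintro c a ⟨ha, ha'⟩
    refine ⟨smul_mem_Hs0 c ha, ?_⟩
    have h1 := dq_congr s (Lp.coeFn_smul c a.fst)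
    filter_upwards [ha', h1, Lp.coeFn_smul c a.snd] with p h1 h2 h3
    rw [WithLp.smul_fst, WithLp.smul_snd, h3, h2, Pi.smul_apply, h1]
    exact (dq_const_mul c _ p).symm

/-- The Hilbert space `Hˢ₀(Ω)` with the full norm. -/
def HS (s : ℝ) (Ω : Set (E d)) : Type := ↥(graphSpace s Ω)

instance : NormedAddCommGroup (HS s Ω) := inferInstanceAs (NormedAddCommGroup ↥(graphSpace s Ω))

instance : InnerProductSpace ℝ (HS s Ω) := inferInstanceAs (InnerProductSpace ℝ ↥(graphSpace s Ω))

/-- The function underlying an element of `HS`. -/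
def HS.val : HS s Ω →L[ℝ] L2 d :=
  (WithLp.fstL 2 ℝ (L2 d) (L2P d)).comp (graphSpace s Ω).subtypeL

/-- The weighted difference quotient of an element of `HS`. -/
def HS.grad : HS s Ω →L[ℝ] L2P d :=
  (WithLp.sndL 2 ℝ (L2 d) (L2P d)).comp (graphSpace s Ω).subtypeL

theorem HS.val_mem (w : HS s Ω) : w.val ∈ Hs0 s Ω := w.2.1

theorem HS.grad_ae (w : HS s Ω) : w.grad =ᵐ[volume] dq s w.val := w.2.2

theorem HS.norm_sq (w : HS s Ω) : ‖w‖ ^ 2 = ‖w.val‖ ^ 2 + ‖w.grad‖ ^ 2 :=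
  WithLp.prod_norm_sq_eq_of_L2 w.1

theorem HS.norm_grad_le (w : HS s Ω) : ‖w.grad‖ ≤ ‖w‖ := by
  have := w.norm_sq
  exact abs_le_of_sq_le_sq' (by nlinarith [sq_nonneg ‖w.val‖]) (norm_nonneg _) |>.2

theorem Lp_enorm_sq {α : Type*} [MeasurableSpace α] {μ : Measure α} (f : Lp ℝ 2 μ) :
    eLpNorm f 2 μ ^ 2 = ENNReal.ofReal (‖f‖ ^ 2) := by
  rw [← Lp.enorm_def, ← ofReal_norm, ENNReal.ofReal_pow (norm_nonneg _)]

theorem HS.gagliardoSq_val (w : HS s Ω) : gagliardoSq s w.val = ENNReal.ofReal (‖w.grad‖ ^ 2) := by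
  rw [gagliardoSq_eq_eLpNorm, ← eLpNorm_congr_ae w.grad_ae, Lp_enorm_sq]

theorem HS.fullSq_val (w : HS s Ω) : fullSq s w.val = ENNReal.ofReal (‖w‖ ^ 2) := by
  rw [fullSq, w.gagliardoSq_val, Lp_enorm_sq, ← ENNReal.ofReal_add (by positivity) (by positivity),
    w.norm_sq]

theorem HS.fullSq_of_ae {w : HS s Ω} {f : E d → ℝ} (h : w.val =ᵐ[volume] f) :
    fullSq s f = ENNReal.ofReal (‖w‖ ^ 2) := by
  rw [← fullSq_congr s h, w.fullSq_val]

theorem HS.fullSq_sub_of_ae {v w : HS s Ω} {f g : E d → ℝ} (hf : v.val =ᵐ[volume] f)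
    (hg : w.val =ᵐ[volume] g) : fullSq s (fun x => f x - g x) = ENNReal.ofReal (‖v - w‖ ^ 2) := by
  refine HS.fullSq_of_ae ?_
  rw [map_sub]
  filter_upwards [Lp.coeFn_sub v.val w.val, hf, hg] with x h1 h2 h3
  rw [h1, Pi.sub_apply, h2, h3]

theorem HS.hsNorm_val (w : HS s Ω) : hsNorm s w.val = ‖w.grad‖ := by
  rw [hsNorm, w.gagliardoSq_val, ENNReal.toReal_ofReal (by positivity),
    Real.sqrt_sq (norm_nonneg _)]

theorem HS.val_injective : Function.Injective (HS.val : HS s Ω → L2 d) := by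
  intro v w h
  refine Subtype.ext ?_
  refine (WithLp.equiv 2 _).injective (Prod.ext h ?_)
  refine Lp.ext (v.grad_ae.trans (EventuallyEq.trans ?_ w.grad_ae.symm))
  rw [h]

theorem HS.exists_of_fullSq_lt_top {u : L2 d} (hu : u ∈ Hs0 s Ω) (hfin : fullSq s u < ⊤) :
    ∃ w : HS s Ω, w.val = u := by
  have hm : MemLp (dq s u) 2 (volume : Measure (E d × E d)) := by
    refine ⟨(measurable_dq s (Lp.stronglyMeasurable u).measurable).aestronglyMeasurable, ?_⟩
    have := (gagliardoSq_le_fullSq s u).trans_lt hfin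
    rw [gagliardoSq_eq_eLpNorm] at this
    by_contra h
    rw [not_lt, top_le_iff] at h
    simp [h] at this
  exact ⟨⟨WithLp.toLp 2 (u, hm.toLp _), hu, hm.coeFn_toLp⟩, rfl⟩

/-- `Hs0` does not ask for finite energy; it follows because an element lies at finite distance from
a test function, whose energy is finite. -/
theorem HS.exists_val_eq (hd : 0 < d) (hs0 : 0 < s) (hs1 : s < 1) {u : L2 d}
    (hu : u ∈ Hs0 s Ω) : ∃ w : HS s Ω, w.val = u := by
  refine HS.exists_of_fullSq_lt_top hu ?_
  obtain ⟨φ, h1, h2, h3, h4⟩ := hu 1 one_pos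
  have hφ : LipC Ω φ := LipC.of_contDiff h1 h2 h3
  rw [fullSq_neg_sub] at h4
  have hsub := fullSq_add_le (s := s) (v := fun x => u x - φ x) hφ.measurable
  simp only [add_sub_cancel] at hsub
  refine hsub.trans_lt ?_
  have k1 := hφ.fullSq_lt_top hd hs0 hs1
  have k2 : fullSq s (fun x => u x - φ x) < ⊤ := by
    rw [fullSq_neg_sub]; exact h4.trans ENNReal.one_lt_top
  finiteness

/-- Along a subsequence both components converge a.e., and the difference quotient depends
continuously on the two point values, so the limit is again a graph point. Norm convergence in the
graph is then convergence for `fullSq`, and smooth approximations of the sequence also approximate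
the limit. -/
theorem isClosed_graphSpace : IsClosed (graphSpace s Ω : Set (WithLp 2 (L2 d × L2P d))) := by
  refine IsSeqClosed.isClosed fun w a hw ha => ?_
  have hfst : Tendsto (fun n => (w n).fst) atTop (𝓝 a.fst) :=
    ((WithLp.continuous_fst 2 _ _).tendsto a).comp ha
  have hsnd : Tendsto (fun n => (w n).snd) atTop (𝓝 a.snd) :=
    ((WithLp.continuous_snd 2 _ _).tendsto a).comp ha
  have hgrad : a.snd =ᵐ[volume] dq s a.fst := by
    obtain ⟨ns, hns, h1⟩ := (tendstoInMeasure_of_tendsto_Lp hfst).exists_seq_tendsto_ae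
    obtain ⟨ms, hms, h2⟩ := (tendstoInMeasure_of_tendsto_Lp
      (hsnd.comp hns.tendsto_atTop)).exists_seq_tendsto_ae
    have h3 : ∀ᵐ p : E d × E d, ∀ n, (w n).snd p = dq s (w n).fst p :=
      ae_all_iff.2 fun n => (hw n).2
    have h4 := Measure.quasiMeasurePreserving_fst (μ := (volume : Measure (E d)))
      (ν := (volume : Measure (E d))).ae h1
    have h5 := Measure.quasiMeasurePreserving_snd (μ := (volume : Measure (E d)))
      (ν := (volume : Measure (E d))).ae h1
    rw [← Measure.volume_eq_prod] at h4 h5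
    filter_upwards [h2, h3, h4, h5] with p k2 k3 k4 k5
    refine tendsto_nhds_unique k2 ?_
    have : Tendsto (fun i => dq s (w (ns (ms i))).fst p) atTop (𝓝 (dq s a.fst p)) := by
      unfold dq
      exact ((k4.comp hms.tendsto_atTop).sub (k5.comp hms.tendsto_atTop)).mul_const _
    refine this.congr fun i => ?_
    exact (k3 _).symm
  refine ⟨fun ε hε => ?_, hgrad⟩
  have hsq : ∀ n, fullSq s (fun x => a.fst x - (w n).fst x) = ENNReal.ofReal (‖a - w n‖ ^ 2) := by
    intro n
    rw [fullSq, gagliardoSq_eq_eLpNorm, WithLp.prod_norm_sq_eq_of_L2,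
      ENNReal.ofReal_add (by positivity) (by positivity), ← Lp_enorm_sq, ← Lp_enorm_sq]
    congr 2
    · refine eLpNorm_congr_ae ?_
      rw [WithLp.sub_fst]
      exact (Lp.coeFn_sub _ _).symm
    · refine eLpNorm_congr_ae ?_
      rw [WithLp.sub_snd]
      filter_upwards [hgrad, (hw n).2, Lp.coeFn_sub a.snd (w n).snd] with p k1 k2 k3
      rw [k3, Pi.sub_apply, k1, k2]
      exact dq_sub _ _ p
  obtain ⟨δ, hδ, hδε⟩ := exists_pos_mul_lt_ennreal hε 4
  have hlim : Tendsto (fun n => ENNReal.ofReal (‖a - w n‖ ^ 2)) atTop (𝓝 0) := by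
    have : Tendsto (fun n => ‖a - w n‖ ^ 2) atTop (𝓝 0) := by
      have := (tendsto_iff_norm_sub_tendsto_zero.1 ha).pow 2
      simpa [norm_sub_rev] using this
    have := (ENNReal.continuous_ofReal.tendsto _).comp this
    rwa [ENNReal.ofReal_zero] at this
  obtain ⟨n, hn⟩ := (hlim.eventually (gt_mem_nhds hδ)).exists
  obtain ⟨φ, h1, h2, h3, h4⟩ := (hw n).1 δ hδ
  refine ⟨φ, h1, h2, h3, ?_⟩
  have hm : Measurable fun x => a.fst x - (w n).fst x :=
    (Lp.stronglyMeasurable _).measurable.sub (Lp.stronglyMeasurable _).measurable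
  have := fullSq_add_le (s := s) (v := fun x => (w n).fst x - φ x) hm
  simp only [sub_add_sub_cancel] at this
  calc _ ≤ _ := this
    _ ≤ 2 * δ + 2 * δ := by
        rw [hsq]; gcongr
    _ = ENNReal.ofReal 4 * δ := by
        rw [← add_mul]; congr 1; rw [show (4 : ℝ) = ((4 : ℕ) : ℝ) by norm_num, ENNReal.ofReal_natCast]
        norm_num
    _ < ε := hδε

instance : CompleteSpace (HS s Ω) := isClosed_graphSpace.completeSpace_coe

/-- A bounded sequence in `Hˢ₀(Ω)` that converges in `L²` has its limit in `Hˢ₀(Ω)`; closed convex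
conditions pass to the limit. -/
theorem HS.exists_val_eq_of_tendsto {w : ℕ → HS s Ω} {R : ℝ} (hR : ∀ n, ‖w n‖ ≤ R) {u : L2 d}
    (hu : Tendsto (fun n => (w n).val) atTop (𝓝 u)) :
    ∃ v : HS s Ω, v.val = u ∧ ‖v‖ ≤ R ∧
      ∀ C : Set (HS s Ω), IsClosed C → Convex ℝ C → (∀ᶠ n in atTop, w n ∈ C) → v ∈ C := by
  -- A point common to the closed convex hulls of all tails plays the role of a weak cluster point.
  let C : ℕ → Set (HS s Ω) := fun n => closure (convexHull ℝ (w '' Ici n))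
  have hanti : Antitone C := fun m n h =>
    closure_mono (convexHull_mono (image_mono (Ici_subset_Ici.2 h)))
  obtain ⟨v, hv, hvR⟩ := exists_forall_mem_of_antitone hanti (fun n => isClosed_closure)
    (fun n => (convex_convexHull ℝ _).closure) (R := R) fun n =>
      ⟨w n, subset_closure (subset_convexHull ℝ _ ⟨n, mem_Ici.2 le_rfl, rfl⟩), hR n⟩
  have hC : ∀ D : Set (HS s Ω), IsClosed D → Convex ℝ D → (∀ᶠ n in atTop, w n ∈ D) → v ∈ D := by
    intro D hD1 hD2 hD3
    obtain ⟨n, hn⟩ := eventually_atTop.1 hD3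
    refine closure_minimal (convexHull_min ?_ hD2) hD1 (hv n)
    rintro _ ⟨m, hm, rfl⟩
    exact hn m hm
  refine ⟨v, ?_, hvR, hC⟩
  rw [← dist_le_zero]
  refine le_of_forall_pos_le_add fun ε hε => ?_
  rw [zero_add]
  -- The preimage of a ball around the L² limit is closed, convex and contains a tail of the
  -- sequence, so it contains v.
  have := hC (HS.val ⁻¹' Metric.closedBall u ε) (Metric.isClosed_closedBall.preimage
    HS.val.continuous) ((convex_closedBall u ε).is_linear_preimage HS.val.toLinearMap.isLinear) (by
      filter_upwards [hu.eventually (Metric.closedBall_mem_nhds u hε)] with n hn using hn)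
  exact this

end Space

end

section

variable {d : ℕ} {s : ℝ} {Ω : Set (E d)}

/-! ### Approximation, lattice operations and multiplication by cut-offs -/

section Density

theorem HS.exists_of_contDiff (hd : 0 < d) (hs0 : 0 < s) (hs1 : s < 1) {φ : E d → ℝ}
    (h : ContDiff ℝ ∞ φ) (hc : HasCompactSupport φ) (hs : tsupport φ ⊆ Ω) :
    ∃ w : HS s Ω, w.val =ᵐ[volume] φ := by
  have hL : LipC Ω φ := LipC.of_contDiff h hc hs
  have hmem : hL.memLp.toLp φ ∈ Hs0 s Ω := by
    intro ε hε
    refine ⟨φ, h, hc, hs, ?_⟩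
    rw [fullSq_congr s (v := fun _ => (0 : ℝ)) (by
      filter_upwards [hL.memLp.coeFn_toLp] with x hx
      simp [hx]), fullSq_zero]
    exact hε
  obtain ⟨w, hw⟩ := HS.exists_val_eq hd hs0 hs1 hmem
  exact ⟨w, hw ▸ hL.memLp.coeFn_toLp⟩

theorem tendsto_L2_of_abs_sub_le {f : ℕ → L2 d} {g : L2 d} {φ : ℕ → E d → ℝ} {θ : E d → ℝ}
    (hf : ∀ n, f n =ᵐ[volume] φ n) (hg : g =ᵐ[volume] θ) {ε : ℕ → ℝ} {R : ℝ}
    (hφ : ∀ n x, |φ n x - θ x| ≤ ε n)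
    (hR : ∀ n x, x ∉ Metric.closedBall (0 : E d) R → φ n x = θ x) (hε : Tendsto ε atTop (𝓝 0)) :
    Tendsto f atTop (𝓝 g) := by
  have hball : MeasurableSet (Metric.closedBall (0 : E d) R) :=
    Metric.isClosed_closedBall.measurableSet
  let h : L2 d := indicatorConstLp 2 hball (measure_closedBall_lt_top (μ := volume)).ne (1 : ℝ)
  have hh : h =ᵐ[volume] (Metric.closedBall (0 : E d) R).indicator fun _ => (1 : ℝ) :=
    indicatorConstLp_coeFn
  rw [tendsto_iff_norm_sub_tendsto_zero]
  refine squeeze_zero (fun n => norm_nonneg _) (fun n => ?_) (by simpa using hε.mul_const ‖h‖)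
  refine Lp.norm_le_mul_norm_of_ae_le_mul ?_
  filter_upwards [hf n, hg, hh, Lp.coeFn_sub (f n) g] with x h1 h2 h3 h4
  rw [h4, Pi.sub_apply, h1, h2, h3]
  by_cases hx : x ∈ Metric.closedBall (0 : E d) R
  · simpa [hx] using hφ n x
  · simp [hx, hR n x hx]

/-- Lipschitz functions with compact support in `Ω` belong to `Hˢ₀(Ω)`. -/
theorem LipC.exists_HS (hd : 0 < d) (hs0 : 0 < s) (hs1 : s < 1) (hΩ : IsOpen Ω) {φ : E d → ℝ}
    (h : LipC Ω φ) : ∃ w : HS s Ω, w.val =ᵐ[volume] φ := by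
  obtain ⟨δ, hδ, hsub⟩ := h.compact.isCompact.exists_cthickening_subset_open hΩ h.subset
  obtain ⟨L, hL⟩ := h.lip
  obtain ⟨B, hB⟩ := h.bounded
  have hK : IsCompact (Metric.cthickening δ (tsupport φ)) :=
    IsCompact.cthickening h.compact.isCompact
  obtain ⟨R, hR⟩ := hK.isBounded.subset_closedBall 0
  let r : ℕ → ℝ := fun n => δ / (n + 1)
  have hr0 : ∀ n, 0 < r n := fun n => by positivity
  have hrδ : ∀ n, r n ≤ δ := fun n => div_le_self hδ.le (by linarith [(n.cast_nonneg : (0:ℝ) ≤ n)])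
  have hrlim : Tendsto r atTop (𝓝 0) := by
    have := (tendsto_one_div_add_atTop_nhds_zero_nat (𝕜 := ℝ)).const_mul δ
    simpa [r, div_eq_mul_inv] using this
  let ρ : ℕ → ContDiffBump (0 : E d) := fun n =>
    ⟨r n / 2, r n, half_pos (hr0 n), half_lt_self (hr0 n)⟩
  let φn : ℕ → E d → ℝ := fun n =>
    convolution ((ρ n).normed volume) φ (ContinuousLinearMap.lsmul ℝ ℝ) volume
  have hclose : ∀ n x, |φn n x - φ x| ≤ L * r n := by
    intro n x
    rw [← Real.dist_eq]
    refine ContDiffBump.dist_normed_convolution_le h.continuous.aestronglyMeasurable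
      fun y hy => (hL.dist_le_mul y x).trans ?_
    gcongr
    exact (Metric.mem_ball.1 hy).le
  have hsupp : ∀ n, Function.support (φn n) ⊆ Metric.cthickening δ (tsupport φ) := by
    intro n
    refine (support_convolution_subset _).trans ?_
    rintro _ ⟨a, ha, b, hb, rfl⟩
    rw [(ρ n).support_normed_eq, mem_ball_zero_iff] at ha
    refine Metric.mem_cthickening_of_dist_le _ b _ _ (subset_tsupport _ hb) ?_
    simpa using ha.le.trans (hrδ n)
  have htsupp : ∀ n, tsupport (φn n) ⊆ Metric.cthickening δ (tsupport φ) := fun n =>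
    closure_minimal (hsupp n) Metric.isClosed_cthickening
  have hsmooth : ∀ n, ContDiff ℝ ∞ (φn n) := fun n =>
    HasCompactSupport.contDiff_convolution_left _ (ρ n).hasCompactSupport_normed
      (ρ n).contDiff_normed h.continuous.locallyIntegrable
  have hcomp : ∀ n, HasCompactSupport (φn n) := fun n =>
    hK.of_isClosed_subset (isClosed_tsupport _) (htsupp n)
  -- Averaging against a probability density keeps the Lipschitz constant. With the common support
  -- this bounds the energies uniformly.
  have hlip : ∀ n, LipschitzWith L (φn n) := by
    intro n
    have hi : ∀ x, Integrable (fun t => (ρ n).normed volume t * φ (x - t)) volume := fun x =>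
      (((ρ n).continuous_normed).mul (h.continuous.comp (continuous_const.sub continuous_id))
        ).integrable_of_hasCompactSupport ((ρ n).hasCompactSupport_normed.mul_right)
    refine LipschitzWith.of_dist_le_mul fun x y => ?_
    rw [Real.dist_eq]
    have e : ∀ x, φn n x = ∫ t, (ρ n).normed volume t * φ (x - t) := fun x => by
      simp [φn, convolution]
    rw [e, e, ← integral_sub (hi x) (hi y)]
    calc |∫ t, ((ρ n).normed volume t * φ (x - t) - (ρ n).normed volume t * φ (y - t))|
        ≤ ∫ t, (ρ n).normed volume t * (L * dist x y) := by
          have hri : Integrable (fun t => (ρ n).normed volume t * (L * dist x y)) volume :=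
            ((ρ n).integrable_normed (μ := volume)).mul_const _
          rw [← Real.norm_eq_abs]
          refine norm_integral_le_of_norm_le hri (Eventually.of_forall fun t => ?_)
          rw [← mul_sub, Real.norm_eq_abs, abs_mul, abs_of_nonneg ((ρ n).nonneg_normed t)]
          refine mul_le_mul_of_nonneg_left ?_ ((ρ n).nonneg_normed t)
          have := hL.dist_le_mul (x - t) (y - t)
          rwa [Real.dist_eq, dist_sub_right] at this
      _ = L * dist x y := by
          rw [integral_mul_const, (ρ n).integral_normed, one_mul]
  obtain ⟨M, hM0, hM⟩ := exists_fullSq_le_of_lipschitz (s := s) hd hs0 hs1 L (B + L * δ) R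
  have hzero : ∀ n x, x ∉ Metric.closedBall (0 : E d) R → φn n x = 0 := fun n x hx =>
    image_eq_zero_of_notMem_tsupport fun h' => hx (hR (htsupp n h'))
  have hbd : ∀ n x, |φn n x| ≤ B + L * δ := fun n x => by
    have h1 := hclose n x
    have h2 := abs_sub_abs_le_abs_sub (φn n x) (φ x)
    have h3 : L * r n ≤ L * δ := by gcongr; exact hrδ n
    linarith [hB x]
  choose w hw using fun n => HS.exists_of_contDiff (s := s) hd hs0 hs1 (hsmooth n) (hcomp n)
    ((htsupp n).trans hsub)
  have hwR : ∀ n, ‖w n‖ ≤ √M := fun n => by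
    have := hM (φn n) (hlip n) (hbd n) (hzero n)
    rw [HS.fullSq_of_ae (hw n), ENNReal.ofReal_le_ofReal_iff hM0] at this
    exact Real.le_sqrt_of_sq_le this
  -- Energy convergence of the mollified functions is not needed: bounded energy and L² convergence
  -- suffice.
  obtain ⟨v, hv, -⟩ := HS.exists_val_eq_of_tendsto hwR (u := h.memLp.toLp φ)
    (tendsto_L2_of_abs_sub_le hw h.memLp.coeFn_toLp hclose (R := R) (fun n x hx => by
      rw [hzero n x hx]
      exact (image_eq_zero_of_notMem_tsupport fun h' =>
        hx (hR (Metric.self_subset_cthickening _ h'))).symm) (by simpa using hrlim.const_mul (L : ℝ)))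
  exact ⟨v, hv ▸ h.memLp.coeFn_toLp⟩

theorem HS.exists_lipC_near (hd : 0 < d) (hs0 : 0 < s) (hs1 : s < 1) (v : HS s Ω) {ε : ℝ}
    (hε : 0 < ε) : ∃ (φ : E d → ℝ) (w : HS s Ω), LipC Ω φ ∧ w.val =ᵐ[volume] φ ∧ ‖v - w‖ < ε := by
  obtain ⟨φ, h1, h2, h3, h4⟩ := v.val_mem (ENNReal.ofReal (ε ^ 2)) (by simpa using by positivity)
  obtain ⟨w, hw⟩ := HS.exists_of_contDiff (s := s) hd hs0 hs1 h1 h2 h3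
  refine ⟨φ, w, LipC.of_contDiff h1 h2 h3, hw, ?_⟩
  rw [HS.fullSq_sub_of_ae (ae_eq_refl _) hw, ENNReal.ofReal_lt_ofReal_iff (by positivity)] at h4
  exact lt_of_pow_lt_pow_left₀ 2 hε.le h4

theorem HS.exists_lipC_seq (hd : 0 < d) (hs0 : 0 < s) (hs1 : s < 1) (v : HS s Ω) :
    ∃ (φ : ℕ → E d → ℝ) (w : ℕ → HS s Ω), (∀ n, LipC Ω (φ n)) ∧ (∀ n, (w n).val =ᵐ[volume] φ n) ∧
      (∀ n, ‖v - w n‖ ≤ 1) ∧ Tendsto w atTop (𝓝 v) := by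
  choose φ w h1 h2 h3 using fun n : ℕ => v.exists_lipC_near hd hs0 hs1
    (Nat.one_div_pos_of_nat (α := ℝ) (n := n))
  refine ⟨φ, w, h1, h2, fun n => (h3 n).le.trans ?_, ?_⟩
  · exact div_le_self zero_le_one (by linarith [(n.cast_nonneg : (0:ℝ) ≤ n)])
  · rw [tendsto_iff_norm_sub_tendsto_zero]
    refine squeeze_zero (fun n => norm_nonneg _) (fun n => ?_)
      (tendsto_one_div_add_atTop_nhds_zero_nat (𝕜 := ℝ))
    rw [norm_sub_rev]; exact (h3 n).le

/-- Superposition operators that are Lipschitz in the second variable and bounded for the energy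
act on `Hˢ₀(Ω)`. -/
theorem HS.exists_superposition (hd : 0 < d) (hs0 : 0 < s) (hs1 : s < 1) (hΩ : IsOpen Ω)
    {τ : E d → ℝ → ℝ} (hm : Measurable fun p : E d × ℝ => τ p.1 p.2) {B A : ℝ}
    (hB : ∀ x a b, |τ x a - τ x b| ≤ B * |a - b|) (h0 : ∀ x, τ x 0 = 0)
    (hlip : ∀ φ, LipC Ω φ → LipC Ω fun x => τ x (φ x)) (hA0 : 0 ≤ A)
    (hA : ∀ φ : E d → ℝ, Measurable φ →
      fullSq s (fun x => τ x (φ x)) ≤ ENNReal.ofReal (A ^ 2) * fullSq s φ) (v : HS s Ω) :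
    ∃ w : HS s Ω, (w.val =ᵐ[volume] fun x => τ x (v.val x)) ∧ ‖w‖ ≤ A * ‖v‖ := by
  obtain ⟨φ, w, h1, h2, h3, h4⟩ := v.exists_lipC_seq hd hs0 hs1
  -- The superposition need not be continuous in the energy norm. Its values on Lipschitz
  -- approximations are bounded in energy and converge in L², which places the limit in the space.
  choose t ht using fun n => (hlip _ (h1 n)).exists_HS (s := s) hd hs0 hs1 hΩ
  have hbound : ∀ (a b : HS s Ω) (f : E d → ℝ), Measurable f → a.val =ᵐ[volume] f →
      (b.val =ᵐ[volume] fun x => τ x (f x)) → ‖b‖ ≤ A * ‖a‖ := by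
    intro a b f hf ha hb
    have := hA f hf
    rw [HS.fullSq_of_ae ha, HS.fullSq_of_ae hb, ← ENNReal.ofReal_mul (by positivity), ← mul_pow,
      ENNReal.ofReal_le_ofReal_iff (by positivity)] at this
    exact abs_le_of_sq_le_sq' this (by positivity) |>.2
  have hvm : Measurable v.val := (Lp.stronglyMeasurable _).measurable
  have hmv : Measurable fun x => τ x (v.val x) := hm.comp (measurable_id.prodMk hvm)
  have hLp : MemLp (fun x => τ x (v.val x)) 2 (volume : Measure (E d)) := by
    refine (Lp.memLp v.val).of_le_mul hmv.aestronglyMeasurable (c := B)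
      (Eventually.of_forall fun x => ?_)
    have := hB x (v.val x) 0
    rwa [h0, sub_zero, sub_zero] at this
  have htR : ∀ n, ‖t n‖ ≤ A * (‖v‖ + 1) := fun n =>
    (hbound _ _ _ (h1 n).measurable (h2 n) (ht n)).trans (by
      gcongr
      have := norm_sub_norm_le (w n) v
      rw [norm_sub_rev] at this
      linarith [h3 n])
  have hlim : Tendsto (fun n => (t n).val) atTop (𝓝 (hLp.toLp _)) := by
    rw [tendsto_iff_norm_sub_tendsto_zero]
    have hw : Tendsto (fun n => B * ‖(w n).val - v.val‖) atTop (𝓝 0) := by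
      have := (tendsto_iff_norm_sub_tendsto_zero.1
        ((HS.val.continuous.tendsto v).comp h4)).const_mul B
      simpa using this
    refine squeeze_zero (fun n => norm_nonneg _) (fun n => ?_) hw
    refine Lp.norm_le_mul_norm_of_ae_le_mul ?_
    filter_upwards [ht n, h2 n, hLp.coeFn_toLp, Lp.coeFn_sub (t n).val (hLp.toLp _),
      Lp.coeFn_sub (w n).val v.val] with x k1 k2 k3 k4 k5
    rw [k4, k5, Pi.sub_apply, Pi.sub_apply, k1, k2, k3]
    exact hB x _ _
  obtain ⟨u, hu, -⟩ := HS.exists_val_eq_of_tendsto htR hlim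
  have hu' : u.val =ᵐ[volume] fun x => τ x (v.val x) := hu ▸ hLp.coeFn_toLp
  -- The norm bound comes from applying the energy estimate to v itself; the limit would only give
  -- A(‖v‖ + 1).
  exact ⟨u, hu', hbound v u _ hvm (ae_eq_refl _) hu'⟩

theorem HS.measurable_val (v : HS s Ω) : Measurable v.val :=
  (Lp.stronglyMeasurable _).measurable

theorem HS.exists_pos (hd : 0 < d) (hs0 : 0 < s) (hs1 : s < 1) (hΩ : IsOpen Ω) (v : HS s Ω) :
    ∃ w : HS s Ω, (w.val =ᵐ[volume] fun x => max (v.val x) 0) ∧ ‖w‖ ≤ ‖v‖ := by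
  have hc : ∀ a b : ℝ, |max a 0 - max b 0| ≤ |a - b| := fun a b => abs_max_sub_max_le_abs a b 0
  obtain ⟨w, h1, h2⟩ := HS.exists_superposition hd hs0 hs1 hΩ (τ := fun _ a => max a 0) (B := 1)
    (A := 1) (by fun_prop) (fun x a b => by simpa using hc a b) (fun x => by simp)
    (fun φ hφ => hφ.pos) zero_le_one (fun φ hφ => by
      have := fullSq_le_of (s := s) (v := φ) (w := fun x => max (φ x) 0) hφ (A := 1) (B := 0)
        (by norm_num) le_rfl (fun x => by
          have := sq_le_sq.2 (hc (φ x) 0)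
          simpa using this) (fun x y => by
          have := sq_le_sq.2 (hc (φ x) (φ y))
          simpa using this)
      simpa using this) v
  exact ⟨w, h1, by simpa using h2⟩

theorem sq_max_sub_max_le (a b a' b' : ℝ) :
    (max a b - max a' b') ^ 2 ≤ (a - a') ^ 2 + (b - b') ^ 2 := by
  have := abs_max_sub_max_le_max a b a' b'
  rcases max_choice |a - a'| |b - b'| with h | h <;> rw [h] at this <;>
    nlinarith [sq_le_sq.2 this, sq_nonneg (a - a'), sq_nonneg (b - b')]

/-- Membership follows from max(u,v) = (u - v)⁺ + v. The norm estimate is proved directly from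
`sq_max_sub_max_le`: with no extra constant in front of the squares, it makes the capacity
subadditive. -/
theorem HS.exists_max (hd : 0 < d) (hs0 : 0 < s) (hs1 : s < 1) (hΩ : IsOpen Ω) (u v : HS s Ω) :
    ∃ w : HS s Ω, (w.val =ᵐ[volume] fun x => max (u.val x) (v.val x)) ∧
      ‖w‖ ^ 2 ≤ ‖u‖ ^ 2 + ‖v‖ ^ 2 := by
  obtain ⟨w, hw, -⟩ := (u - v).exists_pos hd hs0 hs1 hΩ
  have e : (w + v).val =ᵐ[volume] fun x => max (u.val x) (v.val x) := by
    rw [map_add]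
    rw [map_sub] at hw
    filter_upwards [hw, Lp.coeFn_add w.val v.val, Lp.coeFn_sub u.val v.val] with x h1 h2 h3
    rw [h2, Pi.add_apply, h1, h3, Pi.sub_apply, ← max_add_add_right, sub_add_cancel, zero_add]
  refine ⟨w + v, e, ?_⟩
  have := fullSq_le_of (s := s) (u := u.val) (v := v.val) u.measurable_val (A := 1) (B := 1)
    (by norm_num) (by norm_num) (fun x => by
      have := sq_max_sub_max_le (u.val x) (v.val x) 0 0
      simpa using this) (fun x y => by
      have := sq_max_sub_max_le (u.val x) (v.val x) (u.val y) (v.val y)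
      simpa using this)
  rw [HS.fullSq_of_ae e, u.fullSq_val, v.fullSq_val, ENNReal.ofReal_one, one_mul, one_mul,
    ← ENNReal.ofReal_add (by positivity) (by positivity),
    ENNReal.ofReal_le_ofReal_iff (by positivity)] at this
  exact this

/-- Split θ(x)φ(x) - θ(y)φ(y) = θ(x)(φ(x) - φ(y)) + φ(y)(θ(x) - θ(y)). The first term is controlled
by the energy of φ. In the second, the increment of θ tames the weight, whose integral in x is
finite and independent of y, leaving the L² norm of φ. -/
theorem exists_fullSq_mul_le (hd : 0 < d) (hs0 : 0 < s) (hs1 : s < 1) {θ : E d → ℝ}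
    (hθ : LipC Ω θ) : ∃ A : ℝ, 0 ≤ A ∧ ∀ φ : E d → ℝ, Measurable φ →
      fullSq s (fun x => θ x * φ x) ≤ ENNReal.ofReal (A ^ 2) * fullSq s φ := by
  obtain ⟨L, hL⟩ := hθ.lip
  obtain ⟨B, hB⟩ := hθ.bounded
  set I := ∫⁻ h : E d, ENNReal.ofReal (min (‖h‖ ^ 2) 1 * radialWeight d s ‖h‖ ^ 2) with hI
  have hItop : I < ⊤ := lintegral_min_radialWeight_lt_top hd hs0 hs1
  let A₀ : ℝ := L ^ 2 + 4 * B ^ 2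
  let M : ℝ≥0∞ := ENNReal.ofReal (B ^ 2) + ENNReal.ofReal (2 * B ^ 2) +
    ENNReal.ofReal (2 * A₀) * I
  have hM : M ≠ ⊤ := by
    have h1 : ENNReal.ofReal (B ^ 2) < ⊤ := ENNReal.ofReal_lt_top
    have h2 : ENNReal.ofReal (2 * B ^ 2) < ⊤ := ENNReal.ofReal_lt_top
    have h3 : ENNReal.ofReal (2 * A₀) < ⊤ := ENNReal.ofReal_lt_top
    simp only [M]; finiteness
  refine ⟨√M.toReal, Real.sqrt_nonneg _, fun φ hφ => ?_⟩
  rw [Real.sq_sqrt ENNReal.toReal_nonneg, ENNReal.ofReal_toReal hM]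
  let m : E d → ℝ := fun h => √(min (‖h‖ ^ 2) 1) * radialWeight d s ‖h‖
  have hm2 : ∀ h, ‖m h‖ₑ ^ 2 = ENNReal.ofReal (min (‖h‖ ^ 2) 1 * radialWeight d s ‖h‖ ^ 2) := by
    intro h
    rw [← ofReal_norm, ← ENNReal.ofReal_pow (norm_nonneg _), Real.norm_eq_abs, sq_abs]
    simp only [m]
    rw [mul_pow, Real.sq_sqrt (by positivity)]
  have hmm : Measurable m := by
    have := measurable_radialWeight (d := d) s
    simp only [m]; fun_prop
  have hB2 : ∀ x, θ x ^ 2 ≤ B ^ 2 := fun x => sq_le_sq' (abs_le.1 (hB x)).1 (abs_le.1 (hB x)).2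
  have h1 : eLpNorm (fun x => θ x * φ x) 2 volume ^ 2 ≤
      ENNReal.ofReal (B ^ 2) * eLpNorm φ 2 volume ^ 2 := by
    simp only [eLpNorm_two_sq]
    rw [← lintegral_const_mul' _ _ ENNReal.ofReal_ne_top]
    refine lintegral_mono fun x => ?_
    have := enorm_sq_le (a := θ x * φ x) (b := φ x) (c := 0) (sq_nonneg B) le_rfl (by
      rw [mul_pow]; have := mul_le_mul_of_nonneg_right (hB2 x) (sq_nonneg (φ x)); linarith)
    simpa using this
  have h2 : gagliardoSq s (fun x => θ x * φ x) ≤ ENNReal.ofReal (2 * B ^ 2) * gagliardoSq s φ +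
      ENNReal.ofReal (2 * A₀) * (I * eLpNorm φ 2 volume ^ 2) := by
    have hpt : ∀ p : E d × E d, ‖dq s (fun x => θ x * φ x) p‖ₑ ^ 2 ≤
        ENNReal.ofReal (2 * B ^ 2) * ‖dq s φ p‖ₑ ^ 2 +
        ENNReal.ofReal (2 * A₀) * ‖φ p.2 * m (p.1 - p.2)‖ₑ ^ 2 := by
      intro p
      have hA₀ : 0 ≤ A₀ := by simp only [A₀]; positivity
      refine enorm_sq_le (by positivity) (by positivity) ?_
      have hA : (θ p.1 - θ p.2) ^ 2 ≤ A₀ * min (‖p.1 - p.2‖ ^ 2) 1 := by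
        have h1 : |θ p.1 - θ p.2| ≤ L * ‖p.1 - p.2‖ := by
          have := hL.dist_le_mul p.1 p.2
          rwa [Real.dist_eq, dist_eq_norm] at this
        have h2 : |θ p.1 - θ p.2| ≤ 2 * B :=
          (abs_sub _ _).trans (by linarith [hB p.1, hB p.2])
        have h1' : (θ p.1 - θ p.2) ^ 2 ≤ L ^ 2 * ‖p.1 - p.2‖ ^ 2 := by
          rw [← mul_pow, ← sq_abs]; exact pow_le_pow_left₀ (abs_nonneg _) h1 2
        have h2' : (θ p.1 - θ p.2) ^ 2 ≤ 4 * B ^ 2 := by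
          rw [show 4 * B ^ 2 = (2 * B) ^ 2 by ring, ← sq_abs]
          exact pow_le_pow_left₀ (abs_nonneg _) h2 2
        simp only [A₀]
        rcases le_total (‖p.1 - p.2‖ ^ 2) 1 with h | h
        · rw [min_eq_left h]; nlinarith [sq_nonneg B, sq_nonneg ‖p.1 - p.2‖]
        · rw [min_eq_right h]; nlinarith [sq_nonneg (L : ℝ)]
      simp only [dq, m, mul_pow]
      rw [Real.sq_sqrt (by positivity)]
      set W := radialWeight d s ‖p.1 - p.2‖ ^ 2
      have hW : 0 ≤ W := sq_nonneg _
      have e1 : (θ p.1 * φ p.1 - θ p.2 * φ p.2) ^ 2 ≤ 2 * B ^ 2 * (φ p.1 - φ p.2) ^ 2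
          + 2 * A₀ * (φ p.2 ^ 2 * min (‖p.1 - p.2‖ ^ 2) 1) := by
        have k1 := mul_le_mul_of_nonneg_right (hB2 p.1) (sq_nonneg (φ p.1 - φ p.2))
        have k2 := mul_le_mul_of_nonneg_right hA (sq_nonneg (φ p.2))
        nlinarith [sq_nonneg (θ p.1 * (φ p.1 - φ p.2) - φ p.2 * (θ p.1 - θ p.2))]
      nlinarith [mul_le_mul_of_nonneg_right e1 hW]
    have i2 : ∫⁻ p : E d × E d, ‖φ p.2 * m (p.1 - p.2)‖ₑ ^ 2 = I * eLpNorm φ 2 volume ^ 2 := by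
      simp only [enorm_mul, mul_pow]
      rw [Measure.volume_eq_prod, lintegral_prod_symm _ (by fun_prop)]
      have : ∀ y : E d, ∫⁻ x, ‖φ y‖ₑ ^ 2 * ‖m (x - y)‖ₑ ^ 2 = ‖φ y‖ₑ ^ 2 * I := fun y => by
        rw [lintegral_const_mul' _ _ (by simp), lintegral_sub_right_eq_self (fun x => ‖m x‖ₑ ^ 2) y]
        simp only [hm2, hI]
      simp only [this]
      rw [lintegral_mul_const _ (by fun_prop), eLpNorm_two_sq, mul_comm]
    simp only [gagliardoSq_eq_lintegral]
    rw [← i2, ← lintegral_const_mul' _ _ ENNReal.ofReal_ne_top,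
      ← lintegral_const_mul' _ _ ENNReal.ofReal_ne_top,
      ← lintegral_add_left (((measurable_dq s hφ).enorm.pow_const 2).const_mul _)]
    exact lintegral_mono hpt
  unfold fullSq
  calc _ ≤ ENNReal.ofReal (B ^ 2) * eLpNorm φ 2 volume ^ 2 +
        (ENNReal.ofReal (2 * B ^ 2) * gagliardoSq s φ +
        ENNReal.ofReal (2 * A₀) * (I * eLpNorm φ 2 volume ^ 2)) := add_le_add h1 h2
    _ ≤ ENNReal.ofReal (B ^ 2) * (eLpNorm φ 2 volume ^ 2 + gagliardoSq s φ) +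
        (ENNReal.ofReal (2 * B ^ 2) * (eLpNorm φ 2 volume ^ 2 + gagliardoSq s φ) +
        ENNReal.ofReal (2 * A₀) * (I * (eLpNorm φ 2 volume ^ 2 + gagliardoSq s φ))) := by
        gcongr
        · exact le_self_add
        · exact le_add_self
        · exact le_self_add
    _ = _ := by simp only [M]; ring

theorem HS.exists_mul (hd : 0 < d) (hs0 : 0 < s) (hs1 : s < 1) (hΩ : IsOpen Ω) {θ : E d → ℝ}
    (hθ : LipC Ω θ) (v : HS s Ω) : ∃ w : HS s Ω, w.val =ᵐ[volume] fun x => θ x * v.val x := by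
  obtain ⟨A, hA0, hA⟩ := exists_fullSq_mul_le hd hs0 hs1 hθ
  obtain ⟨B, hB⟩ := hθ.bounded
  have hm : Measurable fun p : E d × ℝ => θ p.1 * p.2 := by
    have := hθ.measurable
    fun_prop
  obtain ⟨w, h, -⟩ := HS.exists_superposition hd hs0 hs1 hΩ (τ := fun x a => θ x * a) hm (B := B)
    (fun x a b => by rw [← mul_sub, abs_mul]; gcongr; exact hB x) (fun x => by simp)
    (fun φ hφ => hθ.mul hφ) hA0 hA v
  exact ⟨w, h⟩

end Density

/-! ### Equivalence of the seminorm and the full norm -/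

section Poincare

theorem HS.val_eq_zero (v : HS s Ω) (hΩ : MeasurableSet Ω) : ∀ᵐ x, x ∉ Ω → v.val x = 0 := by
  have h0 : ∀ n : ℕ, eLpNorm (Ωᶜ.indicator v.val) 2 volume ^ 2 ≤ (1 / (n + 1) : ℝ≥0∞) := by
    intro n
    obtain ⟨φ, h1, h2, h3, h4⟩ := v.val_mem (1 / (n + 1)) (by simp)
    refine le_trans ?_ (le_self_add.trans h4.le)
    gcongr
    refine eLpNorm_mono_enorm fun x => ?_
    by_cases hx : x ∈ Ω
    · simp [hx]
    · rw [indicator_of_mem (by simpa using hx), image_eq_zero_of_notMem_tsupport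
        fun h => hx (h3 h), sub_zero]
  have h1 : eLpNorm (Ωᶜ.indicator v.val) 2 volume ^ 2 = 0 := by
    refine le_antisymm (ge_of_tendsto' (x := atTop)
      (f := fun n : ℕ => (1 / (n + 1) : ℝ≥0∞)) ?_ h0) zero_le
    have := ENNReal.tendsto_inv_nat_nhds_zero.comp (tendsto_add_atTop_nat 1)
    simpa [Function.comp_def] using this
  rw [pow_eq_zero_iff (by norm_num), eLpNorm_eq_zero_iff
    (v.measurable_val.indicator hΩ.compl).aestronglyMeasurable (by norm_num)] at h1
  filter_upwards [h1] with x hx hxΩ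
  rwa [indicator_of_mem (by simpa using hxΩ)] at hx

/-- The operator is coercive only for the difference quotient; this inequality turns that into
coercivity in the Hilbert norm. -/
theorem HS.exists_norm_le_grad (hd : 0 < d) (hs0 : 0 < s) (hΩ : IsOpen Ω)
    (hΩb : Bornology.IsBounded Ω) : ∃ C : ℝ, 0 < C ∧ ∀ v : HS s Ω, ‖v‖ ^ 2 ≤ C * ‖v.grad‖ ^ 2 := by
  obtain ⟨C, hC, h⟩ := exists_poincare hd hs0 hΩb
  refine ⟨C + 1, by positivity, fun v => ?_⟩
  have := h v.val v.measurable_val (v.val_eq_zero hΩ.measurableSet)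
  rw [v.gagliardoSq_val, Lp_enorm_sq, ← ENNReal.ofReal_mul hC.le,
    ENNReal.ofReal_le_ofReal_iff (by positivity)] at this
  rw [v.norm_sq]; linarith

end Poincare

end

section

variable {d : ℕ} {s : ℝ} {Ω : Set (E d)}

/-- The standing assumptions on the dimension, the order and the domain. -/
structure Admissible (s : ℝ) (Ω : Set (E d)) : Prop where
  dim_pos : 0 < d
  pos : 0 < s
  lt_one : s < 1
  isOpen : IsOpen Ω
  bounded : Bornology.IsBounded Ω

/-! ### Closed convex sets given by a.e. inequalities -/

section AeOrder

theorem isClosed_setOf_ae_le (c : E d → ℝ) (F : Set (E d)) :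
    IsClosed {v : HS s Ω | ∀ᵐ x, x ∈ F → c x ≤ v.val x} := by
  refine IsSeqClosed.isClosed fun w a hw ha => ?_
  have h1 : Tendsto (fun n => (w n).val) atTop (𝓝 a.val) := (HS.val.continuous.tendsto a).comp ha
  obtain ⟨ns, -, h2⟩ := (tendstoInMeasure_of_tendsto_Lp h1).exists_seq_tendsto_ae
  filter_upwards [h2, ae_all_iff.2 hw] with x h3 h4 hx
  exact ge_of_tendsto' h3 fun n => h4 _ hx

theorem HS.val_combo (u v : HS s Ω) (a b : ℝ) :
    (a • u + b • v).val =ᵐ[volume] fun x => a * u.val x + b * v.val x := by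
  rw [map_add, map_smul, map_smul]
  filter_upwards [Lp.coeFn_add (a • u.val) (b • v.val), Lp.coeFn_smul a u.val,
    Lp.coeFn_smul b v.val] with x h1 h2 h3
  rw [h1, Pi.add_apply, h2, h3]; rfl

theorem HS.val_sub (u v : HS s Ω) : (u - v).val =ᵐ[volume] fun x => u.val x - v.val x := by
  rw [map_sub]; exact Lp.coeFn_sub _ _

theorem HS.val_add (u v : HS s Ω) : (u + v).val =ᵐ[volume] fun x => u.val x + v.val x := by
  rw [map_add]; exact Lp.coeFn_add _ _

theorem HS.val_smul (c : ℝ) (v : HS s Ω) : (c • v).val =ᵐ[volume] fun x => c * v.val x := by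
  rw [map_smul]; exact Lp.coeFn_smul _ _

theorem convex_setOf_ae_le (c : E d → ℝ) (F : Set (E d)) :
    Convex ℝ {v : HS s Ω | ∀ᵐ x, x ∈ F → c x ≤ v.val x} := by
  intro u hu v hv a b ha hb hab
  filter_upwards [hu, hv, HS.val_combo u v a b] with x h1 h2 h3 hx
  rw [h3]
  calc c x = a * c x + b * c x := by rw [← add_mul, hab, one_mul]
    _ ≤ _ := by gcongr; exacts [h1 hx, h2 hx]

end AeOrder

/-! ### Outer capacity -/

section OuterCapacity

/-- The outer capacity of a set, for the full norm of `Hˢ₀(Ω)`. -/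
def ocap (s : ℝ) (Ω F : Set (E d)) : ℝ≥0∞ :=
  ⨅ (v : HS s Ω) (_ : ∃ U, IsOpen U ∧ F ⊆ U ∧ ∀ᵐ x, x ∈ U → 1 ≤ v.val x),
    ENNReal.ofReal (‖v‖ ^ 2)

theorem ocap_le {F U : Set (E d)} {v : HS s Ω} (hU : IsOpen U) (hF : F ⊆ U)
    (hv : ∀ᵐ x, x ∈ U → 1 ≤ v.val x) : ocap s Ω F ≤ ENNReal.ofReal (‖v‖ ^ 2) :=
  iInf₂_le v ⟨U, hU, hF, hv⟩

theorem exists_of_ocap_lt {F : Set (E d)} {ε : ℝ≥0∞} (h : ocap s Ω F < ε) :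
    ∃ (v : HS s Ω) (U : Set (E d)), IsOpen U ∧ F ⊆ U ∧ (∀ᵐ x, x ∈ U → 1 ≤ v.val x) ∧
      ENNReal.ofReal (‖v‖ ^ 2) < ε := by
  simp only [ocap, iInf_lt_iff] at h
  obtain ⟨v, ⟨U, h1, h2, h3⟩, h4⟩ := h
  exact ⟨v, U, h1, h2, h3, h4⟩

theorem ocap_mono {F G : Set (E d)} (h : F ⊆ G) : ocap s Ω F ≤ ocap s Ω G := by
  refine le_iInf₂ fun v ⟨U, h1, h2, h3⟩ => ocap_le h1 (h.trans h2) h3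

theorem ocap_empty : ocap s Ω (∅ : Set (E d)) = 0 := by
  have := ocap_le (s := s) (Ω := Ω) (v := 0) isOpen_empty (subset_refl ∅) (by simp)
  simpa using this

theorem ocap_null_mono {F G : Set (E d)} (h : F ⊆ G) (hG : ocap s Ω G = 0) : ocap s Ω F = 0 :=
  le_antisymm ((ocap_mono h).trans hG.le) zero_le

theorem Admissible.exists_max_family (hA : Admissible s Ω) (v : ℕ → HS s Ω)
    (U : ℕ → Set (E d)) (hv : ∀ n, ∀ᵐ x, x ∈ U n → 1 ≤ (v n).val x) (n : ℕ) :
    ∃ m : HS s Ω, (∀ k ≤ n, ∀ᵐ x, x ∈ U k → 1 ≤ m.val x) ∧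
      ‖m‖ ^ 2 ≤ ∑ k ∈ Finset.range (n + 1), ‖v k‖ ^ 2 := by
  induction n with
  | zero => exact ⟨v 0, fun k hk => by rw [Nat.le_zero.1 hk]; exact hv 0, by simp⟩
  | succ n ih =>
    obtain ⟨m, h1, h2⟩ := ih
    obtain ⟨w, h3, h4⟩ := m.exists_max hA.dim_pos hA.pos hA.lt_one hA.isOpen (v (n + 1))
    refine ⟨w, fun k hk => ?_, ?_⟩
    · rcases Nat.le_succ_iff.1 hk with hk | rfl
      · filter_upwards [h1 k hk, h3] with x k1 k2 hx
        rw [k2]; exact le_max_of_le_left (k1 hx)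
      · filter_upwards [hv (n + 1), h3] with x k1 k2 hx
        rw [k2]; exact le_max_of_le_right (k1 hx)
    · rw [Finset.sum_range_succ]; linarith

/-- Maxima of the first n near-optimal competitors have squared norm at most the partial sum of the
capacities. The constraints they satisfy are closed, convex and decreasing in n, so one element of
the same norm bound satisfies them all. -/
theorem Admissible.ocap_iUnion_le (hA : Admissible s Ω) (F : ℕ → Set (E d)) :
    ocap s Ω (⋃ n, F n) ≤ ∑' n, ocap s Ω (F n) := by
  refine ENNReal.le_of_forall_pos_le_add fun ε hε hS => ?_
  obtain ⟨δ, hδ, hδε⟩ := ENNReal.exists_pos_sum_of_countable (ENNReal.coe_pos.2 hε).ne' ℕ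
  have hfin : ∀ n, ocap s Ω (F n) < ocap s Ω (F n) + δ n := fun n =>
    ENNReal.lt_add_right (ENNReal.ne_top_of_tsum_ne_top hS.ne n) (by simpa using (hδ n).ne')
  choose v U hU hFU hv hvn using fun n => exists_of_ocap_lt (hfin n)
  choose m hm1 hm2 using hA.exists_max_family v U hv
  set T := ∑' n, ocap s Ω (F n) + ε
  have hT : T < ⊤ := ENNReal.add_lt_top.2 ⟨hS, ENNReal.coe_lt_top⟩
  have hmT : ∀ n, ‖m n‖ ≤ √T.toReal := fun n => by
    refine Real.le_sqrt_of_sq_le ((hm2 n).trans ?_)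
    rw [← ENNReal.ofReal_le_iff_le_toReal hT.ne,
      ENNReal.ofReal_sum_of_nonneg fun _ _ => by positivity]
    calc _ ≤ ∑ k ∈ Finset.range (n + 1), (ocap s Ω (F k) + δ k) :=
          Finset.sum_le_sum fun k _ => (hvn k).le
      _ ≤ ∑' k, (ocap s Ω (F k) + δ k) := ENNReal.sum_le_tsum _
      _ = ∑' k, ocap s Ω (F k) + ∑' k, (δ k : ℝ≥0∞) := ENNReal.tsum_add
      _ ≤ T := add_le_add le_rfl hδε.le
  obtain ⟨p, hp, hpR⟩ := exists_forall_mem_of_antitone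
    (C := fun n => ⋂ k ∈ Iic n, {v : HS s Ω | ∀ᵐ x, x ∈ U k → 1 ≤ v.val x})
    (fun a b hab => biInter_subset_biInter_left (Iic_subset_Iic.2 hab))
    (fun n => isClosed_biInter fun k _ => isClosed_setOf_ae_le (fun _ => 1) (U k))
    (fun n => convex_iInter₂ fun k _ => convex_setOf_ae_le (fun _ => 1) (U k))
    (fun n => ⟨m n, mem_iInter₂.2 fun k hk => hm1 n k hk, hmT n⟩)
  have hp' : ∀ n, ∀ᵐ x, x ∈ U n → 1 ≤ p.val x := fun n =>
    mem_iInter₂.1 (hp n) n (mem_Iic.2 le_rfl)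
  have hpU : ∀ᵐ x, x ∈ (⋃ n, U n) → 1 ≤ p.val x := by
    filter_upwards [ae_all_iff.2 hp'] with x hx hxU
    obtain ⟨n, hn⟩ := mem_iUnion.1 hxU
    exact hx n hn
  refine (ocap_le (isOpen_iUnion hU) (iUnion_mono hFU) hpU).trans ?_
  rw [ENNReal.ofReal_le_iff_le_toReal hT.ne]
  calc ‖p‖ ^ 2 ≤ √T.toReal ^ 2 := by gcongr
    _ = _ := Real.sq_sqrt ENNReal.toReal_nonneg

theorem Admissible.ocap_union_le (hA : Admissible s Ω) (F G : Set (E d)) :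
    ocap s Ω (F ∪ G) ≤ ocap s Ω F + ocap s Ω G := by
  have h := hA.ocap_iUnion_le fun n : ℕ => if n = 0 then F else if n = 1 then G else ∅
  rw [tsum_eq_sum (s := Finset.range 2) fun n hn => by
    simp only [Finset.mem_range, not_lt] at hn
    rw [if_neg (by omega), if_neg (by omega), ocap_empty]] at h
  simp only [Finset.sum_range_succ, Finset.range_zero, Finset.sum_empty, zero_add, if_true,
    one_ne_zero, if_false] at h
  refine (ocap_mono ?_).trans h
  rintro x (hx | hx)
  · exact mem_iUnion.2 ⟨0, by simpa using hx⟩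
  · exact mem_iUnion.2 ⟨1, by simpa using hx⟩

theorem Admissible.ocap_null_union (hA : Admissible s Ω) {F G : Set (E d)}
    (hF : ocap s Ω F = 0) (hG : ocap s Ω G = 0) : ocap s Ω (F ∪ G) = 0 :=
  le_antisymm ((hA.ocap_union_le F G).trans (by rw [hF, hG, add_zero])) zero_le

theorem Admissible.ocap_null_iUnion (hA : Admissible s Ω) {F : ℕ → Set (E d)}
    (hF : ∀ n, ocap s Ω (F n) = 0) : ocap s Ω (⋃ n, F n) = 0 :=
  le_antisymm ((hA.ocap_iUnion_le F).trans (by simp [hF])) zero_le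

/-- A competitor is at least 1 only almost everywhere, so an open set is its own admissible
neighbourhood and null sets do not count. This carries inequalities from a.e. to q.e. -/
theorem ocap_le_of_ae_subset {U V : Set (E d)} (hV : IsOpen V) (h : ∀ᵐ x, x ∈ V → x ∈ U) :
    ocap s Ω V ≤ ocap s Ω U := by
  refine le_iInf₂ fun v ⟨W, _, h2, h3⟩ => ocap_le hV subset_rfl ?_
  filter_upwards [h, h3] with x k1 k2 hx using k2 (h2 (k1 hx))

/-- Chebyshev's inequality for the L² part of the full norm. It makes sets of outer capacity zero
Lebesgue null. -/
theorem volume_le_ocap (F : Set (E d)) : volume F ≤ ocap s Ω F := by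
  refine le_iInf₂ fun v ⟨U, h1, h2, h3⟩ => (measure_mono h2).trans ?_
  rw [← v.fullSq_val]
  refine le_trans ?_ (le_self_add : _ ≤ fullSq s v.val)
  rw [eLpNorm_two_sq, ← lintegral_indicator_one h1.measurableSet]
  refine lintegral_mono_ae ?_
  filter_upwards [h3] with x hx
  by_cases hxU : x ∈ U
  · rw [indicator_of_mem hxU, Pi.one_apply, ← ofReal_norm, ← ENNReal.ofReal_pow (norm_nonneg _),
      ENNReal.one_le_ofReal, Real.norm_eq_abs, sq_abs]
    exact one_le_pow₀ (hx hxU)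
  · simp [hxU]

end OuterCapacity

/-! ### Comparison of inner and outer capacity -/

section InnerCapacity

/-- The Lipschitz competitors for the capacity of `K`. -/
def capTest (s : ℝ) (Ω K : Set (E d)) : Set (HS s Ω) :=
  {w | ∃ φ, LipC Ω φ ∧ (∀ x ∈ K, 1 ≤ φ x) ∧ w.val =ᵐ[volume] φ}

theorem convex_capTest (K : Set (E d)) : Convex ℝ (capTest s Ω K) := by
  rintro u ⟨φ, h1, h2, h3⟩ v ⟨θ, k1, k2, k3⟩ a b ha hb hab
  refine ⟨fun x => a * φ x + b * θ x, (h1.const_mul a).add (k1.const_mul b), fun x hx => ?_, ?_⟩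
  · calc (1 : ℝ) = a * 1 + b * 1 := by rw [mul_one, mul_one, hab]
      _ ≤ a * φ x + b * θ x := by gcongr; exacts [h2 x hx, k2 x hx]
  · filter_upwards [h3, k3, HS.val_combo u v a b] with x l1 l2 l3
    rw [l3, l1, l2]

theorem Admissible.mem_capSet_iff (hA : Admissible s Ω) (K : Set (E d)) (w : HS s Ω) :
    w.val ∈ capSet s Ω K ↔ w ∈ closure (capTest s Ω K) := by
  rw [Metric.mem_closure_iff]
  constructor
  · rintro ⟨-, h⟩ ε hε
    obtain ⟨φ, h1, h2, h3, h4, h5⟩ := h (ENNReal.ofReal (ε ^ 2)) (by simpa using by positivity)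
    have hφ : LipC Ω φ := ⟨h1, h2, h3⟩
    obtain ⟨t, ht⟩ := hφ.exists_HS (s := s) hA.dim_pos hA.pos hA.lt_one hA.isOpen
    refine ⟨t, ⟨φ, hφ, h4, ht⟩, ?_⟩
    rw [HS.fullSq_sub_of_ae (ae_eq_refl _) ht, ENNReal.ofReal_lt_ofReal_iff (by positivity)] at h5
    rw [dist_eq_norm]
    exact lt_of_pow_lt_pow_left₀ 2 hε.le h5
  · intro h
    refine ⟨w.val_mem, fun ε hε => ?_⟩
    obtain ⟨δ, hδ, hδε⟩ : ∃ δ : ℝ, 0 < δ ∧ ENNReal.ofReal (δ ^ 2) < ε := by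
      rcases eq_or_ne ε ⊤ with rfl | hε'
      · exact ⟨1, one_pos, ENNReal.ofReal_lt_top⟩
      · have hpos := ENNReal.toReal_pos hε.ne' hε'
        refine ⟨√(ε.toReal / 2), by positivity, ?_⟩
        rw [Real.sq_sqrt (by positivity), ENNReal.ofReal_lt_iff_lt_toReal (by positivity) hε']
        linarith
    obtain ⟨t, ⟨φ, h1, h2, h3⟩, h4⟩ := h δ hδ
    refine ⟨φ, h1.lip, h1.compact, h1.subset, h2, ?_⟩
    rw [HS.fullSq_sub_of_ae (ae_eq_refl _) h3]
    refine lt_of_le_of_lt (ENNReal.ofReal_le_ofReal ?_) hδε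
    rw [dist_eq_norm] at h4
    gcongr

theorem Admissible.exists_of_mem_capSet (hA : Admissible s Ω) {K : Set (E d)} {v : L2 d}
    (hv : v ∈ capSet s Ω K) : ∃ w : HS s Ω, w.val = v ∧ w ∈ closure (capTest s Ω K) := by
  obtain ⟨w, rfl⟩ := HS.exists_val_eq hA.dim_pos hA.pos hA.lt_one hv.1
  exact ⟨w, rfl, (hA.mem_capSet_iff K w).1 hv⟩

/-- Let v ≥ 1 on an open U ⊇ K, made nonnegative by taking positive parts. A cut-off θ of K
supported in U ∩ Ω satisfies θ ≤ v a.e., so for Lipschitz φₙ → v the functions max(φₙ, θ) are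
admissible for K, bounded in energy, and converge in L² to max(v, θ) = v. Thus v itself lies in
𝕂ˢ_K. -/
theorem Admissible.iInf_capSet_le_ocap (hA : Admissible s Ω) {K : Set (E d)} (hK : IsCompact K)
    (hKΩ : K ⊆ Ω) : ⨅ v ∈ capSet s Ω K, gagliardoSq s v ≤ ocap s Ω K := by
  refine le_iInf₂ fun v ⟨U, hU, hKU, hv⟩ => ?_
  obtain ⟨v', hv', hvn⟩ := v.exists_pos hA.dim_pos hA.pos hA.lt_one hA.isOpen
  obtain ⟨θ, h1, h2, h3, h4⟩ := exists_lipC_one (hU.inter hA.isOpen) hK (subset_inter hKU hKΩ)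
  have hθ : LipC Ω θ := ⟨h1.lip, h1.compact, h1.subset.trans inter_subset_right⟩
  obtain ⟨t, ht⟩ := hθ.exists_HS (s := s) hA.dim_pos hA.pos hA.lt_one hA.isOpen
  obtain ⟨φ, w, k1, k2, k3, k4⟩ := v'.exists_lipC_seq hA.dim_pos hA.pos hA.lt_one
  choose m hm1 hm2 using fun n =>
    (w n).exists_max hA.dim_pos hA.pos hA.lt_one hA.isOpen t
  have hmR : ∀ n, ‖m n‖ ≤ √((‖v'‖ + 1) ^ 2 + ‖t‖ ^ 2) := fun n => by
    refine Real.le_sqrt_of_sq_le ((hm2 n).trans ?_)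
    gcongr
    have := norm_sub_norm_le (w n) v'
    rw [norm_sub_rev] at this
    linarith [k3 n]
  have hlim : Tendsto (fun n => (m n).val) atTop (𝓝 v'.val) := by
    rw [tendsto_iff_norm_sub_tendsto_zero]
    have hw : Tendsto (fun n => ‖(w n).val - v'.val‖) atTop (𝓝 0) :=
      tendsto_iff_norm_sub_tendsto_zero.1 ((HS.val.continuous.tendsto v').comp k4)
    refine squeeze_zero (fun n => norm_nonneg _) (fun n => ?_) hw
    refine Lp.norm_le_norm_of_ae_le ?_
    filter_upwards [hm1 n, hv', hv, ht, Lp.coeFn_sub (m n).val v'.val,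
      Lp.coeFn_sub (w n).val v'.val] with x l1 l2 l3 l4 l5 l6
    rw [l5, l6, Pi.sub_apply, Pi.sub_apply, l1, l4, Real.norm_eq_abs, Real.norm_eq_abs]
    have hle : θ x ≤ v'.val x := by
      rw [l2]
      by_cases hx : x ∈ U
      · exact (h3 x).trans (le_max_of_le_left (l3 hx))
      · rw [h1.eq_zero fun h => hx h.1]; exact le_max_right _ _
    have := abs_max_sub_max_le_abs ((w n).val x) (v'.val x) (θ x)
    rwa [max_eq_left hle] at this
  obtain ⟨p, hp, -, hpC⟩ := HS.exists_val_eq_of_tendsto hmR hlim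
  have hpv : p = v' := HS.val_injective hp
  have := hpC (closure (capTest s Ω K)) isClosed_closure (convex_capTest K).closure
    (Eventually.of_forall fun n => subset_closure
      ⟨fun x => max (φ n x) (θ x), (k1 n).max hθ, fun x hx => by simp [h4 x hx], by
        filter_upwards [hm1 n, k2 n, ht] with x l1 l2 l3
        rw [l1, l2, l3]⟩)
  rw [hpv, ← hA.mem_capSet_iff] at this
  refine (iInf₂_le v'.val this).trans ?_
  rw [v'.gagliardoSq_val]
  exact ENNReal.ofReal_le_ofReal (pow_le_pow_left₀ (norm_nonneg _) (v'.norm_grad_le.trans hvn) 2)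

/-- A continuous function that is at least 1 on K exceeds 1 on a neighbourhood of K once multiplied
by any c > 1. -/
theorem ocap_le_of_mem_closure_capTest {K : Set (E d)} {w : HS s Ω}
    (hw : w ∈ closure (capTest s Ω K)) : ocap s Ω K ≤ ENNReal.ofReal (‖w‖ ^ 2) := by
  have key : ∀ R : ℝ, ‖w‖ < R → ocap s Ω K ≤ ENNReal.ofReal (R ^ 2) := by
    intro R hR
    have hR0 : 0 < R := (norm_nonneg _).trans_lt hR
    obtain ⟨t, ⟨φ, h1, h2, h3⟩, h4⟩ := Metric.mem_closure_iff.1 hw (R - ‖w‖) (by linarith)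
    have ht : ‖t‖ < R := by
      rw [dist_comm, dist_eq_norm] at h4
      have := norm_sub_norm_le t w
      linarith
    -- Since ‖t‖ < R, this c exceeds 1 while c‖t‖ stays at most R.
    set c := 2 * R / (R + ‖t‖)
    have hc1 : 1 < c := by
      rw [one_lt_div (by positivity)]; linarith
    have hcR : c * ‖t‖ ≤ R := by
      simp only [c]
      rw [div_mul_eq_mul_div, div_le_iff₀ (by positivity)]
      nlinarith [norm_nonneg t]
    have hc0 : 0 < c := one_pos.trans hc1
    refine (ocap_le (v := c • t) (U := {x | 1 < c * φ x})
      (isOpen_lt continuous_const (continuous_const.mul h1.continuous)) (fun x hx => ?_) ?_).trans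
      (ENNReal.ofReal_le_ofReal (pow_le_pow_left₀ (norm_nonneg _) ?_ 2))
    · have := h2 x hx
      change 1 < c * φ x
      nlinarith
    · filter_upwards [HS.val_smul c t, h3] with x k1 k2 hx
      rw [k1, k2]; exact le_of_lt hx
    · rw [norm_smul, Real.norm_eq_abs, abs_of_pos hc0]; exact hcR
  have hlim : Tendsto (fun R : ℝ => ENNReal.ofReal (R ^ 2)) (𝓝[>] ‖w‖)
      (𝓝 (ENNReal.ofReal (‖w‖ ^ 2))) := by
    have : Continuous fun R : ℝ => ENNReal.ofReal (R ^ 2) :=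
      ENNReal.continuous_ofReal.comp (continuous_pow 2)
    exact (this.tendsto _).mono_left nhdsWithin_le_nhds
  exact ge_of_tendsto hlim (by filter_upwards [self_mem_nhdsWithin] with R hR using key R hR)

theorem capS_mono {F G : Set (E d)} (h : F ⊆ G) : capS s Ω F ≤ capS s Ω G :=
  iSup_mono fun _ => iSup_mono fun _ => iSup_mono' fun hKF => ⟨hKF.trans h, le_rfl⟩

theorem Admissible.capS_le_ocap (hA : Admissible s Ω) {F : Set (E d)} (hF : F ⊆ Ω) :
    capS s Ω F ≤ ocap s Ω F :=
  iSup_le fun _ => iSup_le fun hK => iSup_le fun hKF =>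
    (hA.iInf_capSet_le_ocap hK (hKF.trans hF)).trans (ocap_mono hKF)

/-- On compact sets the Poincaré constant bridges the two norms. An open G ⊆ Ω is an increasing
union of compact sets, and the decreasing constraints v ≥ 1 on these have a common solution of
controlled norm; G being open, that solution competes for its outer capacity. -/
theorem Admissible.exists_const (hA : Admissible s Ω) : ∃ C : ℝ, 0 < C ∧
    (∀ v : HS s Ω, ‖v‖ ^ 2 ≤ C * ‖v.grad‖ ^ 2) ∧
    (∀ K F : Set (E d), IsCompact K → K ⊆ F →
      ocap s Ω K ≤ ENNReal.ofReal C * capS s Ω F) ∧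
    (∀ G : Set (E d), IsOpen G → G ⊆ Ω → ocap s Ω G ≤ ENNReal.ofReal C * capS s Ω G) := by
  obtain ⟨C, hC, h⟩ := HS.exists_norm_le_grad (s := s) hA.dim_pos hA.pos hA.isOpen hA.bounded
  have hcomp : ∀ K F : Set (E d), IsCompact K → K ⊆ F →
      ocap s Ω K ≤ ENNReal.ofReal C * capS s Ω F := by
    intro K F hK hKF
    have h1 : ⨅ v ∈ capSet s Ω K, gagliardoSq s v ≤ capS s Ω F :=
      le_iSup_of_le K (le_iSup_of_le hK (le_iSup_of_le hKF le_rfl))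
    refine le_trans ?_ (mul_le_mul_right h1 _)
    simp only [ENNReal.mul_iInf_of_ne (by simpa using hC) ENNReal.ofReal_ne_top]
    refine le_iInf₂ fun v hv => ?_
    obtain ⟨w, rfl, hw⟩ := hA.exists_of_mem_capSet hv
    refine (ocap_le_of_mem_closure_capTest hw).trans ?_
    rw [w.gagliardoSq_val, ← ENNReal.ofReal_mul hC.le]
    exact ENNReal.ofReal_le_ofReal (h w)
  refine ⟨C, hC, h, hcomp, fun G hG hGΩ => ?_⟩
  set T := ENNReal.ofReal C * capS s Ω G
  rcases eq_or_ne T ⊤ with hT | hT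
  · rw [hT]; exact le_top
  obtain ⟨F, hF1, hF2, hF3, hF4⟩ := hG.exists_iUnion_isClosed
  have hFc : ∀ n, IsCompact (F n) := fun n =>
    Metric.isCompact_of_isClosed_isBounded (hF1 n) (hA.bounded.subset ((hF2 n).trans hGΩ))
  refine ENNReal.le_of_forall_pos_le_add fun ε hε _ => ?_
  have hTε : T + ε ≠ ⊤ := ENNReal.add_ne_top.2 ⟨hT, ENNReal.coe_ne_top⟩
  have hlt : ∀ n, ocap s Ω (F n) < T + ε := fun n =>
    (hcomp _ _ (hFc n) (hF2 n)).trans_lt (ENNReal.lt_add_right hT (by simpa using hε.ne'))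
  choose v U hU hFU hv hvn using fun n => exists_of_ocap_lt (hlt n)
  obtain ⟨p, hp, hpR⟩ := exists_forall_mem_of_antitone
    (C := fun n => {v : HS s Ω | ∀ᵐ x, x ∈ F n → 1 ≤ v.val x})
    (fun a b hab w (hw : ∀ᵐ x, x ∈ F b → 1 ≤ w.val x) =>
      hw.mono fun x hx hxF => hx (hF4 hab hxF))
    (fun n => isClosed_setOf_ae_le (fun _ => 1) (F n))
    (fun n => convex_setOf_ae_le (fun _ => 1) (F n)) (R := √(T + ε).toReal)
    (fun n => ⟨v n, by filter_upwards [hv n] with x hx hxF using hx (hFU n hxF),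
      Real.le_sqrt_of_sq_le ((ENNReal.ofReal_le_iff_le_toReal hTε).1 (hvn n).le)⟩)
  have hpG : ∀ᵐ x, x ∈ G → 1 ≤ p.val x := by
    filter_upwards [ae_all_iff.2 hp] with x hx hxG
    rw [← hF3] at hxG
    obtain ⟨n, hn⟩ := mem_iUnion.1 hxG
    exact hx n hn
  refine (ocap_le hG subset_rfl hpG).trans ?_
  rw [ENNReal.ofReal_le_iff_le_toReal hTε]
  calc ‖p‖ ^ 2 ≤ √(T + ε).toReal ^ 2 := by gcongr
    _ = _ := Real.sq_sqrt ENNReal.toReal_nonneg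

end InnerCapacity

end

section

variable {d : ℕ} {s : ℝ} {Ω : Set (E d)}

/-! ### Quasi-continuous functions and representatives -/

section QuasiContinuity

/-- The exceptional sets in the definition are open subsets of Ω, exactly where the two capacities
are comparable. -/
theorem Admissible.quasiCont_iff (hA : Admissible s Ω) {f : E d → ℝ} :
    QuasiCont s Ω f ↔ ∀ ε : ℝ≥0∞, 0 < ε → ∃ G : Set (E d), IsOpen G ∧ G ⊆ Ω ∧ ocap s Ω G < ε ∧
      ContinuousOn f (Ω \ G) := by
  constructor
  · intro h ε hε
    obtain ⟨C, -, -, -, hC⟩ := hA.exists_const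
    obtain ⟨δ, hδ, hδε⟩ := exists_pos_mul_lt_ennreal hε C
    obtain ⟨G, h1, h2, h3, h4⟩ := h δ hδ
    exact ⟨G, h1, h2, (hC G h1 h2).trans_lt ((by gcongr : _ ≤ _).trans_lt hδε), h4⟩
  · intro h ε hε
    obtain ⟨G, h1, h2, h3, h4⟩ := h ε hε
    exact ⟨G, h1, h2, (hA.capS_le_ocap h2).trans_lt h3, h4⟩

theorem Admissible.exists_common (hA : Admissible s Ω) {f g : E d → ℝ} (hf : QuasiCont s Ω f)
    (hg : QuasiCont s Ω g) {ε : ℝ≥0∞} (hε : 0 < ε) : ∃ G : Set (E d), IsOpen G ∧ G ⊆ Ω ∧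
      ocap s Ω G < ε ∧ ContinuousOn f (Ω \ G) ∧ ContinuousOn g (Ω \ G) := by
  obtain ⟨G, h1, h2, h3, h4⟩ := hA.quasiCont_iff.1 hf (ε / 2) (ENNReal.half_pos hε.ne')
  obtain ⟨G', k1, k2, k3, k4⟩ := hA.quasiCont_iff.1 hg (ε / 2) (ENNReal.half_pos hε.ne')
  refine ⟨G ∪ G', h1.union k1, union_subset h2 k2, ?_,
    h4.mono (sdiff_subset_sdiff_right subset_union_left),
    k4.mono (sdiff_subset_sdiff_right subset_union_right)⟩
  calc _ ≤ _ := hA.ocap_union_le G G'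
    _ < ε / 2 + ε / 2 := ENNReal.add_lt_add h3 k3
    _ = ε := ENNReal.add_halves ε

theorem Admissible.quasiCont_comp₂ (hA : Admissible s Ω) {f g : E d → ℝ} (hf : QuasiCont s Ω f)
    (hg : QuasiCont s Ω g) {F : ℝ × ℝ → ℝ} (hF : Continuous F) :
    QuasiCont s Ω fun x => F (f x, g x) := by
  rw [hA.quasiCont_iff]
  intro ε hε
  obtain ⟨G, h1, h2, h3, h4, h5⟩ := hA.exists_common hf hg hε
  exact ⟨G, h1, h2, h3, hF.comp_continuousOn (h4.prodMk h5)⟩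

theorem Admissible.quasiCont_of_continuous (hA : Admissible s Ω) {f : E d → ℝ}
    (hf : Continuous f) : QuasiCont s Ω f := by
  rw [hA.quasiCont_iff]
  exact fun ε hε => ⟨∅, isOpen_empty, empty_subset _, by rwa [ocap_empty], hf.continuousOn⟩

/-- Off an open set of small capacity, `{g < f}` is relatively open. -/
theorem Admissible.exists_open_lt (hA : Admissible s Ω) {f g : E d → ℝ} (hf : QuasiCont s Ω f)
    (hg : QuasiCont s Ω g) {ε : ℝ≥0∞} (hε : 0 < ε) : ∃ G O : Set (E d), IsOpen G ∧ G ⊆ Ω ∧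
      ocap s Ω G < ε ∧ IsOpen O ∧ O ⊆ Ω ∧ (∀ x ∈ Ω, x ∉ G → (x ∈ O ↔ g x < f x)) ∧
      ContinuousOn f (Ω \ G) ∧ ContinuousOn g (Ω \ G) := by
  obtain ⟨G, h1, h2, h3, h4, h5⟩ := hA.exists_common hf hg hε
  obtain ⟨O, hO, hO'⟩ := continuousOn_iff'.1 (h4.sub h5) (Ioi 0) isOpen_Ioi
  refine ⟨G, O ∩ Ω, h1, h2, h3, hO.inter hA.isOpen, inter_subset_right, fun x hx hxG => ?_, h4, h5⟩
  have := Set.ext_iff.1 hO' x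
  simp only [mem_inter_iff, mem_preimage, mem_Ioi, Set.mem_sdiff, hx, hxG, not_false_eq_true, and_true,
    Pi.sub_apply, sub_pos] at this ⊢
  exact this.symm

/-- An inequality between quasi-continuous functions that holds almost everywhere in an open set
holds quasi-everywhere there. -/
theorem Admissible.ocap_lt_eq_zero_of_ae (hA : Admissible s Ω) {f g : E d → ℝ}
    (hf : QuasiCont s Ω f) (hg : QuasiCont s Ω g) {U : Set (E d)} (hU : IsOpen U) (hUΩ : U ⊆ Ω)
    (h : ∀ᵐ x, x ∈ U → f x ≤ g x) : ocap s Ω {x | x ∈ U ∧ g x < f x} = 0 := by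
  refine le_antisymm (le_of_forall_pos_le_add fun ε hε => ?_) zero_le
  obtain ⟨G, O, h1, h2, h3, h4, h5, h6, -⟩ := hA.exists_open_lt hf hg hε
  rw [zero_add]
  calc _ ≤ ocap s Ω ((O ∩ U) ∪ G) := ocap_mono fun x hx => by
        by_cases hxG : x ∈ G
        · exact Or.inr hxG
        · exact Or.inl ⟨(h6 x (hUΩ hx.1) hxG).2 hx.2, hx.1⟩
    _ ≤ ocap s Ω G := by
        -- Off G, membership in O means g < f, which happens on U only on a null set. So this open
        -- set is a.e. contained in G.
        refine ocap_le_of_ae_subset ((h4.inter hU).union h1) ?_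
        filter_upwards [h] with x hx hx'
        by_contra hxG
        rcases hx' with hx' | hx'
        · exact absurd ((h6 x (hUΩ hx'.2) hxG).1 hx'.1) (not_lt.2 (hx hx'.2))
        · exact hxG hx'
    _ ≤ ε := h3.le

/-- For quasi-continuous functions, inner and outer quasi-everywhere inequalities agree. -/
theorem Admissible.ocap_lt_eq_zero_of_QE (hA : Admissible s Ω) {f g : E d → ℝ}
    (hf : QuasiCont s Ω f) (hg : QuasiCont s Ω g) (h : QE s Ω fun x => f x ≤ g x) :
    ocap s Ω {x | x ∈ Ω ∧ g x < f x} = 0 := by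
  obtain ⟨C, -, -, hC, -⟩ := hA.exists_const
  refine le_antisymm (le_of_forall_pos_le_add fun ε hε => ?_) zero_le
  obtain ⟨G, O, h1, h2, h3, h4, h5, h6, -⟩ := hA.exists_open_lt hf hg hε
  rw [zero_add]
  obtain ⟨F, hF1, hF2, hF3, -⟩ := h4.exists_iUnion_isClosed
  -- Removing the open set G leaves compact subsets of an inner null set, and on compact sets the
  -- inner capacity controls the outer one.
  have hF : ∀ n, ocap s Ω (F n \ G) = 0 := fun n => by
    have hc : IsCompact (F n \ G) := (Metric.isCompact_of_isClosed_isBounded (hF1 n)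
      (hA.bounded.subset ((hF2 n).trans h5))).diff h1
    refine le_antisymm ((hC _ {x | x ∈ Ω ∧ ¬ f x ≤ g x} hc fun x hx => ?_).trans ?_) zero_le
    · have hxΩ := h5 (hF2 n hx.1)
      exact ⟨hxΩ, not_le.2 ((h6 x hxΩ hx.2).1 (hF2 n hx.1))⟩
    · rw [QE] at h; rw [h, mul_zero]
  calc _ ≤ ocap s Ω ((⋃ n, F n \ G) ∪ G) := ocap_mono fun x hx => by
        by_cases hxG : x ∈ G
        · exact Or.inr hxG
        · have := (h6 x hx.1 hxG).2 hx.2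
          rw [← hF3] at this
          obtain ⟨n, hn⟩ := mem_iUnion.1 this
          exact Or.inl (mem_iUnion.2 ⟨n, hn, hxG⟩)
    _ ≤ _ := hA.ocap_union_le _ _
    _ ≤ ε := by rw [hA.ocap_null_iUnion hF, zero_add]; exact h3.le

theorem Admissible.qe_of_ocap (hA : Admissible s Ω) {P : E d → Prop}
    (h : ocap s Ω {x | x ∈ Ω ∧ ¬ P x} = 0) : QE s Ω P :=
  le_antisymm ((hA.capS_le_ocap fun _ hx => hx.1).trans h.le) zero_le

theorem Admissible.isQCRep_iff (hA : Admissible s Ω) {v : L2 d} {f : E d → ℝ} :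
    IsQCRep s Ω v f ↔ QuasiCont s Ω f ∧ ∀ᵐ x, x ∈ Ω → f x = v x := by
  rw [IsQCRep, ae_restrict_iff' hA.isOpen.measurableSet]

theorem Admissible.isQCRep_of_continuous (hA : Admissible s Ω) {v : L2 d} {f : E d → ℝ}
    (hf : Continuous f) (h : v =ᵐ[volume] f) : IsQCRep s Ω v f :=
  hA.isQCRep_iff.2 ⟨hA.quasiCont_of_continuous hf, h.mono fun _ hx _ => hx.symm⟩

theorem Admissible.isQCRep_comp₂ (hA : Admissible s Ω) {u v w : L2 d} {f g : E d → ℝ}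
    (hf : IsQCRep s Ω u f) (hg : IsQCRep s Ω v g) {F : ℝ × ℝ → ℝ} (hF : Continuous F)
    (h : w =ᵐ[volume] fun x => F (u x, v x)) : IsQCRep s Ω w fun x => F (f x, g x) := by
  rw [hA.isQCRep_iff] at *
  refine ⟨hA.quasiCont_comp₂ hf.1 hg.1 hF, ?_⟩
  filter_upwards [hf.2, hg.2, h] with x h1 h2 h3 hx
  rw [h1 hx, h2 hx, h3]

theorem Admissible.isQCRep_sub (hA : Admissible s Ω) {u v : HS s Ω} {f g : E d → ℝ}
    (hf : IsQCRep s Ω u.val f) (hg : IsQCRep s Ω v.val g) :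
    IsQCRep s Ω (u - v).val fun x => f x - g x :=
  hA.isQCRep_comp₂ hf hg (F := fun p => p.1 - p.2) (by fun_prop) (HS.val_sub u v)

/-- The capacity of a set on which a quasi-continuous representative is at least one. -/
theorem Admissible.ocap_le_of_rep (hA : Admissible s Ω) {v : HS s Ω} {f : E d → ℝ}
    (hf : IsQCRep s Ω v.val f) {F N : Set (E d)} (hF : F ⊆ Ω) (hN : ocap s Ω N = 0)
    (h : ∀ x ∈ F, x ∉ N → 1 ≤ f x) : ocap s Ω F ≤ ENNReal.ofReal (‖v‖ ^ 2) := by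
  rw [hA.isQCRep_iff] at hf
  -- Scaling by 1 + δ makes the inequality strict, so F \ N is covered by an open set O ∪ G. On it
  -- the competitor is the maximum of (1 + δ)v and a function e of small norm that is at least 1 on
  -- G.
  have key : ∀ δ : ℝ, 0 < δ →
      ocap s Ω (F \ N) ≤ ENNReal.ofReal ((1 + δ) ^ 2 * ‖v‖ ^ 2 + δ) := by
    intro δ hδ
    have hq : QuasiCont s Ω fun x => (1 + δ) * f x :=
      hA.quasiCont_comp₂ hf.1 hf.1 (F := fun p => (1 + δ) * p.1) (by fun_prop)
    obtain ⟨G, O, h1, h2, h3, h4, h5, h6, -⟩ := hA.exists_open_lt hq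
      (hA.quasiCont_of_continuous (continuous_const (y := (1 : ℝ))))
      (ENNReal.ofReal_pos.2 hδ)
    obtain ⟨e, U, hU, hGU, he, hen⟩ := exists_of_ocap_lt h3
    obtain ⟨m, hm, hmn⟩ := ((1 + δ) • v).exists_max hA.dim_pos hA.pos hA.lt_one hA.isOpen e
    refine (ocap_le (U := O ∪ G) (v := m) (h4.union h1) ?_ ?_).trans
      (ENNReal.ofReal_le_ofReal (hmn.trans ?_))
    · intro x hx
      by_cases hxG : x ∈ G
      · exact Or.inr hxG
      · refine Or.inl ((h6 x (hF hx.1) hxG).2 ?_)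
        have := h x hx.1 hx.2
        nlinarith
    · filter_upwards [hm, he, hf.2, HS.val_smul (1 + δ) v] with x k1 k2 k3 k4 hx
      rw [k1]
      by_cases hxG : x ∈ G
      · exact le_max_of_le_right (k2 (hGU hxG))
      · have hxO := hx.resolve_right hxG
        refine le_max_of_le_left ?_
        rw [k4, ← k3 (h5 hxO)]
        exact ((h6 x (h5 hxO) hxG).1 hxO).le
    · rw [norm_smul, mul_pow, Real.norm_eq_abs, sq_abs]
      have := (ENNReal.ofReal_lt_ofReal_iff hδ).1 hen
      linarith
  have h1 : ocap s Ω F ≤ ocap s Ω (F \ N) := by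
    calc _ ≤ ocap s Ω (F \ N ∪ N) := ocap_mono (by simp)
      _ ≤ _ := hA.ocap_union_le _ _
      _ = _ := by rw [hN, add_zero]
  refine h1.trans ?_
  have hlim : Tendsto (fun δ : ℝ => ENNReal.ofReal ((1 + δ) ^ 2 * ‖v‖ ^ 2 + δ)) (𝓝[>] 0)
      (𝓝 (ENNReal.ofReal (‖v‖ ^ 2))) := by
    have : Continuous fun δ : ℝ => ENNReal.ofReal ((1 + δ) ^ 2 * ‖v‖ ^ 2 + δ) :=
      ENNReal.continuous_ofReal.comp (by fun_prop)
    have := (this.tendsto 0).mono_left (nhdsWithin_le_nhds (s := Ioi 0))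
    simpa using this
  exact ge_of_tendsto hlim (by filter_upwards [self_mem_nhdsWithin] with δ hδ using key δ hδ)

/-- Chebyshev's inequality for capacity. The factor 2 comes from treating the two signs of f
separately. -/
theorem Admissible.ocap_abs_ge_le (hA : Admissible s Ω) {v : HS s Ω} {f : E d → ℝ}
    (hf : IsQCRep s Ω v.val f) {c : ℝ} (hc : 0 < c) :
    ocap s Ω {x | x ∈ Ω ∧ c ≤ |f x|} ≤ ENNReal.ofReal (2 * ‖v‖ ^ 2 / c ^ 2) := by
  have key : ∀ a : ℝ, |a| = c⁻¹ → ocap s Ω {x | x ∈ Ω ∧ 1 ≤ a * f x} ≤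
      ENNReal.ofReal (‖v‖ ^ 2 / c ^ 2) := by
    intro a ha
    have hr : IsQCRep s Ω (a • v).val fun x => a * f x :=
      hA.isQCRep_comp₂ hf hf (F := fun p => a * p.1) (by fun_prop) (HS.val_smul a v)
    refine (hA.ocap_le_of_rep hr (fun x hx => hx.1) ocap_empty fun x hx _ => hx.2).trans ?_
    rw [norm_smul, Real.norm_eq_abs, ha, mul_pow, inv_pow, div_eq_inv_mul]
  calc _ ≤ ocap s Ω ({x | x ∈ Ω ∧ 1 ≤ c⁻¹ * f x} ∪ {x | x ∈ Ω ∧ 1 ≤ (-c⁻¹) * f x}) := by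
        refine ocap_mono fun x hx => ?_
        obtain ⟨h1, h2⟩ := hx
        rcases le_abs'.1 h2 with h2 | h2
        · refine Or.inr ⟨h1, ?_⟩
          rw [neg_mul, ← mul_neg, ← div_eq_inv_mul, one_le_div hc]; linarith
        · refine Or.inl ⟨h1, ?_⟩
          rwa [← div_eq_inv_mul, one_le_div hc]
    _ ≤ _ := hA.ocap_union_le _ _
    _ ≤ ENNReal.ofReal (‖v‖ ^ 2 / c ^ 2) + ENNReal.ofReal (‖v‖ ^ 2 / c ^ 2) :=
        add_le_add (key _ (by rw [abs_of_pos (by positivity)]))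
          (key _ (by rw [abs_neg, abs_of_pos (by positivity)]))
    _ = _ := by rw [← ENNReal.ofReal_add (by positivity) (by positivity)]; congr 1; ring

theorem Admissible.rep_unique (hA : Admissible s Ω) {v : L2 d} {f g : E d → ℝ}
    (hf : IsQCRep s Ω v f) (hg : IsQCRep s Ω v g) : ocap s Ω {x | x ∈ Ω ∧ f x ≠ g x} = 0 := by
  rw [hA.isQCRep_iff] at hf hg
  have h1 := hA.ocap_lt_eq_zero_of_ae hf.1 hg.1 hA.isOpen subset_rfl (by
    filter_upwards [hf.2, hg.2] with x h1 h2 hx using by rw [h1 hx, h2 hx])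
  have h2 := hA.ocap_lt_eq_zero_of_ae hg.1 hf.1 hA.isOpen subset_rfl (by
    filter_upwards [hf.2, hg.2] with x h1 h2 hx using by rw [h1 hx, h2 hx])
  refine ocap_null_mono ?_ (hA.ocap_null_union h1 h2)
  rintro x ⟨hx, hne⟩
  rcases lt_or_gt_of_ne hne with h | h
  · exact Or.inr ⟨hx, h⟩
  · exact Or.inl ⟨hx, h⟩

/-- Every element of `Hˢ₀(Ω)` has a quasi-continuous representative. It is the limit, outside a set
of capacity zero, of Lipschitz functions with compact support that converge to it in norm. -/
theorem Admissible.exists_rep (hA : Admissible s Ω) (v : HS s Ω) :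
    ∃ (f : E d → ℝ) (φ : ℕ → E d → ℝ) (w : ℕ → HS s Ω), IsQCRep s Ω v.val f ∧
      (∀ n, LipC Ω (φ n)) ∧ (∀ n, (w n).val =ᵐ[volume] φ n) ∧ Tendsto w atTop (𝓝 v) ∧
      ocap s Ω {x | x ∈ Ω ∧ ¬ Tendsto (fun n => φ n x) atTop (𝓝 (f x))} = 0 := by
  -- With this rate ‖w (n+1) - w n‖ ≤ 4⁻ⁿ/2, so by Chebyshev the increment exceeds 2⁻ⁿ only on a set
  -- of capacity at most 2⁻ⁿ; thresholds and capacities are both summable.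
  choose φ w h1 h2 h3 using fun n : ℕ => v.exists_lipC_near hA.dim_pos hA.pos hA.lt_one
    (show (0 : ℝ) < (1 / 4) ^ n / 4 by positivity)
  have hwv : Tendsto w atTop (𝓝 v) := by
    rw [tendsto_iff_norm_sub_tendsto_zero]
    have hg : Tendsto (fun n : ℕ => (1 / 4 : ℝ) ^ n / 4) atTop (𝓝 0) := by
      have := (tendsto_pow_atTop_nhds_zero_of_lt_one (r := (1 / 4 : ℝ)) (by norm_num)
        (by norm_num)).div_const 4
      rwa [zero_div] at this
    refine squeeze_zero (fun n => norm_nonneg _) (fun n => ?_) hg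
    rw [norm_sub_rev]; exact (h3 n).le
  let B₀ : ℕ → Set (E d) := fun n => {x | (1 / 2 : ℝ) ^ n < |φ (n + 1) x - φ n x|}
  have hB₀o : ∀ n, IsOpen (B₀ n) := fun n =>
    isOpen_lt continuous_const (((h1 (n + 1)).continuous.sub (h1 n).continuous).abs)
  have hB₀Ω : ∀ n, B₀ n ⊆ Ω := fun n x hx => by
    by_contra hxΩ
    have : (1 / 2 : ℝ) ^ n < |φ (n + 1) x - φ n x| := hx
    rw [(h1 _).eq_zero hxΩ, (h1 _).eq_zero hxΩ, sub_zero, abs_zero] at this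
    exact absurd this (not_lt.2 (by positivity))
  have hB₀c : ∀ n, ocap s Ω (B₀ n) ≤ ENNReal.ofReal ((1 / 2) ^ n) := fun n => by
    have hr : IsQCRep s Ω (w (n + 1) - w n).val fun x => φ (n + 1) x - φ n x :=
      hA.isQCRep_sub (hA.isQCRep_of_continuous (h1 _).continuous (h2 _))
        (hA.isQCRep_of_continuous (h1 _).continuous (h2 _))
    refine (ocap_mono fun x hx => ?_).trans
      ((hA.ocap_abs_ge_le hr (c := (1 / 2) ^ n) (by positivity)).trans
        (ENNReal.ofReal_le_ofReal ?_))
    · exact ⟨hB₀Ω n hx, le_of_lt hx⟩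
    · have hn : ‖w (n + 1) - w n‖ ≤ (1 / 4) ^ n / 2 := by
        calc ‖w (n + 1) - w n‖ = ‖(v - w n) - (v - w (n + 1))‖ := by congr 1; abel
          _ ≤ ‖v - w n‖ + ‖v - w (n + 1)‖ := norm_sub_le _ _
          _ ≤ (1 / 4) ^ n / 4 + (1 / 4) ^ (n + 1) / 4 := add_le_add (h3 n).le (h3 (n + 1)).le
          _ ≤ _ := by
            rw [pow_succ]
            have : (0 : ℝ) < (1 / 4) ^ n := by positivity
            linarith
      rw [div_le_iff₀ (by positivity)]
      have hsq : ‖w (n + 1) - w n‖ ^ 2 ≤ ((1 / 4) ^ n / 2) ^ 2 := by gcongr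
      have e1 : ((1 / 4 : ℝ) ^ n) = (1 / 2) ^ n * (1 / 2) ^ n := by
        rw [← mul_pow]; norm_num
      rw [e1] at hsq
      have hp : (0 : ℝ) < (1 / 2) ^ n := by positivity
      have hp1 : ((1 / 2 : ℝ)) ^ n ≤ 1 := pow_le_one₀ (by norm_num) (by norm_num)
      have hp3 : ((1 / 2 : ℝ) ^ n) ^ 4 ≤ ((1 / 2 : ℝ) ^ n) ^ 3 :=
        pow_le_pow_of_le_one hp.le hp1 (by norm_num)
      nlinarith
  -- Off the m-th tail union the sequence converges uniformly, so the limit is continuous there. The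
  -- capacity of that union is at most 2 · 2⁻ᵐ.
  let B : ℕ → Set (E d) := fun m => ⋃ n, B₀ (n + m)
  have hBo : ∀ m, IsOpen (B m) := fun m => isOpen_iUnion fun n => hB₀o _
  have hBΩ : ∀ m, B m ⊆ Ω := fun m => iUnion_subset fun n => hB₀Ω _
  have hBc : ∀ m, ocap s Ω (B m) ≤ ENNReal.ofReal (2 * (1 / 2) ^ m) := fun m => by
    refine (hA.ocap_iUnion_le _).trans ((ENNReal.tsum_le_tsum fun n => hB₀c (n + m)).trans ?_)
    have hs : HasSum (fun n : ℕ => (1 / 2 : ℝ) ^ (n + m)) (2 * (1 / 2) ^ m) := by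
      simp only [pow_add]
      exact (hasSum_geometric_two).mul_right _
    rw [← hs.tsum_eq, ENNReal.ofReal_tsum_of_nonneg (fun n => by positivity) hs.summable]
  have hcau : ∀ m x, x ∉ B m → ∀ n ≥ m, |φ (n + 1) x - φ n x| ≤ (1 / 2) ^ n := by
    intro m x hx n hn
    by_contra! h
    refine hx (mem_iUnion.2 ⟨n - m, ?_⟩)
    rw [Nat.sub_add_cancel hn]; exact h
  let f : E d → ℝ := fun x => limUnder atTop fun n => φ n x
  have hlim : ∀ m x, x ∉ B m → Tendsto (fun n => φ n x) atTop (𝓝 (f x)) ∧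
      ∀ n ≥ m, |φ n x - f x| ≤ 2 * (1 / 2) ^ n := by
    intro m x hx
    have hd : ∀ n, dist (φ (n + m) x) (φ (n + 1 + m) x) ≤ (1 / 2) ^ m * (1 / 2) ^ n := fun n => by
      rw [dist_comm, Real.dist_eq, ← pow_add, add_comm m n, show n + 1 + m = n + m + 1 by ring]
      exact hcau m x hx (n + m) (by omega)
    have hc := cauchySeq_of_le_geometric (1 / 2) ((1 / 2) ^ m) (by norm_num) hd
    obtain ⟨l, hl⟩ := cauchySeq_tendsto_of_complete hc
    have hl' : Tendsto (fun n => φ n x) atTop (𝓝 l) := (tendsto_add_atTop_iff_nat m).1 hl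
    have hfl : f x = l := hl'.limUnder_eq
    rw [hfl]
    refine ⟨hl', fun n hn => ?_⟩
    have hb := dist_le_of_le_geometric_of_tendsto (1 / 2) ((1 / 2) ^ m) (by norm_num) hd hl (n - m)
    rw [Nat.sub_add_cancel hn, Real.dist_eq] at hb
    refine hb.trans (le_of_eq ?_)
    rw [← pow_add, Nat.add_sub_cancel' hn]
    ring
  have hnull : ocap s Ω {x | x ∈ Ω ∧ ¬ Tendsto (fun n => φ n x) atTop (𝓝 (f x))} = 0 := by
    have hle : ∀ m, ocap s Ω {x | x ∈ Ω ∧ ¬ Tendsto (fun n => φ n x) atTop (𝓝 (f x))} ≤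
        ENNReal.ofReal (2 * (1 / 2) ^ m) := fun m =>
      (ocap_mono fun x hx => by
        by_contra hxB
        exact hx.2 (hlim m x hxB).1).trans (hBc m)
    refine le_antisymm (ge_of_tendsto' (x := atTop) ?_ hle) zero_le
    have : Tendsto (fun m : ℕ => 2 * (1 / 2 : ℝ) ^ m) atTop (𝓝 0) := by
      simpa using (tendsto_pow_atTop_nhds_zero_of_lt_one (r := (1 / 2 : ℝ)) (by norm_num)
        (by norm_num)).const_mul 2
    simpa [Function.comp_def] using (ENNReal.continuous_ofReal.tendsto 0).comp this
  refine ⟨f, φ, w, hA.isQCRep_iff.2 ⟨hA.quasiCont_iff.2 fun ε hε => ?_, ?_⟩, h1, h2, hwv, hnull⟩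
  · have htend : Tendsto (fun m : ℕ => ENNReal.ofReal (2 * (1 / 2 : ℝ) ^ m)) atTop (𝓝 0) := by
      have : Tendsto (fun m : ℕ => 2 * (1 / 2 : ℝ) ^ m) atTop (𝓝 0) := by
        simpa using (tendsto_pow_atTop_nhds_zero_of_lt_one (r := (1 / 2 : ℝ)) (by norm_num)
          (by norm_num)).const_mul 2
      simpa [Function.comp_def] using (ENNReal.continuous_ofReal.tendsto 0).comp this
    obtain ⟨m, hm⟩ := (htend.eventually (gt_mem_nhds hε)).exists
    refine ⟨B m, hBo m, hBΩ m, (hBc m).trans_lt hm, ?_⟩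
    have hunif : TendstoUniformlyOn φ f atTop (Ω \ B m) := by
      rw [Metric.tendstoUniformlyOn_iff]
      intro δ hδ
      have : Tendsto (fun m : ℕ => 2 * (1 / 2 : ℝ) ^ m) atTop (𝓝 0) := by
        simpa using (tendsto_pow_atTop_nhds_zero_of_lt_one (r := (1 / 2 : ℝ)) (by norm_num)
          (by norm_num)).const_mul 2
      filter_upwards [this.eventually (gt_mem_nhds hδ), eventually_ge_atTop m] with n hn hmn x hx
      rw [dist_comm, Real.dist_eq]
      exact ((hlim m x hx.2).2 n hmn).trans_lt hn
    exact hunif.continuousOn (Frequently.of_forall fun n => (h1 n).continuous.continuousOn)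
  · have hconv : ∀ᵐ x, x ∈ Ω → Tendsto (fun n => φ n x) atTop (𝓝 (f x)) := by
      have := le_antisymm ((volume_le_ocap _).trans hnull.le) zero_le
      filter_upwards [measure_eq_zero_iff_ae_notMem.1 this] with x hx hxΩ
      by_contra h
      exact hx ⟨hxΩ, h⟩
    obtain ⟨ns, hns, h4⟩ := (tendstoInMeasure_of_tendsto_Lp
      ((HS.val.continuous.tendsto v).comp hwv)).exists_seq_tendsto_ae
    filter_upwards [hconv, h4, ae_all_iff.2 h2] with x k1 k2 k3 hx
    refine tendsto_nhds_unique ((k1 hx).comp hns.tendsto_atTop) (k2.congr fun n => ?_)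
    exact k3 _

end QuasiContinuity

/-! ### The obstacle set is closed and convex -/

section ObstacleSet

/-- The elements of `Hˢ₀(Ω)` that lie above `ψ` outside a set of outer capacity zero. -/
def qeAbove (s : ℝ) (Ω : Set (E d)) (ψ : E d → ℝ) : Set (HS s Ω) :=
  {v | ∃ f, IsQCRep s Ω v.val f ∧ ocap s Ω {x | x ∈ Ω ∧ f x < ψ x} = 0}

theorem Admissible.mem_qeAbove_iff (hA : Admissible s Ω) {ψ : E d → ℝ} {v : HS s Ω} {f : E d → ℝ}
    (hf : IsQCRep s Ω v.val f) :
    v ∈ qeAbove s Ω ψ ↔ ocap s Ω {x | x ∈ Ω ∧ f x < ψ x} = 0 := by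
  refine ⟨?_, fun h => ⟨f, hf, h⟩⟩
  rintro ⟨g, hg, h⟩
  refine ocap_null_mono ?_ (hA.ocap_null_union h (hA.rep_unique hf hg))
  rintro x ⟨hx, hlt⟩
  by_cases he : f x = g x
  · exact Or.inl ⟨hx, he ▸ hlt⟩
  · exact Or.inr ⟨hx, he⟩

/-- Quasi-continuity of ψ is what upgrades an exceptional set of inner capacity zero to one of outer
capacity zero. -/
theorem Admissible.mem_obstacleSet_iff_mem_qeAbove (hA : Admissible s Ω) {ψ : E d → ℝ}
    (hψ : QuasiCont s Ω ψ) (v : HS s Ω) : v.val ∈ obstacleSet s Ω ψ ↔ v ∈ qeAbove s Ω ψ := by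
  constructor
  · rintro ⟨-, g, hg, h⟩
    exact ⟨g, hg, hA.ocap_lt_eq_zero_of_QE hψ hg.1 h⟩
  · rintro ⟨f, hf, h⟩
    exact ⟨v.val_mem, f, hf, hA.qe_of_ocap (by simpa using h)⟩

theorem Admissible.mem_obstacleSet_iff (hA : Admissible s Ω) {ψ : E d → ℝ}
    (hψ : QuasiCont s Ω ψ) (v : HS s Ω) {f : E d → ℝ} (hf : IsQCRep s Ω v.val f) :
    v.val ∈ obstacleSet s Ω ψ ↔ ocap s Ω {x | x ∈ Ω ∧ f x < ψ x} = 0 := by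
  rw [hA.mem_obstacleSet_iff_mem_qeAbove hψ, hA.mem_qeAbove_iff hf]

theorem Admissible.convex_qeAbove (hA : Admissible s Ω) {ψ : E d → ℝ} : Convex ℝ (qeAbove s Ω ψ) := by
  intro u hu v hv a b ha hb hab
  obtain ⟨f, -, -, hf, -⟩ := hA.exists_rep u
  obtain ⟨g, -, -, hg, -⟩ := hA.exists_rep v
  have hr : IsQCRep s Ω (a • u + b • v).val fun x => a * f x + b * g x :=
    hA.isQCRep_comp₂ hf hg (F := fun p => a * p.1 + b * p.2) (by fun_prop) (HS.val_combo u v a b)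
  refine (hA.mem_qeAbove_iff hr).2 (ocap_null_mono ?_ (hA.ocap_null_union
    ((hA.mem_qeAbove_iff hf).1 hu) ((hA.mem_qeAbove_iff hg).1 hv)))
  rintro x ⟨hx, hlt⟩
  by_contra h
  simp only [mem_union, mem_ofPred_eq, hx, true_and, not_or, not_lt] at h
  have : ψ x ≤ a * f x + b * g x := by
    calc ψ x = a * ψ x + b * ψ x := by rw [← add_mul, hab, one_mul]
      _ ≤ _ := by gcongr; exacts [h.1, h.2]
  exact absurd hlt (not_lt.2 this)

/-- Where the limit lies below ψ by at least 1/(k+1), either `w n` lies below ψ, a null event, or `w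
n` differs from the limit by at least 1/(k+1), which has small capacity by Chebyshev. The obstacle
is arbitrary here; the minimum principle applies this to a discontinuous one. -/
theorem Admissible.isClosed_qeAbove (hA : Admissible s Ω) {ψ : E d → ℝ} : IsClosed (qeAbove s Ω ψ) := by
  refine IsSeqClosed.isClosed fun w a hw ha => ?_
  obtain ⟨f, -, -, hf, -⟩ := hA.exists_rep a
  refine (hA.mem_qeAbove_iff hf).2 ?_
  have key : ∀ k : ℕ, ocap s Ω {x | x ∈ Ω ∧ f x + 1 / (k + 1) ≤ ψ x} = 0 := by
    intro k
    have hc : (0 : ℝ) < 1 / (k + 1) := by positivity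
    have hle : ∀ n, ocap s Ω {x | x ∈ Ω ∧ f x + 1 / (k + 1) ≤ ψ x} ≤
        ENNReal.ofReal (2 * ‖w n - a‖ ^ 2 / (1 / (k + 1)) ^ 2) := by
      intro n
      obtain ⟨g, -, -, hg, -⟩ := hA.exists_rep (w n)
      have h1 := (hA.mem_qeAbove_iff hg).1 (hw n)
      have h2 := hA.ocap_abs_ge_le (hA.isQCRep_sub hg hf) hc
      calc _ ≤ ocap s Ω ({x | x ∈ Ω ∧ g x < ψ x} ∪ {x | x ∈ Ω ∧ 1 / (k + 1) ≤ |g x - f x|}) := by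
            refine ocap_mono ?_
            rintro x ⟨hx, hfx⟩
            rcases lt_or_ge (g x) (ψ x) with h | h
            · exact Or.inl ⟨hx, h⟩
            · exact Or.inr ⟨hx, le_trans (by linarith) (le_abs_self _)⟩
        _ ≤ _ := hA.ocap_union_le _ _
        _ ≤ _ := by rw [h1, zero_add]; exact h2
    refine le_antisymm (ge_of_tendsto' (x := atTop) ?_ hle) zero_le
    have h3 := tendsto_iff_norm_sub_tendsto_zero.1 ha
    have : Tendsto (fun n => 2 * ‖w n - a‖ ^ 2 / (1 / ((k : ℝ) + 1)) ^ 2) atTop (𝓝 0) := by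
      have := ((h3.pow 2).const_mul 2).div_const ((1 / ((k : ℝ) + 1)) ^ 2)
      rwa [zero_pow two_ne_zero, mul_zero, zero_div] at this
    have := (ENNReal.continuous_ofReal.tendsto 0).comp this
    rwa [ENNReal.ofReal_zero] at this
  refine ocap_null_mono ?_ (hA.ocap_null_iUnion key)
  rintro x ⟨hx, hlt⟩
  obtain ⟨k, hk⟩ := exists_nat_one_div_lt (sub_pos.2 hlt)
  exact mem_iUnion.2 ⟨k, hx, by linarith⟩

end ObstacleSet

end

section

variable {d : ℕ} {s : ℝ} {Ω : Set (E d)} {g : E d → E d → ℝ → ℝ} {gLow gUp γLow γUp : ℝ}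

/-! ### The nonlinear operator -/

section Operator

/-- The coefficient of the linear operator that agrees with the nonlinear one at `u`. -/
def frozenWeight (s : ℝ) (g : E d → E d → ℝ → ℝ) (γLow : ℝ) (u : E d → ℝ) (p : E d × E d) : ℝ :=
  open Classical in
  -- Nothing is assumed about g at r = 0. The value there is multiplied by 0, and γLow keeps the
  -- weight within its bounds.
  if delta s u p.1 p.2 = 0 then γLow else g p.1 p.2 |delta s u p.1 p.2|

theorem frozenWeight_mul_delta (u : E d → ℝ) (p : E d × E d) :
    frozenWeight s g γLow u p * delta s u p.1 p.2 =
      g p.1 p.2 |delta s u p.1 p.2| * delta s u p.1 p.2 := by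
  unfold frozenWeight
  split_ifs with h
  · simp [h]
  · rfl

theorem integrand_eq (u v : E d → ℝ) (p : E d × E d) :
    g p.1 p.2 |delta s u p.1 p.2| * delta s u p.1 p.2 * delta s v p.1 p.2 / ‖p.1 - p.2‖ ^ d =
      frozenWeight s g γLow u p * dq s u p * dq s v p := by
  rw [← frozenWeight_mul_delta (γLow := γLow), ← delta_div_sqrt, ← delta_div_sqrt]
  have h : √(‖p.1 - p.2‖ ^ d) * √(‖p.1 - p.2‖ ^ d) = ‖p.1 - p.2‖ ^ d :=
    Real.mul_self_sqrt (by positivity)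
  rw [mul_assoc, mul_assoc, div_mul_div_comm, h, mul_div_assoc]

theorem measurable_delta {u : E d → ℝ} (hu : Measurable u) :
    Measurable fun p : E d × E d => delta s u p.1 p.2 := by
  unfold delta; fun_prop

theorem IsKernel.measurable_frozenWeight (hg : IsKernel g gLow gUp γLow γUp) {u : E d → ℝ}
    (hu : Measurable u) : Measurable (frozenWeight s g γLow u) := by
  classical
  have hδ := measurable_delta (s := s) hu
  refine Measurable.ite (hδ (measurableSet_singleton 0)) measurable_const ?_
  exact hg.measurable.comp (measurable_fst.prodMk (measurable_snd.prodMk hδ.abs))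

theorem IsKernel.frozenWeight_bounds (hg : IsKernel g gLow gUp γLow γUp) :
    ∀ᵐ p : E d × E d, ∀ u : E d → ℝ,
      γLow ≤ frozenWeight s g γLow u p ∧ frozenWeight s g γLow u p ≤ γUp := by
  filter_upwards [hg.bounds] with p hp u
  unfold frozenWeight
  split_ifs with h
  · exact ⟨le_rfl, (hp 1 one_pos).1.trans (hp 1 one_pos).2⟩
  · exact hp _ (abs_pos.2 h)

theorem IsKernel.γUp_pos (hg : IsKernel g gLow gUp γLow γUp) : 0 < γUp := by
  obtain ⟨p, hp⟩ := hg.bounds.exists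
  exact hg.γLow_pos.trans_le ((hp 1 one_pos).1.trans (hp 1 one_pos).2)

/-- The scalar flux estimate, rescaled by the weight. The exceptional null set is independent of u
and v, so the estimate applies to all functions at once. -/
theorem IsKernel.flux_increment (hg : IsKernel g gLow gUp γLow γUp) :
    ∀ᵐ p : E d × E d, ∀ u v : E d → ℝ,
      γLow * min 1 gLow * (dq s u p - dq s v p) ^ 2 ≤
        (frozenWeight s g γLow u p * dq s u p - frozenWeight s g γLow v p * dq s v p) *
          (dq s u p - dq s v p) ∧
      |frozenWeight s g γLow u p * dq s u p - frozenWeight s g γLow v p * dq s v p| ≤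
        γUp * max 1 gUp * |dq s u p - dq s v p| := by
  filter_upwards [hg.locallyLipschitz, hg.growth, hg.bounds] with p h1 h2 h3 u v
  have hinc : ∀ a b : ℝ, a ≤ b → _ := fun a b hab =>
    kernel_flux_increment hg.gLow_pos hg.γLow_pos h1 h2 h3 hab
  simp only [← delta_div_sqrt]
  rw [mul_div_assoc', mul_div_assoc', frozenWeight_mul_delta, frozenWeight_mul_delta, ← sub_div,
    ← sub_div]
  set t := √(‖p.1 - p.2‖ ^ d)
  have ht : 0 ≤ t := Real.sqrt_nonneg _
  set a := delta s u p.1 p.2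
  set b := delta s v p.1 p.2
  have key : γLow * min 1 gLow * (a - b) ^ 2 ≤ (g p.1 p.2 |a| * a - g p.1 p.2 |b| * b) * (a - b) ∧
      |g p.1 p.2 |a| * a - g p.1 p.2 |b| * b| ≤ γUp * max 1 gUp * |a - b| := by
    have hc : 0 < γLow * min 1 gLow := mul_pos hg.γLow_pos (lt_min one_pos hg.gLow_pos)
    rcases le_total a b with h | h
    · have := hinc a b h
      have hab := sub_nonneg.2 h
      refine ⟨by nlinarith [this.1], ?_⟩
      rw [abs_sub_comm, abs_sub_comm a b, abs_of_nonneg hab, abs_of_nonneg]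
      · exact this.2
      · nlinarith [this.1]
    · have := hinc b a h
      have hab := sub_nonneg.2 h
      refine ⟨by nlinarith [this.1], ?_⟩
      rw [abs_of_nonneg hab, abs_of_nonneg]
      · exact this.2
      · nlinarith [this.1]
  constructor
  · rw [div_pow, div_mul_div_comm, mul_div_assoc', pow_two t]
    exact div_le_div_of_nonneg_right key.1 (by positivity)
  · rw [abs_div, abs_div, abs_of_nonneg ht, mul_div_assoc']
    exact div_le_div_of_nonneg_right key.2 ht

theorem HS.memLp_dq (v : HS s Ω) : MemLp (dq s v.val) 2 (volume : Measure (E d × E d)) :=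
  (memLp_congr_ae v.grad_ae).1 (Lp.memLp v.grad)

theorem IsKernel.memLp_flux (hg : IsKernel g gLow gUp γLow γUp) (u : HS s Ω) :
    MemLp (fun p => frozenWeight s g γLow u.val p * dq s u.val p) 2
      (volume : Measure (E d × E d)) := by
  refine u.memLp_dq.of_le_mul (c := γUp) ((hg.measurable_frozenWeight u.measurable_val).mul
    (measurable_dq s u.measurable_val)).aestronglyMeasurable ?_
  filter_upwards [hg.frozenWeight_bounds (s := s)] with p hp
  rw [norm_mul]
  gcongr
  rw [Real.norm_eq_abs, abs_of_nonneg (hg.γLow_pos.le.trans (hp _).1)]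
  exact (hp _).2

theorem IsKernel.integrable_opL (hg : IsKernel g gLow gUp γLow γUp) (u v : HS s Ω) :
    Integrable (fun p : E d × E d =>
      frozenWeight s g γLow u.val p * dq s u.val p * dq s v.val p) :=
  (hg.memLp_flux u).integrable_mul v.memLp_dq

theorem opL_eq_integral (u v : E d → ℝ) : opL s g u v =
    ∫ p : E d × E d, frozenWeight s g γLow u p * dq s u p * dq s v p := by
  unfold opL
  exact integral_congr_ae (Eventually.of_forall fun p => integrand_eq u v p)

theorem opL_congr_right (u : E d → ℝ) {v w : E d → ℝ} (h : v =ᵐ[volume] w) :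
    opL s g u v = opL s g u w := by
  rw [opL_eq_integral (γLow := 0), opL_eq_integral (γLow := 0)]
  refine integral_congr_ae ?_
  filter_upwards [dq_congr s h] with p hp
  rw [hp]

/-- The flux of an element of `Hˢ₀(Ω)`. -/
def IsKernel.flux (hg : IsKernel g gLow gUp γLow γUp) (u : HS s Ω) : L2P d :=
  (hg.memLp_flux u).toLp _

theorem IsKernel.opL_eq_inner (hg : IsKernel g gLow gUp γLow γUp) (u v : HS s Ω) :
    opL s g u.val v.val = inner ℝ (hg.flux u) v.grad := by
  rw [opL_eq_integral (γLow := γLow), L2.inner_def]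
  refine integral_congr_ae ?_
  filter_upwards [(hg.memLp_flux u).coeFn_toLp, v.grad_ae] with p h1 h2
  rw [IsKernel.flux, h1, h2]
  exact mul_comm _ _

/-- The operator in the Hilbert space `Hˢ₀(Ω)`. -/
def IsKernel.op (hg : IsKernel g gLow gUp γLow γUp) (u : HS s Ω) : HS s Ω :=
  (InnerProductSpace.toDual ℝ (HS s Ω)).symm ((innerSL ℝ (hg.flux u)).comp HS.grad)

theorem IsKernel.inner_op (hg : IsKernel g gLow gUp γLow γUp) (u v : HS s Ω) :
    inner ℝ (hg.op u) v = opL s g u.val v.val := by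
  rw [hg.opL_eq_inner, IsKernel.op, InnerProductSpace.toDual_symm_apply]
  rfl

theorem IsKernel.norm_op_sub_le (hg : IsKernel g gLow gUp γLow γUp) (u v : HS s Ω) :
    ‖hg.op u - hg.op v‖ ≤ γUp * max 1 gUp * ‖u - v‖ := by
  have h0 : 0 ≤ γUp * max 1 gUp := mul_nonneg hg.γUp_pos.le (zero_le_one.trans (le_max_left _ _))
  have h1 : ‖hg.flux u - hg.flux v‖ ≤ γUp * max 1 gUp * ‖(u - v).grad‖ := by
    refine Lp.norm_le_mul_norm_of_ae_le_mul ?_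
    rw [map_sub]
    filter_upwards [hg.flux_increment (s := s), (hg.memLp_flux u).coeFn_toLp,
      (hg.memLp_flux v).coeFn_toLp, Lp.coeFn_sub (hg.flux u) (hg.flux v),
      Lp.coeFn_sub u.grad v.grad, u.grad_ae, v.grad_ae] with p k1 k2 k3 k4 k5 k6 k7
    rw [k4, k5, Pi.sub_apply, Pi.sub_apply, k6, k7, IsKernel.flux, IsKernel.flux, k2, k3]
    exact (k1 _ _).2
  have h2 : ‖hg.op u - hg.op v‖ ≤ ‖hg.flux u - hg.flux v‖ := by
    have e : inner ℝ (hg.op u - hg.op v) (hg.op u - hg.op v) =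
        inner ℝ (hg.flux u - hg.flux v) (hg.op u - hg.op v).grad := by
      rw [inner_sub_left, hg.inner_op, hg.inner_op, hg.opL_eq_inner, hg.opL_eq_inner,
        ← inner_sub_left]
    rw [real_inner_self_eq_norm_sq] at e
    have k1 := real_inner_le_norm (hg.flux u - hg.flux v) (hg.op u - hg.op v).grad
    have k2 := (hg.op u - hg.op v).norm_grad_le
    by_contra! h
    have k3 : 0 < ‖hg.op u - hg.op v‖ := (norm_nonneg _).trans_lt h
    have k4 : ‖hg.flux u - hg.flux v‖ * ‖(hg.op u - hg.op v).grad‖ ≤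
      ‖hg.flux u - hg.flux v‖ * ‖hg.op u - hg.op v‖ := by gcongr
    nlinarith
  exact h2.trans (h1.trans (by gcongr; exact (u - v).norm_grad_le))

theorem L2P_norm_sq (U : L2P d) : ‖U‖ ^ 2 = ∫ p, U p ^ 2 := by
  rw [← real_inner_self_eq_norm_sq, L2.inner_def]
  simp [pow_two]

theorem HS.norm_grad_sq (v : HS s Ω) : ‖v.grad‖ ^ 2 = ∫ p, dq s v.val p ^ 2 := by
  rw [L2P_norm_sq]
  refine integral_congr_ae ?_
  filter_upwards [v.grad_ae] with p hp
  rw [hp]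

theorem HS.integrable_dq_sq (v : HS s Ω) : Integrable fun p => dq s v.val p ^ 2 :=
  v.memLp_dq.integrable_sq

theorem IsKernel.op_strongly_monotone (hg : IsKernel g gLow gUp γLow γUp) (u v : HS s Ω) :
    γLow * min 1 gLow * ‖(u - v).grad‖ ^ 2 ≤ inner ℝ (hg.op u - hg.op v) (u - v) := by
  rw [inner_sub_left, hg.inner_op, hg.inner_op, opL_eq_integral (γLow := γLow),
    opL_eq_integral (γLow := γLow),
    ← integral_sub (hg.integrable_opL u (u - v)) (hg.integrable_opL v (u - v)), HS.norm_grad_sq,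
    ← integral_const_mul]
  refine integral_mono_ae ((u - v).integrable_dq_sq.const_mul _)
    ((hg.integrable_opL u (u - v)).sub (hg.integrable_opL v (u - v))) ?_
  filter_upwards [hg.flux_increment (s := s), dq_congr s (HS.val_sub u v)] with p h1 h2
  have h3 := (h1 u.val v.val).1
  simp only [h2, dq_sub]
  linarith

/-- Unique solvability of variational inequalities for the operator. -/
theorem Admissible.exists_solution (hA : Admissible s Ω) (hg : IsKernel g gLow gUp γLow γUp)
    {C : Set (HS s Ω)} (hne : C.Nonempty) (hcl : IsClosed C) (hconv : Convex ℝ C) :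
    ∃ u ∈ C, ∀ v ∈ C, 0 ≤ opL s g u.val (v - u).val := by
  obtain ⟨P, hP, hP'⟩ := HS.exists_norm_le_grad (s := s) hA.dim_pos hA.pos hA.isOpen hA.bounded
  have hc : 0 < γLow * min 1 gLow := mul_pos hg.γLow_pos (lt_min one_pos hg.gLow_pos)
  obtain ⟨u, hu, h⟩ := exists_variationalInequality hne hcl hconv hg.op
    (c := γLow * min 1 gLow / P) (by positivity) (fun u v => by
      refine le_trans ?_ (hg.op_strongly_monotone u v)
      rw [div_mul_eq_mul_div, div_le_iff₀ hP]
      nlinarith [mul_le_mul_of_nonneg_left (hP' (u - v)) hc.le]) hg.norm_op_sub_le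
  exact ⟨u, hu, fun v hv => by rw [← hg.inner_op]; exact h v hv⟩

theorem Admissible.eq_of_opL (hA : Admissible s Ω) (hg : IsKernel g gLow gUp γLow γUp)
    {u w : HS s Ω} (h1 : 0 ≤ opL s g u.val (w - u).val) (h2 : 0 ≤ opL s g w.val (u - w).val) :
    w = u := by
  obtain ⟨P, hP, hP'⟩ := HS.exists_norm_le_grad (s := s) hA.dim_pos hA.pos hA.isOpen hA.bounded
  have hc : 0 < γLow * min 1 gLow := mul_pos hg.γLow_pos (lt_min one_pos hg.gLow_pos)
  rw [← hg.inner_op] at h1 h2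
  have h3 := hg.op_strongly_monotone u w
  have e : inner ℝ (hg.op u - hg.op w) (u - w) =
      -(inner ℝ (hg.op u) (w - u) + inner ℝ (hg.op w) (u - w)) := by
    rw [← neg_sub w u, inner_sub_left, inner_neg_right]; ring
  have h4 : ‖(u - w).grad‖ ^ 2 ≤ 0 := by nlinarith [sq_nonneg ‖(u - w).grad‖]
  have h5 : ‖u - w‖ ^ 2 ≤ 0 := (hP' _).trans (by nlinarith)
  have h6 : ‖u - w‖ = 0 := by nlinarith [norm_nonneg (u - w)]
  exact (sub_eq_zero.1 (norm_eq_zero.1 h6)).symm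

/-- Cauchy–Schwarz with the size of the weight instead of the increments of the flux. Here and in
`IsKernel.le_opL_self` only the γ constants appear, and so only they enter the final estimates. -/
theorem IsKernel.abs_opL_le (hg : IsKernel g gLow gUp γLow γUp) (u v : HS s Ω) :
    |opL s g u.val v.val| ≤ γUp * ‖u.grad‖ * ‖v.grad‖ := by
  rw [hg.opL_eq_inner]
  refine (abs_real_inner_le_norm _ _).trans ?_
  gcongr
  refine Lp.norm_le_mul_norm_of_ae_le_mul ?_
  filter_upwards [hg.frozenWeight_bounds (s := s), (hg.memLp_flux u).coeFn_toLp, u.grad_ae]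
    with p h1 h2 h3
  rw [IsKernel.flux, h2, h3, norm_mul]
  gcongr
  rw [Real.norm_eq_abs, abs_of_nonneg (hg.γLow_pos.le.trans (h1 _).1)]
  exact (h1 _).2

theorem IsKernel.le_opL_self (hg : IsKernel g gLow gUp γLow γUp) (u : HS s Ω) :
    γLow * ‖u.grad‖ ^ 2 ≤ opL s g u.val u.val := by
  rw [opL_eq_integral (γLow := γLow), HS.norm_grad_sq, ← integral_const_mul]
  refine integral_mono_ae (u.integrable_dq_sq.const_mul _) (hg.integrable_opL u u) ?_
  filter_upwards [hg.frozenWeight_bounds (s := s)] with p hp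
  have := mul_le_mul_of_nonneg_right (hp u.val).1 (sq_nonneg (dq s u.val p))
  beta_reduce
  linarith

theorem IsKernel.opL_add (hg : IsKernel g gLow gUp γLow γUp) (u v w : HS s Ω) :
    opL s g u.val (v + w).val = opL s g u.val v.val + opL s g u.val w.val := by
  rw [← hg.inner_op, ← hg.inner_op, ← hg.inner_op, inner_add_right]

theorem IsKernel.opL_sub (hg : IsKernel g gLow gUp γLow γUp) (u v w : HS s Ω) :
    opL s g u.val (v - w).val = opL s g u.val v.val - opL s g u.val w.val := by
  rw [← hg.inner_op, ← hg.inner_op, ← hg.inner_op, inner_sub_right]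

theorem IsKernel.opL_smul (hg : IsKernel g gLow gUp γLow γUp) (u v : HS s Ω) (c : ℝ) :
    opL s g u.val (c • v).val = c * opL s g u.val v.val := by
  rw [← hg.inner_op, ← hg.inner_op, inner_smul_right]

end Operator

/-! ### The obstacle problem: existence, sign and norm bound -/

section Obstacle

variable {ψ : E d → ℝ}

theorem Admissible.isObstacleSol_iff (hA : Admissible s Ω) (u : HS s Ω) :
    IsObstacleSol s g Ω ψ u.val ↔ u.val ∈ obstacleSet s Ω ψ ∧
      ∀ v : HS s Ω, v.val ∈ obstacleSet s Ω ψ → 0 ≤ opL s g u.val (v - u).val := by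
  constructor
  · rintro ⟨h1, h2⟩
    exact ⟨h1, fun v hv => by rw [map_sub]; exact h2 _ hv⟩
  · rintro ⟨h1, h2⟩
    refine ⟨h1, fun v hv => ?_⟩
    obtain ⟨w, rfl⟩ := HS.exists_val_eq hA.dim_pos hA.pos hA.lt_one hv.1
    rw [← map_sub]; exact h2 w hv

theorem Admissible.exists_obstacleSol (hA : Admissible s Ω) (hg : IsKernel g gLow gUp γLow γUp)
    (hψ : MemL2Cap s Ω ψ) : ∃ u : HS s Ω, IsObstacleSol s g Ω ψ u.val ∧
      ∀ w : L2 d, IsObstacleSol s g Ω ψ w → w = u.val := by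
  obtain ⟨v, hv, f, hf, hψf⟩ := hψ.2
  obtain ⟨v, rfl⟩ := HS.exists_val_eq hA.dim_pos hA.pos hA.lt_one hv
  have hvK : v.val ∈ obstacleSet s Ω ψ := by
    refine ⟨hv, f, hf, le_antisymm ((capS_mono ?_).trans hψf.le) zero_le⟩
    rintro x ⟨h1, h2⟩
    exact ⟨h1, fun h => h2 ((le_abs_self _).trans h)⟩
  obtain ⟨u, hu, hmin⟩ := hA.exists_solution hg (C := qeAbove s Ω ψ)
    ⟨v, (hA.mem_obstacleSet_iff_mem_qeAbove hψ.1 v).1 hvK⟩ hA.isClosed_qeAbove hA.convex_qeAbove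
  simp only [← hA.mem_obstacleSet_iff_mem_qeAbove hψ.1] at hu hmin
  refine ⟨u, (hA.isObstacleSol_iff u).2 ⟨hu, hmin⟩, fun w hw => ?_⟩
  obtain ⟨w, rfl⟩ := HS.exists_val_eq hA.dim_pos hA.pos hA.lt_one hw.1.1
  obtain ⟨h1, h2⟩ := (hA.isObstacleSol_iff w).1 hw
  rw [hA.eq_of_opL hg (hmin w h1) (h2 u hu)]

/-- An a.e. inequality between two elements becomes q.e. for their representatives, so the obstacle
set is stable upwards. -/
theorem Admissible.obstacleSet_mono (hA : Admissible s Ω) (hψ : QuasiCont s Ω ψ) {u v : HS s Ω}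
    (hu : u.val ∈ obstacleSet s Ω ψ) (h : ∀ᵐ x, u.val x ≤ v.val x) :
    v.val ∈ obstacleSet s Ω ψ := by
  obtain ⟨f, -, -, hf, -⟩ := hA.exists_rep u
  obtain ⟨k, -, -, hk, -⟩ := hA.exists_rep v
  refine (hA.mem_obstacleSet_iff hψ v hk).2 (ocap_null_mono ?_ (hA.ocap_null_union
    ((hA.mem_obstacleSet_iff hψ u hf).1 hu) (hA.ocap_lt_eq_zero_of_ae hf.1 hk.1 hA.isOpen
      subset_rfl (by
        filter_upwards [h, (hA.isQCRep_iff.1 hf).2, (hA.isQCRep_iff.1 hk).2] with x h1 h2 h3 hx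
        rw [h2 hx, h3 hx]; exact h1))))
  rintro x ⟨hx, hlt⟩
  rcases lt_or_ge (f x) (ψ x) with h' | h'
  · exact Or.inl ⟨hx, h'⟩
  · exact Or.inr ⟨hx, hlt.trans_le h'⟩

theorem Admissible.opL_nonneg (hA : Admissible s Ω) (hψ : QuasiCont s Ω ψ) {u : HS s Ω}
    (hu : IsObstacleSol s g Ω ψ u.val) {v : HS s Ω} (hv : ∀ᵐ x, 0 ≤ v.val x) :
    0 ≤ opL s g u.val v.val := by
  obtain ⟨h1, h2⟩ := (hA.isObstacleSol_iff u).1 hu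
  have := h2 (u + v) (hA.obstacleSet_mono hψ h1 (by
    filter_upwards [HS.val_add u v, hv] with x k1 k2
    rw [k1]; linarith))
  rwa [add_sub_cancel_left] at this

/-- The positive part of u dominates u and is therefore admissible whatever the sign of ψ. Testing
with it gives 0 ≤ ⟨𝓛u, u⁻⟩ ≤ -γ_* ‖u⁻‖², because (a - b)(a⁻ - b⁻) ≤ -(a⁻ - b⁻)². -/
theorem Admissible.sol_nonneg (hA : Admissible s Ω) (hg : IsKernel g gLow gUp γLow γUp)
    (hψ : QuasiCont s Ω ψ) {u : HS s Ω} (hu : IsObstacleSol s g Ω ψ u.val) :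
    ∀ᵐ x, 0 ≤ u.val x := by
  obtain ⟨w, hw, -⟩ := u.exists_pos hA.dim_pos hA.pos hA.lt_one hA.isOpen
  obtain ⟨h1, h2⟩ := (hA.isObstacleSol_iff u).1 hu
  have h3 := h2 w (hA.obstacleSet_mono hψ h1 (by
    filter_upwards [hw] with x hx
    rw [hx]; exact le_max_left _ _))
  have h4 : opL s g u.val (w - u).val ≤ -(γLow * ‖(w - u).grad‖ ^ 2) := by
    rw [opL_eq_integral (γLow := γLow), HS.norm_grad_sq, ← integral_const_mul, ← integral_neg]
    refine integral_mono_ae (hg.integrable_opL u (w - u))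
      ((w - u).integrable_dq_sq.const_mul _).neg ?_
    have he : (w - u).val =ᵐ[volume] fun x => max (-u.val x) 0 := by
      filter_upwards [HS.val_sub w u, hw] with x k1 k2
      rw [k1, k2, ← max_sub_sub_right, sub_self, zero_sub, max_comm]
    filter_upwards [hg.frozenWeight_bounds (s := s), dq_congr s he] with p k1 k2
    have k3 := (k1 u.val).1
    simp only [k2]
    unfold dq
    set W := radialWeight d s ‖p.1 - p.2‖
    set a := u.val p.1
    set b := u.val p.2
    set k := frozenWeight s g γLow u.val p
    have e1 : (a - b) * (max (-a) 0 - max (-b) 0) ≤ -(max (-a) 0 - max (-b) 0) ^ 2 := by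
      rcases le_total (-a) 0 with ha | ha <;> rcases le_total (-b) 0 with hb | hb <;>
        simp only [max_eq_left, max_eq_right, ha, hb] <;> nlinarith
    have e2 : 0 ≤ (max (-a) 0 - max (-b) 0) ^ 2 := sq_nonneg _
    have e3 : 0 ≤ W ^ 2 := sq_nonneg _
    have e4 := hg.γLow_pos
    have e5 : k * ((a - b) * (max (-a) 0 - max (-b) 0)) ≤
        -(γLow * (max (-a) 0 - max (-b) 0) ^ 2) := by
      calc _ ≤ k * (-(max (-a) 0 - max (-b) 0) ^ 2) :=
            mul_le_mul_of_nonneg_left e1 (e4.le.trans k3)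
        _ ≤ _ := by nlinarith
    nlinarith [mul_le_mul_of_nonneg_right e5 e3]
  have h5 : ‖(w - u).grad‖ ^ 2 ≤ 0 := by
    have := hg.γLow_pos
    nlinarith [sq_nonneg ‖(w - u).grad‖]
  obtain ⟨P, hP, hP'⟩ := HS.exists_norm_le_grad (s := s) hA.dim_pos hA.pos hA.isOpen hA.bounded
  have h6 : ‖w - u‖ ^ 2 ≤ 0 := (hP' _).trans (by nlinarith)
  have h7 : ‖w - u‖ = 0 := by nlinarith [norm_nonneg (w - u)]
  have h8 : w = u := sub_eq_zero.1 (norm_eq_zero.1 h7)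
  rw [h8] at hw
  filter_upwards [hw] with x hx
  rw [hx]; exact le_max_right _ _

/-- The chain is γ_* ‖u‖² ≤ ⟨𝓛u, u⟩ ≤ ⟨𝓛u, v⟩ ≤ γ* ‖u‖ ‖v‖. -/
theorem Admissible.norm_grad_sol_le (hA : Admissible s Ω) (hg : IsKernel g gLow gUp γLow γUp)
    {u v : HS s Ω} (hu : IsObstacleSol s g Ω ψ u.val) (hv : v.val ∈ obstacleSet s Ω ψ) :
    ‖u.grad‖ ≤ γUp / γLow * ‖v.grad‖ := by
  obtain ⟨h1, h2⟩ := (hA.isObstacleSol_iff u).1 hu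
  have h3 := h2 v hv
  rw [hg.opL_sub] at h3
  have h4 := hg.le_opL_self u
  have h5 := (le_abs_self _).trans (hg.abs_opL_le u v)
  have h6 := hg.γLow_pos
  rw [div_mul_eq_mul_div, le_div_iff₀ h6]
  rcases (norm_nonneg u.grad).eq_or_lt with h0 | h0
  · rw [← h0, zero_mul]; exact mul_nonneg hg.γUp_pos.le (norm_nonneg _)
  · by_contra! h
    nlinarith

theorem Admissible.hsNorm_sol_le (hA : Admissible s Ω) (hg : IsKernel g gLow gUp γLow γUp)
    (hψ : MemL2Cap s Ω ψ) {u : HS s Ω} (hu : IsObstacleSol s g Ω ψ u.val) :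
    hsNorm s u.val ≤ γUp / γLow * l2CapNorm s Ω (fun x => max (ψ x) 0) := by
  have hγ : 0 < γUp / γLow := div_pos hg.γUp_pos hg.γLow_pos
  rw [← div_le_iff₀' hγ]
  -- The infimum is meaningful only for a nonempty set of majorants; any majorant of |ψ| also
  -- dominates ψ⁺.
  refine le_csInf ?_ ?_
  · obtain ⟨v, hv, f, hf, hq⟩ := hψ.2
    refine Set.Nonempty.image _ ⟨v, hv, f, hf, le_antisymm ((capS_mono ?_).trans hq.le) zero_le⟩
    rintro x ⟨h1, h2⟩
    refine ⟨h1, fun h => h2 (le_trans ?_ h)⟩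
    change |max (ψ x) 0| ≤ |ψ x|
    rw [abs_of_nonneg (le_max_right _ _)]
    exact max_le (le_abs_self _) (abs_nonneg _)
  · rintro _ ⟨v, ⟨hv, f, hf, hq⟩, rfl⟩
    obtain ⟨v, rfl⟩ := HS.exists_val_eq hA.dim_pos hA.pos hA.lt_one hv
    rw [div_le_iff₀' hγ, HS.hsNorm_val, HS.hsNorm_val]
    refine hA.norm_grad_sol_le hg hu ⟨hv, f, hf, le_antisymm ((capS_mono ?_).trans hq.le) zero_le⟩
    rintro x ⟨h1, h2⟩
    refine ⟨h1, fun h => h2 (le_trans ?_ h)⟩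
    change ψ x ≤ |max (ψ x) 0|
    rw [abs_of_nonneg (le_max_right _ _)]
    exact le_max_left _ _

end Obstacle

end

section

variable {d : ℕ} {s : ℝ} {Ω : Set (E d)} {μ ν : Measure (E d)}

/-! ### Radon measures and Lipschitz test functions -/

section Radon

/-- Radon measures on the open set `Ω`. -/
structure RadonOn (Ω : Set (E d)) (μ : Measure (E d)) : Prop where
  compl_null : μ Ωᶜ = 0
  finite_compact : ∀ K : Set (E d), IsCompact K → K ⊆ Ω → μ K < ⊤

theorem LipC.integrable (hμ : RadonOn Ω μ) {φ : E d → ℝ} (h : LipC Ω φ) : Integrable φ μ := by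
  obtain ⟨B, hB⟩ := h.bounded
  refine (integrableOn_iff_integrable_of_support_subset (subset_tsupport φ)).1 ?_
  exact Measure.integrableOn_of_bounded (hμ.finite_compact _ h.compact h.subset).ne
    h.measurable.aestronglyMeasurable (Eventually.of_forall hB)

/-- Positivity is known only on Lipschitz functions. The M. Riesz extension theorem extends the
functional to a positive one on all of C_c(Ω); the Riesz–Markov–Kakutani theorem then gives a
measure on the subtype Ω, which is pushed forward to the whole space. -/
theorem exists_measure_of_nonneg (hΩ : IsOpen Ω) (Λ : (E d → ℝ) → ℝ)
    (hadd : ∀ φ θ, LipC Ω φ → LipC Ω θ → Λ (fun x => φ x + θ x) = Λ φ + Λ θ)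
    (hmul : ∀ φ c, LipC Ω φ → Λ (fun x => c * φ x) = c * Λ φ)
    (hpos : ∀ φ, LipC Ω φ → (∀ x, 0 ≤ φ x) → 0 ≤ Λ φ) :
    ∃ μ : Measure (E d), RadonOn Ω μ ∧ ∀ φ, LipC Ω φ → ∫ x, φ x ∂μ = Λ φ := by
  classical
  have : LocallyCompactSpace Ω := hΩ.locallyCompactSpace
  have hpre : ∀ K : Set (E d), IsCompact K → K ⊆ Ω → IsCompact ((↑) ⁻¹' K : Set Ω) :=
    fun K hK hKΩ => IsInducing.subtypeVal.isCompact_preimage_iff (by simpa using hKΩ) |>.2 hK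
  have hres : ∀ φ, LipC Ω φ → ∃ h : CompactlySupportedContinuousMap Ω ℝ, ∀ x : Ω, h x = φ x := by
    intro φ hφ
    refine ⟨⟨⟨fun x : Ω => φ x, hφ.continuous.comp continuous_subtype_val⟩,
      HasCompactSupport.intro (hpre _ hφ.compact hφ.subset) fun x hx =>
        image_eq_zero_of_notMem_tsupport (f := φ) hx⟩, fun x => rfl⟩
  let ext (h : CompactlySupportedContinuousMap Ω ℝ) : E d → ℝ :=
    fun x => if hx : x ∈ Ω then h ⟨x, hx⟩ else 0
  have hext : ∀ (h : CompactlySupportedContinuousMap Ω ℝ) (φ : E d → ℝ), LipC Ω φ →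
      (∀ x : Ω, h x = φ x) → ext h = φ := by
    intro h φ hφ e
    funext x
    simp only [ext]
    split_ifs with hx
    · exact e ⟨x, hx⟩
    · exact (hφ.eq_zero hx).symm
  let D : Submodule ℝ (CompactlySupportedContinuousMap Ω ℝ) :=
    { carrier := {h | ∃ φ, LipC Ω φ ∧ ∀ x : Ω, h x = φ x}
      add_mem' := by
        rintro a b ⟨φ, hφ, e⟩ ⟨θ, hθ, e'⟩
        exact ⟨_, hφ.add hθ, fun x => by
          rw [CompactlySupportedContinuousMap.add_apply, e, e']⟩
      zero_mem' := by
        obtain ⟨θ, hθ, -⟩ := exists_lipC_one hΩ isCompact_empty (empty_subset Ω)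
        exact ⟨_, hθ.const_mul 0, fun x => by simp⟩
      smul_mem' := by
        rintro c a ⟨φ, hφ, e⟩
        exact ⟨_, hφ.const_mul c, fun x => by
          rw [CompactlySupportedContinuousMap.smul_apply, e, smul_eq_mul]⟩ }
  have hD : ∀ h : D, LipC Ω (ext h) ∧ ∀ x : Ω, (h : CompactlySupportedContinuousMap Ω ℝ) x =
      ext h x := by
    rintro ⟨h, φ, hφ, e⟩
    have := hext h φ hφ e
    exact ⟨this.symm ▸ hφ, fun x => by rw [this]; exact e x⟩
  let F : CompactlySupportedContinuousMap Ω ℝ →ₗ.[ℝ] ℝ :=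
    ⟨D, { toFun := fun h => Λ (ext h)
          map_add' := fun a b => by
            rw [← hadd _ _ (hD a).1 (hD b).1]
            congr 1
            exact hext _ _ ((hD a).1.add (hD b).1) fun x => by
              rw [← (hD a).2, ← (hD b).2]; rfl
          map_smul' := fun c a => by
            rw [RingHom.id_apply, smul_eq_mul, ← hmul _ _ (hD a).1]
            congr 1
            exact hext _ _ ((hD a).1.const_mul c) fun x => by
              rw [← (hD a).2]; rfl }⟩
  let P : PointedCone ℝ (CompactlySupportedContinuousMap Ω ℝ) :=
    { carrier := {h | ∀ x, 0 ≤ h x}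
      add_mem' := fun {a b} ha hb x => add_nonneg (ha x) (hb x)
      zero_mem' := fun x => le_rfl
      smul_mem' := fun c a ha x => mul_nonneg c.2 (ha x) }
  obtain ⟨G, hG, hG0⟩ := riesz_extension P F
    (fun h hh => hpos _ (hD h).1 fun x => by
      by_cases hx : x ∈ Ω
      · rw [← (hD h).2 ⟨x, hx⟩]; exact hh ⟨x, hx⟩
      · rw [(hD h).1.eq_zero hx])
    -- The cofinality condition of the extension theorem: a Lipschitz cut-off of the support of y,
    -- times a bound of |y|, makes the sum with y nonnegative.
    (fun y => by
      obtain ⟨θ, hθ, h0, -, h1⟩ := exists_lipC_one hΩ (y.hasCompactSupport.image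
        continuous_subtype_val) (by rintro _ ⟨x, -, rfl⟩; exact x.2)
      obtain ⟨B, hB⟩ := y.hasCompactSupport.exists_bound_of_continuous y.continuous
      obtain ⟨h, hh⟩ := hres _ (hθ.const_mul B)
      refine ⟨⟨h, _, hθ.const_mul B, hh⟩, fun x => ?_⟩
      rw [CompactlySupportedContinuousMap.add_apply, hh]
      by_cases hx : x ∈ tsupport y
      · rw [h1 _ ⟨x, hx, rfl⟩]
        linarith [(abs_le.1 (hB x)).1]
      · rw [image_eq_zero_of_notMem_tsupport hx, add_zero]
        exact mul_nonneg ((norm_nonneg _).trans (hB x)) (h0 _))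
  let Q := PositiveLinearMap.mk₀ G fun h hh => hG0 h hh
  have hemb := MeasurableEmbedding.subtype_coe hΩ.measurableSet
  refine ⟨(RealRMK.rieszMeasure Q).map (↑), ⟨?_, ?_⟩, ?_⟩
  · rw [hemb.map_apply]
    have : ((↑) ⁻¹' Ωᶜ : Set Ω) = ∅ := by ext x; simp
    rw [this, measure_empty]
  · intro K hK hKΩ
    rw [hemb.map_apply]
    exact (hpre K hK hKΩ).measure_lt_top
  · intro φ hφ
    obtain ⟨h, hh⟩ := hres φ hφ
    rw [hemb.integral_map]
    simp_rw [← hh]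
    rw [RealRMK.integral_rieszMeasure]
    change G h = _
    have := hG ⟨h, φ, hφ, hh⟩
    rw [this]
    change Λ (ext h) = _
    rw [hext h φ hφ hh]

theorem exists_compact_exhaustion {U : Set (E d)} (hU : IsOpen U) :
    ∃ K : ℕ → Set (E d), (∀ n, IsCompact (K n)) ∧ (∀ n, K n ⊆ U) ∧ Monotone K ∧ ⋃ n, K n = U := by
  obtain ⟨F, h1, h2, h3, h4⟩ := hU.exists_iUnion_isClosed
  refine ⟨fun n => F n ∩ Metric.closedBall 0 n, fun n =>
    (isCompact_closedBall _ _).inter_left (h1 n), fun n => inter_subset_left.trans (h2 n),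
    fun m n hmn => inter_subset_inter (h4 hmn)
      (Metric.closedBall_subset_closedBall (Nat.cast_le.2 hmn)), ?_⟩
  refine subset_antisymm (iUnion_subset fun n => inter_subset_left.trans (h2 n)) fun x hx => ?_
  rw [← h3] at hx
  obtain ⟨m, hm⟩ := mem_iUnion.1 hx
  obtain ⟨n, hn⟩ := exists_nat_ge (dist x 0)
  exact mem_iUnion.2 ⟨max m n, h4 (le_max_left _ _) hm,
    Metric.mem_closedBall.2 (hn.trans (Nat.cast_le.2 (le_max_right _ _)))⟩

theorem measure_open_le {U : Set (E d)} (hU : IsOpen U) {c : ℝ≥0∞}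
    (h : ∀ K ⊆ U, IsCompact K → μ K ≤ c) : μ U ≤ c := by
  obtain ⟨K, h1, h2, h3, h4⟩ := exists_compact_exhaustion hU
  rw [← h4, h3.measure_iUnion]
  exact iSup_le fun n => h _ (h2 n) (h1 n)

/-- The measure may be infinite, so inner regularity is applied to its restrictions to a compact
exhaustion of Ω, which are finite. -/
theorem RadonOn.measure_le (hΩ : IsOpen Ω) (hμ : RadonOn Ω μ) {A : Set (E d)}
    (hA : MeasurableSet A) {c : ℝ≥0∞} (h : ∀ K ⊆ A, IsCompact K → μ K ≤ c) : μ A ≤ c := by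
  obtain ⟨K, h1, h2, h3, h4⟩ := exists_compact_exhaustion hΩ
  have e : μ A = μ (⋃ n, A ∩ K n) := by
    refine le_antisymm ?_ (measure_mono (iUnion_subset fun n => inter_subset_left))
    rw [← inter_iUnion, h4]
    calc μ A ≤ μ (A ∩ Ω ∪ Ωᶜ) := measure_mono fun x hx => by
          by_cases h : x ∈ Ω
          · exact Or.inl ⟨hx, h⟩
          · exact Or.inr h
      _ ≤ μ (A ∩ Ω) + μ Ωᶜ := measure_union_le _ _
      _ = μ (A ∩ Ω) := by rw [hμ.compl_null, add_zero]
  rw [e, Monotone.measure_iUnion fun m n hmn => inter_subset_inter_right _ (h3 hmn)]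
  refine iSup_le fun n => ?_
  have : IsFiniteMeasure (μ.restrict (K n)) :=
    ⟨by rw [Measure.restrict_apply_univ]; exact hμ.finite_compact _ (h1 n) (h2 n)⟩
  rw [← Measure.restrict_apply hA,
    hA.measure_eq_iSup_isCompact_of_ne_top (measure_ne_top _ _)]
  refine iSup₂_le fun L hL => iSup_le fun hL' => ?_
  rw [Measure.restrict_apply hL'.measurableSet]
  exact (measure_mono inter_subset_left).trans (h L hL hL')

theorem RadonOn.measure_le_integral (hμ : RadonOn Ω μ) {φ : E d → ℝ} (hφ : LipC Ω φ)
    (h0 : ∀ x, 0 ≤ φ x) {K : Set (E d)} (hK : IsCompact K) (h1 : ∀ x ∈ K, 1 ≤ φ x) :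
    μ K ≤ ENNReal.ofReal (∫ x, φ x ∂μ) := by
  rw [ofReal_integral_eq_lintegral_ofReal (hφ.integrable hμ) (Eventually.of_forall h0),
    ← lintegral_indicator_one hK.measurableSet]
  refine lintegral_mono fun x => ?_
  by_cases hx : x ∈ K
  · simpa [hx] using h1 x hx
  · simp [hx]

theorem RadonOn.integral_le_measure (hμ : RadonOn Ω μ) {U : Set (E d)} (hUΩ : U ⊆ Ω)
    {φ : E d → ℝ} (hφ : LipC U φ) (h0 : ∀ x, 0 ≤ φ x) (h1 : ∀ x, φ x ≤ 1) :
    ENNReal.ofReal (∫ x, φ x ∂μ) ≤ μ U := by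
  have hφ' : LipC Ω φ := ⟨hφ.lip, hφ.compact, hφ.subset.trans hUΩ⟩
  rw [ofReal_integral_eq_lintegral_ofReal (hφ'.integrable hμ) (Eventually.of_forall h0)]
  calc _ ≤ ∫⁻ x, (tsupport φ).indicator 1 x ∂μ := by
        refine lintegral_mono fun x => ?_
        by_cases hx : x ∈ tsupport φ
        · simpa [hx] using h1 x
        · simp [hx, image_eq_zero_of_notMem_tsupport hx]
    _ = μ (tsupport φ) := lintegral_indicator_one (isClosed_tsupport φ).measurableSet
    _ ≤ μ U := measure_mono hφ.subset

theorem RadonOn.le_of_integral_eq (hμ : RadonOn Ω μ) (hν : RadonOn Ω ν)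
    (h : ∀ φ, LipC Ω φ → ∫ x, φ x ∂μ = ∫ x, φ x ∂ν) {U : Set (E d)} (hU : IsOpen U)
    (hUΩ : U ⊆ Ω) : μ U ≤ ν U := by
  refine measure_open_le hU fun K hKU hK => ?_
  obtain ⟨θ, h1, h2, h3, h4⟩ := exists_lipC_one hU hK hKU
  have hθ' : LipC Ω θ := ⟨h1.lip, h1.compact, h1.subset.trans hUΩ⟩
  refine (hμ.measure_le_integral hθ' h2 hK fun x hx => (h4 x hx).ge).trans ?_
  rw [h θ hθ']
  exact hν.integral_le_measure hUΩ h1 h2 h3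

/-- Radon measures on `Ω` are determined by the integrals of Lipschitz functions. -/
theorem RadonOn.eq_of_integral_eq (hΩ : IsOpen Ω) (hμ : RadonOn Ω μ) (hν : RadonOn Ω ν)
    (h : ∀ φ, LipC Ω φ → ∫ x, φ x ∂μ = ∫ x, φ x ∂ν) : μ = ν := by
  have hopen : ∀ U, IsOpen U → U ⊆ Ω → μ U = ν U := fun U hU hUΩ =>
    le_antisymm (hμ.le_of_integral_eq hν h hU hUΩ)
      (hν.le_of_integral_eq hμ (fun φ hφ => (h φ hφ).symm) hU hUΩ)
  obtain ⟨K, h1, h2, -, h4⟩ := exists_compact_exhaustion hΩ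
  choose θ k1 k2 k3 k4 using fun n => exists_lipC_one hΩ (h1 n) (h2 n)
  -- Both measures live on a countable union of open sets with compact closure in Ω. On each they
  -- are finite, so agreement on the π-system of open sets is enough.
  have hself : ∀ ρ : Measure (E d), ρ Ωᶜ = 0 → ρ = ρ.restrict (⋃ n, {x | 1 / 2 < θ n x}) := by
    intro ρ hρ
    refine (Measure.restrict_eq_self_of_ae_mem ?_).symm
    have : ∀ᵐ x ∂ρ, x ∈ Ω := hρ
    filter_upwards [this] with x hx
    rw [← h4] at hx
    obtain ⟨n, hn⟩ := mem_iUnion.1 hx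
    exact mem_iUnion.2 ⟨n, by simp only [mem_ofPred_eq, k4 n x hn]; norm_num⟩
  rw [hself μ hμ.compl_null, hself ν hν.compl_null, Measure.restrict_iUnion_congr]
  intro n
  have hUo : IsOpen {x | 1 / 2 < θ n x} := isOpen_lt continuous_const (k1 n).continuous
  have hUs : {x | 1 / 2 < θ n x} ⊆ tsupport (θ n) := fun x hx =>
    subset_tsupport _ (Function.mem_support.2 (by
      have : 1 / 2 < θ n x := hx
      linarith))
  have : IsFiniteMeasure (μ.restrict {x | 1 / 2 < θ n x}) := ⟨by
    rw [Measure.restrict_apply_univ]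
    exact (measure_mono hUs).trans_lt (hμ.finite_compact _ (k1 n).compact (k1 n).subset)⟩
  refine ext_of_generate_finite {U | IsOpen U} (BorelSpace.measurable_eq) isPiSystem_isOpen ?_ ?_
  · intro U (hU : IsOpen U)
    rw [Measure.restrict_apply hU.measurableSet, Measure.restrict_apply hU.measurableSet]
    exact hopen _ (hU.inter hUo) ((inter_subset_right.trans hUs).trans (k1 n).subset)
  · rw [Measure.restrict_apply_univ, Measure.restrict_apply_univ]
    exact hopen _ hUo (hUs.trans (k1 n).subset)

end Radon

end

section

variable {d : ℕ} {s : ℝ} {Ω : Set (E d)} {g : E d → E d → ℝ → ℝ} {gLow gUp γLow γUp : ℝ}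
  {μ : Measure (E d)} {u : HS s Ω}

/-! ### The measure represents the operator -/

section Representation

/-- `μ` represents `𝓛ˢ_g u` on Lipschitz functions. -/
structure RepresentsLip (s : ℝ) (g : E d → E d → ℝ → ℝ) (Ω : Set (E d)) (u : L2 d)
    (μ : Measure (E d)) : Prop where
  radon : RadonOn Ω μ
  integral_eq : ∀ φ, LipC Ω φ → ∫ x, φ x ∂μ = opL s g u φ

theorem HS.norm_grad_le_of_ae {v w : HS s Ω} {φ θ : E d → ℝ} (hv : v.val =ᵐ[volume] φ)
    (hw : w.val =ᵐ[volume] θ) (h : ∀ x y, |θ x - θ y| ≤ |φ x - φ y|) :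
    ‖w.grad‖ ≤ ‖v.grad‖ := by
  refine Lp.norm_le_norm_of_ae_le ?_
  filter_upwards [v.grad_ae, w.grad_ae, dq_congr s hv, dq_congr s hw] with p h1 h2 h3 h4
  rw [h1, h2, h3, h4, Real.norm_eq_abs, Real.norm_eq_abs]
  unfold dq
  rw [abs_mul, abs_mul]
  exact mul_le_mul_of_nonneg_right (h _ _) (abs_nonneg _)

/-- On Lipschitz functions v ↦ ⟨𝓛u, v⟩ is linear, and the hypothesis makes it positive, as the Riesz
construction demands. -/
theorem Admissible.exists_representsLip (hA : Admissible s Ω)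
    (hg : IsKernel g gLow gUp γLow γUp) (u : HS s Ω)
    (hpos : ∀ v : HS s Ω, (∀ᵐ x, 0 ≤ v.val x) → 0 ≤ opL s g u.val v.val) :
    ∃ μ, RepresentsLip s g Ω u.val μ := by
  have hex : ∀ φ, LipC Ω φ → ∃ w : HS s Ω, w.val =ᵐ[volume] φ := fun φ hφ =>
    hφ.exists_HS hA.dim_pos hA.pos hA.lt_one hA.isOpen
  obtain ⟨μ, hμ, h⟩ := exists_measure_of_nonneg hA.isOpen (fun φ => opL s g u.val φ)
    (fun φ θ hφ hθ => by
      obtain ⟨v, hv⟩ := hex φ hφ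
      obtain ⟨w, hw⟩ := hex θ hθ
      beta_reduce
      rw [← opL_congr_right _ hv, ← opL_congr_right _ hw, ← hg.opL_add]
      refine opL_congr_right _ ?_
      filter_upwards [HS.val_add v w, hv, hw] with x h1 h2 h3
      rw [h1, h2, h3])
    (fun φ c hφ => by
      obtain ⟨v, hv⟩ := hex φ hφ
      beta_reduce
      rw [← opL_congr_right _ hv, ← hg.opL_smul]
      refine opL_congr_right _ ?_
      filter_upwards [HS.val_smul c v, hv] with x h1 h2
      rw [h1, h2])
    (fun φ hφ h0 => by
      obtain ⟨v, hv⟩ := hex φ hφ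
      beta_reduce
      rw [← opL_congr_right _ hv]
      refine hpos v ?_
      filter_upwards [hv] with x hx
      rw [hx]; exact h0 x)
  exact ⟨μ, hμ, h⟩

/-- For a Lipschitz φ ≥ 1 on K, μ(K) ≤ ∫ φ⁺ dμ = ⟨𝓛u, φ⁺⟩ ≤ γ* ‖u‖ ‖φ‖. The bound is a closed
condition on the competitor, so it passes to limits. Every relation between μ and capacity below
rests on it. -/
theorem RepresentsLip.measure_le_of_mem_closure (hA : Admissible s Ω)
    (hg : IsKernel g gLow gUp γLow γUp) (hμ : RepresentsLip s g Ω u.val μ) {K : Set (E d)}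
    (hK : IsCompact K) {w : HS s Ω} (hw : w ∈ closure (capTest s Ω K)) :
    μ K ≤ ENNReal.ofReal (γUp * ‖u.grad‖ * ‖w.grad‖) := by
  have hcl : IsClosed {w : HS s Ω | μ K ≤ ENNReal.ofReal (γUp * ‖u.grad‖ * ‖w.grad‖)} :=
    isClosed_le continuous_const (ENNReal.continuous_ofReal.comp
      (continuous_const.mul HS.grad.continuous.norm))
  refine closure_minimal ?_ hcl hw
  rintro w ⟨φ, hφ, hφ1, hφw⟩
  obtain ⟨v, hv⟩ := hφ.pos.exists_HS hA.dim_pos hA.pos hA.lt_one hA.isOpen (s := s)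
  refine (hμ.radon.measure_le_integral hφ.pos (fun x => le_max_right _ _) hK
    fun x hx => (hφ1 x hx).trans (le_max_left _ _)).trans (ENNReal.ofReal_le_ofReal ?_)
  rw [hμ.integral_eq _ hφ.pos, ← opL_congr_right _ hv]
  refine ((le_abs_self _).trans (hg.abs_opL_le u v)).trans ?_
  refine mul_le_mul_of_nonneg_left (HS.norm_grad_le_of_ae hφw hv fun x y =>
    abs_max_sub_max_le_abs _ _ _) (mul_nonneg hg.γUp_pos.le (norm_nonneg _))

theorem RepresentsLip.measure_compact_le (hA : Admissible s Ω)
    (hg : IsKernel g gLow gUp γLow γUp) (hμ : RepresentsLip s g Ω u.val μ) {K : Set (E d)}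
    (hK : IsCompact K) {r : ℝ} (hr : 0 ≤ r)
    (h : ⨅ v ∈ capSet s Ω K, gagliardoSq s v < ENNReal.ofReal (r ^ 2)) :
    μ K ≤ ENNReal.ofReal (γUp * ‖u.grad‖ * r) := by
  obtain ⟨v, hv⟩ := iInf_lt_iff.1 h
  obtain ⟨hv, hlt⟩ := iInf_lt_iff.1 hv
  obtain ⟨w, rfl, hw⟩ := hA.exists_of_mem_capSet hv
  rw [HS.gagliardoSq_val] at hlt
  refine (hμ.measure_le_of_mem_closure hA hg hK hw).trans (ENNReal.ofReal_le_ofReal ?_)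
  exact mul_le_mul_of_nonneg_left (abs_le_of_sq_le_sq' (ENNReal.lt_ofReal_iff_toReal_lt
    ENNReal.ofReal_ne_top |>.1 hlt |>.le |> fun h => by
      rwa [ENNReal.toReal_ofReal (sq_nonneg _)] at h) hr).2
    (mul_nonneg hg.γUp_pos.le (norm_nonneg _))

theorem RepresentsLip.measure_le_of_ocap_lt (hA : Admissible s Ω)
    (hg : IsKernel g gLow gUp γLow γUp) (hμ : RepresentsLip s g Ω u.val μ) {F : Set (E d)}
    {r : ℝ} (hr : 0 ≤ r) (h : ocap s Ω F < ENNReal.ofReal (r ^ 2)) :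
    μ F ≤ ENNReal.ofReal (γUp * ‖u.grad‖ * r) := by
  obtain ⟨v, U, hU, hFU, hv, hlt⟩ := exists_of_ocap_lt h
  calc μ F ≤ μ (U ∩ Ω ∪ Ωᶜ) := measure_mono fun x hx => by
        by_cases h : x ∈ Ω
        · exact Or.inl ⟨hFU hx, h⟩
        · exact Or.inr h
    _ ≤ μ (U ∩ Ω) + μ Ωᶜ := measure_union_le _ _
    _ = μ (U ∩ Ω) := by rw [hμ.radon.compl_null, add_zero]
    _ ≤ _ := measure_open_le (hU.inter hA.isOpen) fun K hKU hK =>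
      hμ.measure_compact_le hA hg hK hr
        ((hA.iInf_capSet_le_ocap hK (hKU.trans inter_subset_right)).trans_lt
          ((ocap_le hU (hKU.trans inter_subset_left) hv).trans_lt hlt))

theorem eq_zero_of_forall_le_ofReal {a : ℝ≥0∞} {c : ℝ}
    (h : ∀ r : ℝ, 0 < r → a ≤ ENNReal.ofReal (c * r)) : a = 0 := by
  have h1 : Tendsto (fun r : ℝ => ENNReal.ofReal (c * r)) (𝓝[>] 0) (𝓝 0) := by
    have : Tendsto (fun r : ℝ => ENNReal.ofReal (c * r)) (𝓝 0) (𝓝 (ENNReal.ofReal (c * 0))) :=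
      (ENNReal.continuous_ofReal.comp (continuous_const.mul continuous_id)).tendsto 0
    rw [mul_zero, ENNReal.ofReal_zero] at this
    exact this.mono_left nhdsWithin_le_nhds
  exact le_antisymm (ge_of_tendsto h1 (by
    filter_upwards [self_mem_nhdsWithin] with r hr
    exact h r hr)) zero_le

theorem RepresentsLip.measure_null (hA : Admissible s Ω)
    (hg : IsKernel g gLow gUp γLow γUp) (hμ : RepresentsLip s g Ω u.val μ) {F : Set (E d)}
    (h : ocap s Ω F = 0) : μ F = 0 :=
  eq_zero_of_forall_le_ofReal fun r hr => hμ.measure_le_of_ocap_lt hA hg hr.le (by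
    rw [h]; exact ENNReal.ofReal_pos.2 (by positivity))

theorem RepresentsLip.ae_of_ocap (hA : Admissible s Ω)
    (hg : IsKernel g gLow gUp γLow γUp) (hμ : RepresentsLip s g Ω u.val μ) {P : E d → Prop}
    (h : ocap s Ω {x | x ∈ Ω ∧ ¬ P x} = 0) : ∀ᵐ x ∂μ, P x := by
  have h1 : ∀ᵐ x ∂μ, x ∈ Ω := hμ.radon.compl_null
  have h2 : ∀ᵐ x ∂μ, ¬ (x ∈ Ω ∧ ¬ P x) := by
    rw [ae_iff]; simpa using hμ.measure_null hA hg h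
  filter_upwards [h1, h2] with x k1 k2
  by_contra h
  exact k2 ⟨k1, h⟩

/-- The function |φ - θ| is itself an admissible Lipschitz test function, with energy no larger than
that of φ - θ. So passing from the energy space to L¹(μ) is Lipschitz on such functions. -/
theorem RepresentsLip.lintegral_abs_sub_le (hA : Admissible s Ω)
    (hg : IsKernel g gLow gUp γLow γUp) (hμ : RepresentsLip s g Ω u.val μ) {φ θ : E d → ℝ}
    {v w : HS s Ω} (hφ : LipC Ω φ) (hθ : LipC Ω θ) (hv : v.val =ᵐ[volume] φ)
    (hw : w.val =ᵐ[volume] θ) :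
    ∫⁻ x, ‖φ x - θ x‖ₑ ∂μ ≤ ENNReal.ofReal (γUp * ‖u.grad‖ * ‖v - w‖) := by
  have hl := (hφ.sub hθ).abs
  obtain ⟨z, hz⟩ := hl.exists_HS hA.dim_pos hA.pos hA.lt_one hA.isOpen (s := s)
  have e : ∫⁻ x, ‖φ x - θ x‖ₑ ∂μ = ENNReal.ofReal (∫ x, |φ x - θ x| ∂μ) := by
    rw [ofReal_integral_eq_lintegral_ofReal (hl.integrable hμ.radon)
      (Eventually.of_forall fun x => abs_nonneg _)]
    exact lintegral_congr fun x => (Real.enorm_eq_ofReal_abs _)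
  rw [e, hμ.integral_eq _ hl, ← opL_congr_right _ hz]
  refine ENNReal.ofReal_le_ofReal (((le_abs_self _).trans (hg.abs_opL_le u z)).trans ?_)
  refine mul_le_mul_of_nonneg_left ?_ (mul_nonneg hg.γUp_pos.le (norm_nonneg _))
  have hvw : (v - w).val =ᵐ[volume] fun x => φ x - θ x := by
    filter_upwards [HS.val_sub v w, hv, hw] with x h1 h2 h3
    rw [h1, h2, h3]
  exact (HS.norm_grad_le_of_ae hvw hz fun x y => abs_abs_sub_abs_le _ _).trans
    (v - w).norm_grad_le

/-- Integration against `μ` extends from Lipschitz functions to quasi-continuous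
representatives. -/
theorem RepresentsLip.formula (hA : Admissible s Ω)
    (hg : IsKernel g gLow gUp γLow γUp) (hμ : RepresentsLip s g Ω u.val μ) {v : HS s Ω}
    {f : E d → ℝ} (hf : IsQCRep s Ω v.val f) :
    Integrable f μ ∧ opL s g u.val v.val = ∫ x, f x ∂μ := by
  obtain ⟨k, φ, w, hk, hφ, hw, hwv, hlim⟩ := hA.exists_rep v
  have hfk : f =ᵐ[μ] k := hμ.ae_of_ocap hA hg (hA.rep_unique hf hk)
  have hlim' : ∀ᵐ x ∂μ, Tendsto (fun n => φ n x) atTop (𝓝 (k x)) := hμ.ae_of_ocap hA hg hlim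
  have hint : ∀ n, Integrable (φ n) μ := fun n => (hφ n).integrable hμ.radon
  have hm : AEStronglyMeasurable k μ :=
    aestronglyMeasurable_of_tendsto_ae atTop (fun n => (hint n).aestronglyMeasurable) hlim'
  -- Fatou's lemma in the second index. Pointwise convergence holds μ-a.e. because it fails only on
  -- a set of capacity zero, which μ ignores.
  have hbd : ∀ n, ∫⁻ x, ‖φ n x - k x‖ₑ ∂μ ≤ ENNReal.ofReal (γUp * ‖u.grad‖ * ‖w n - v‖) := by
    intro n
    have h1 : Tendsto (fun m => ENNReal.ofReal (γUp * ‖u.grad‖ * ‖w n - w m‖)) atTop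
        (𝓝 (ENNReal.ofReal (γUp * ‖u.grad‖ * ‖w n - v‖))) :=
      ENNReal.tendsto_ofReal ((hwv.const_sub (w n)).norm.const_mul _)
    calc ∫⁻ x, ‖φ n x - k x‖ₑ ∂μ ≤ ∫⁻ x, liminf (fun m => ‖φ n x - φ m x‖ₑ) atTop ∂μ := by
          refine lintegral_mono_ae ?_
          filter_upwards [hlim'] with x hx
          exact ((hx.const_sub (φ n x)).enorm).liminf_eq.ge
      _ ≤ liminf (fun m => ∫⁻ x, ‖φ n x - φ m x‖ₑ ∂μ) atTop :=
          lintegral_liminf_le fun m => ((hφ n).measurable.sub (hφ m).measurable).enorm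
      _ ≤ liminf (fun m => ENNReal.ofReal (γUp * ‖u.grad‖ * ‖w n - w m‖)) atTop :=
          liminf_le_liminf (Eventually.of_forall fun m =>
            hμ.lintegral_abs_sub_le hA hg (hφ n) (hφ m) (hw n) (hw m))
      _ = _ := h1.liminf_eq
  have hki : Integrable k μ := by
    have h1 : Integrable (fun x => φ 0 x - k x) μ :=
      ⟨(hint 0).aestronglyMeasurable.sub hm, (hbd 0).trans_lt ENNReal.ofReal_lt_top⟩
    refine ((hint 0).sub h1).congr (Eventually.of_forall fun x => ?_)
    simp
  refine ⟨hki.congr hfk.symm, ?_⟩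
  rw [integral_congr_ae hfk]
  have h1 : Tendsto (fun n => ∫ x, φ n x ∂μ) atTop (𝓝 (∫ x, k x ∂μ)) := by
    refine tendsto_integral_of_L1 k hki.aestronglyMeasurable (Eventually.of_forall hint) ?_
    refine tendsto_of_tendsto_of_tendsto_of_le_of_le tendsto_const_nhds ?_ (fun n => zero_le) hbd
    have := ENNReal.tendsto_ofReal (((hwv.sub_const v).norm).const_mul (γUp * ‖u.grad‖))
    simpa using this
  have h2 : Tendsto (fun n => ∫ x, φ n x ∂μ) atTop (𝓝 (opL s g u.val v.val)) := by
    have e : ∀ n, ∫ x, φ n x ∂μ = inner ℝ (hg.op u) (w n) := fun n => by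
      rw [hμ.integral_eq _ (hφ n), hg.inner_op, opL_congr_right _ (hw n)]
    simp_rw [e]
    rw [← hg.inner_op]
    exact tendsto_const_nhds.inner hwv
  exact tendsto_nhds_unique h2 h1

theorem RepresentsLip.represents (hA : Admissible s Ω)
    (hg : IsKernel g gLow gUp γLow γUp) (hμ : RepresentsLip s g Ω u.val μ) :
    Represents s g Ω u.val μ := by
  refine ⟨hμ.radon.compl_null, hμ.radon.finite_compact, fun v hv f hf => ?_⟩
  obtain ⟨v, rfl⟩ := HS.exists_val_eq hA.dim_pos hA.pos hA.lt_one hv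
  exact hμ.formula hA hg hf

/-- A continuous function is its own quasi-continuous representative. Hence any representing measure
is determined by Lipschitz test functions, and uniqueness follows. -/
theorem Admissible.representsLip (hA : Admissible s Ω) {u : L2 d}
    (hμ : Represents s g Ω u μ) : RepresentsLip s g Ω u μ := by
  refine ⟨⟨hμ.compl_null, hμ.finite_compact⟩, fun φ hφ => ?_⟩
  obtain ⟨w, hw⟩ := hφ.exists_HS hA.dim_pos hA.pos hA.lt_one hA.isOpen (s := s)
  rw [← (hμ.formula _ w.val_mem φ (hA.isQCRep_of_continuous hφ.continuous hw)).2,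
    opL_congr_right _ hw]

theorem Admissible.eq_of_represents (hA : Admissible s Ω) {u : L2 d} {ν : Measure (E d)}
    (hμ : RepresentsLip s g Ω u μ) (hν : Represents s g Ω u ν) : ν = μ := by
  have hν' := hA.representsLip hν
  exact hν'.radon.eq_of_integral_eq hA.isOpen hμ.radon fun φ hφ => by
    rw [hν'.integral_eq _ hφ, hμ.integral_eq _ hφ]

end Representation

/-! ### Bounds for the measure in terms of capacity -/

section Bounds

theorem RepresentsLip.measure_null_of_capS (hA : Admissible s Ω)
    (hg : IsKernel g gLow gUp γLow γUp) (hμ : RepresentsLip s g Ω u.val μ) {A : Set (E d)}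
    (hAm : MeasurableSet A) (h : capS s Ω A = 0) : μ A = 0 := by
  refine le_antisymm (hμ.radon.measure_le hA.isOpen hAm fun K hKA hK => ?_) zero_le
  refine le_of_eq (eq_zero_of_forall_le_ofReal fun r hr => hμ.measure_compact_le hA hg hK hr.le ?_)
  have h1 : ⨅ v ∈ capSet s Ω K, gagliardoSq s v ≤ capS s Ω A :=
    le_iSup₂_of_le K hK (le_iSup_of_le hKA le_rfl)
  exact h1.trans_lt (h.trans_lt (ENNReal.ofReal_pos.2 (by positivity)))

theorem Admissible.exists_isCapPotential (hA : Admissible s Ω)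
    (hg : IsKernel g gLow gUp γLow γUp) {K : Set (E d)} (hK : IsCompact K) (hKΩ : K ⊆ Ω) :
    ∃ w : HS s Ω, w ∈ closure (capTest s Ω K) ∧ IsCapPotential s g Ω K w.val := by
  obtain ⟨θ, hθ, -, -, h1⟩ := exists_lipC_one hA.isOpen hK hKΩ
  obtain ⟨z, hz⟩ := hθ.exists_HS hA.dim_pos hA.pos hA.lt_one hA.isOpen (s := s)
  obtain ⟨w, hw, h⟩ := hA.exists_solution hg
    (C := closure (capTest s Ω K)) ⟨z, subset_closure ⟨θ, hθ, fun x hx => (h1 x hx).ge, hz⟩⟩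
    isClosed_closure (convex_capTest K).closure
  refine ⟨w, hw, (hA.mem_capSet_iff K w).2 hw, fun v hv => ?_⟩
  obtain ⟨v, rfl, hv'⟩ := hA.exists_of_mem_capSet hv
  rw [← map_sub]
  exact h v hv'

/-- For compact K take the capacitary potential w as competitor and use γ_* ‖w‖² ≤ ⟨𝓛w, w⟩. The
factor γ*‖u‖ contributes γ*²/γ_*, and ‖w‖ contributes γ_*^(-1/2). Borel sets follow by inner
regularity. -/
theorem RepresentsLip.measure_le_capG (hA : Admissible s Ω)
    (hg : IsKernel g gLow gUp γLow γUp) (hμ : RepresentsLip s g Ω u.val μ) {N : ℝ}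
    (hN : ‖u.grad‖ ≤ γUp / γLow * N) {A : Set (E d)}
    (hAm : MeasurableSet A) (hAΩ : A ⊆ Ω) :
    μ A ≤ ENNReal.ofReal (γUp ^ 2 / γLow ^ (3 / 2 : ℝ) * N) * capG s g Ω A ^ (1 / 2 : ℝ) := by
  refine hμ.radon.measure_le hA.isOpen hAm fun K hKA hK => ?_
  obtain ⟨w, hw, hpot⟩ := hA.exists_isCapPotential hg hK (hKA.trans hAΩ)
  have h1 : ENNReal.ofReal (opL s g w.val w.val) ≤ capG s g Ω A :=
    le_iSup₂_of_le K hK (le_iSup₂_of_le hKA w.val (le_iSup_of_le hpot le_rfl))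
  have h0 := hg.γLow_pos
  have h2 := hg.le_opL_self w
  set t := opL s g w.val w.val
  have ht : 0 ≤ t := le_trans (by positivity) h2
  have hN0 : 0 ≤ N := by
    have := (norm_nonneg _).trans hN
    exact nonneg_of_mul_nonneg_right this (div_pos hg.γUp_pos h0)
  have hsq : √γLow * √γLow = γLow := Real.mul_self_sqrt h0.le
  have hs0 : 0 < √γLow := Real.sqrt_pos.2 h0
  have h3 : ‖w.grad‖ ≤ √t / √γLow := by
    rw [← Real.sqrt_div ht]
    refine Real.le_sqrt_of_sq_le ?_
    rw [le_div_iff₀ h0]; linarith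
  have h4 : γLow ^ (3 / 2 : ℝ) = γLow * √γLow := by
    rw [Real.sqrt_eq_rpow, ← Real.rpow_one_add' h0.le (by norm_num)]
    norm_num
  calc μ K ≤ ENNReal.ofReal (γUp * ‖u.grad‖ * ‖w.grad‖) :=
        hμ.measure_le_of_mem_closure hA hg hK hw
    _ ≤ ENNReal.ofReal (γUp ^ 2 / γLow ^ (3 / 2 : ℝ) * N * √t) := by
        refine ENNReal.ofReal_le_ofReal ?_
        calc γUp * ‖u.grad‖ * ‖w.grad‖ ≤ γUp * (γUp / γLow * N) * (√t / √γLow) := by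
              have := hg.γUp_pos
              gcongr
          _ = _ := by rw [h4]; field_simp
    _ = ENNReal.ofReal (γUp ^ 2 / γLow ^ (3 / 2 : ℝ) * N) *
        ENNReal.ofReal t ^ (1 / 2 : ℝ) := by
        rw [ENNReal.ofReal_mul (by positivity), ENNReal.ofReal_rpow_of_nonneg ht (by norm_num),
          ← Real.sqrt_eq_rpow]
    _ ≤ _ := by gcongr

theorem RepresentsLip.measure_null_of_cap (hA : Admissible s Ω)
    (hg : IsKernel g gLow gUp γLow γUp) (hμ : RepresentsLip s g Ω u.val μ) {A : Set (E d)}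
    (hAm : MeasurableSet A) (hAΩ : A ⊆ Ω) (h : capS s Ω A = 0 ∨ capG s g Ω A = 0) : μ A = 0 := by
  rcases h with h | h
  · exact hμ.measure_null_of_capS hA hg hAm h
  · have hγ : 0 < γUp / γLow := div_pos hg.γUp_pos hg.γLow_pos
    refine le_antisymm ((hμ.measure_le_capG hA hg
      -- With this N the norm hypothesis is an equality; only finiteness of the prefactor matters
      -- here.
      (N := ‖u.grad‖ / (γUp / γLow)) (mul_div_cancel₀ _ hγ.ne').ge hAm hAΩ).trans_eq ?_) zero_le
    rw [h, ENNReal.zero_rpow_of_pos (by norm_num), mul_zero]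

end Bounds

end

section

variable {d : ℕ} {s : ℝ} {Ω : Set (E d)} {g : E d → E d → ℝ → ℝ} {gLow gUp γLow γUp : ℝ}
  {μ : Measure (E d)} {u : HS s Ω} {ψ f : E d → ℝ}

/-! ### Concentration on the coincidence set -/

section Concentration

/-- Near-contact estimate: the part of `Ω` where `u` exceeds the obstacle by more than `δ` is
covered by an open set of small measure. -/
theorem RepresentsLip.measure_gap_le (hA : Admissible s Ω)
    (hg : IsKernel g gLow gUp γLow γUp) (hμ : RepresentsLip s g Ω u.val μ)
    (hψ : QuasiCont s Ω ψ) (hu : IsObstacleSol s g Ω ψ u.val) (hf : IsQCRep s Ω u.val f)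
    {δ : ℝ} (hδ : 0 < δ) {r : ℝ} (hr : 0 < r) :
    μ {x | x ∈ Ω ∧ ψ x + δ < f x} ≤ ENNReal.ofReal (γUp * ‖u.grad‖ * (2 * r)) := by
  have hψδ : QuasiCont s Ω fun x => ψ x + δ :=
    hA.quasiCont_comp₂ hψ hψ (F := fun p => p.1 + δ) (by fun_prop)
  obtain ⟨G, O, hG, hGΩ, hGr, hO, hOΩ, hGO, -, -⟩ :=
    hA.exists_open_lt hf.1 hψδ (ε := ENNReal.ofReal (r ^ 2)) (by positivity)
  obtain ⟨v, U, hU, hGU, hv, hvr⟩ := exists_of_ocap_lt hGr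
  obtain ⟨e, -, -, he, -⟩ := hA.exists_rep v
  have hsub : {x | x ∈ Ω ∧ ψ x + δ < f x} ⊆ O ∪ G := by
    rintro x ⟨hx, hlt⟩
    by_cases hxG : x ∈ G
    · exact Or.inr hxG
    · exact Or.inl ((hGO x hx hxG).2 hlt)
  refine (measure_mono hsub).trans (measure_open_le (hO.union hG) fun K hKV hK => ?_)
  -- The set where u exceeds ψ + δ is open only up to the small set G, so a cut-off θ may reach into
  -- G, where u cannot be lowered. Subtracting e⁺, with e ≥ 1 q.e. on G, removes that part: the
  -- perturbation is δ(θ - e⁺)⁺.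
  obtain ⟨θ, hθ, h0, h1, hθK⟩ := exists_lipC_one (hO.union hG) hK hKV
  have hθΩ : LipC Ω θ := ⟨hθ.lip, hθ.compact, hθ.subset.trans (union_subset hOΩ hGΩ)⟩
  obtain ⟨t, ht⟩ := hθΩ.exists_HS hA.dim_pos hA.pos hA.lt_one hA.isOpen (s := s)
  have htr := hA.isQCRep_of_continuous hθΩ.continuous ht
  obtain ⟨p, hp, -⟩ := v.exists_pos hA.dim_pos hA.pos hA.lt_one hA.isOpen
  obtain ⟨q, hq, -⟩ := (t - p).exists_pos hA.dim_pos hA.pos hA.lt_one hA.isOpen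
  have hw : (δ • q).val =ᵐ[volume] fun x => δ * max (t.val x - max (v.val x) 0) 0 := by
    filter_upwards [HS.val_smul δ q, hq, HS.val_sub t p, hp] with x k1 k2 k3 k4
    rw [k1, k2, k3, k4]
  have hwr : IsQCRep s Ω (δ • q).val fun x => δ * max (θ x - max (e x) 0) 0 :=
    hA.isQCRep_comp₂ htr he (F := fun p => δ * max (p.1 - max p.2 0) 0) (by fun_prop) hw
  have heG : ocap s Ω {x | x ∈ U ∩ Ω ∧ e x < 1} = 0 :=
    hA.ocap_lt_eq_zero_of_ae (hA.quasiCont_of_continuous continuous_const) he.1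
      (hU.inter hA.isOpen) inter_subset_right (by
        filter_upwards [hv, (hA.isQCRep_iff.1 he).2] with x k1 k2 hx
        rw [k2 hx.2]; exact k1 hx.1)
  obtain ⟨hu1, hu2⟩ := (hA.isObstacleSol_iff u).1 hu
  -- Up to capacity zero, the perturbation vanishes on G, is at most δ on O \ G, where the gap
  -- exceeds δ, and vanishes elsewhere since θ does.
  have hmem : (u - δ • q).val ∈ obstacleSet s Ω ψ := by
    refine (hA.mem_obstacleSet_iff hψ _ (hA.isQCRep_sub hf hwr)).2 (ocap_null_mono ?_
      (hA.ocap_null_union heG ((hA.mem_obstacleSet_iff hψ u hf).1 hu1)))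
    rintro x ⟨hx, hlt⟩
    by_cases hfx : f x < ψ x
    · exact Or.inr ⟨hx, hfx⟩
    by_cases hxG : x ∈ G
    · refine Or.inl ⟨⟨hGU hxG, hx⟩, ?_⟩
      by_contra! hex
      have : max (θ x - max (e x) 0) 0 = 0 :=
        max_eq_right (by linarith [h1 x, le_max_left (e x) 0])
      rw [this] at hlt
      linarith
    · exfalso
      have hb : max (θ x - max (e x) 0) 0 ≤ θ x :=
        max_le (by linarith [le_max_right (e x) 0]) (h0 x)
      by_cases hxO : x ∈ O
      · have := (hGO x hx hxG).1 hxO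
        nlinarith [h1 x]
      · have : θ x = 0 := hθ.eq_zero (by rintro (h | h) <;> contradiction)
        nlinarith
  have hle := hu2 _ hmem
  have e1 : u - δ • q - u = (-1 : ℝ) • (δ • q) := by rw [neg_one_smul]; abel
  rw [e1, hg.opL_smul] at hle
  obtain ⟨hi, hform⟩ := hμ.formula hA hg hwr
  have hz : ∫ x, δ * max (θ x - max (e x) 0) 0 ∂μ = 0 :=
    le_antisymm (by linarith) (integral_nonneg fun x =>
      mul_nonneg hδ.le (le_max_right _ _))
  rw [integral_eq_zero_iff_of_nonneg (fun x => mul_nonneg hδ.le (le_max_right _ _)) hi] at hz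
  have hΩ : ∀ᵐ x ∂μ, x ∈ Ω := hμ.radon.compl_null
  have hsub2 : ∀ᵐ x ∂μ, x ∈ K → x ∈ {x | x ∈ Ω ∧ 1 ≤ |e x|} := by
    filter_upwards [hz, hΩ] with x k1 k2 hxK
    refine ⟨k2, ?_⟩
    have k3 : δ * max (θ x - max (e x) 0) 0 = 0 := k1
    rw [hθK x hxK] at k3
    have k4 : max (1 - max (e x) 0) 0 = 0 := (mul_eq_zero.1 k3).resolve_left hδ.ne'
    have k5 := le_max_left (1 - max (e x) 0) 0
    rw [k4] at k5
    exact le_trans (by linarith) (max_le (le_abs_self _) (abs_nonneg _))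
  -- The perturbation has zero integral, so e ≥ 1 holds μ-a.e. on K. The set where |e| ≥ 1 has
  -- capacity at most 2‖v‖² < (2r)², which explains the 2r in the bound.
  refine (measure_mono_ae hsub2).trans (hμ.measure_le_of_ocap_lt hA hg (by positivity)
    ((hA.ocap_abs_ge_le he one_pos).trans_lt ?_))
  have hvr' := (ENNReal.ofReal_lt_ofReal_iff (by positivity)).1 hvr
  refine (ENNReal.ofReal_lt_ofReal_iff (by positivity)).2 ?_
  rw [one_pow, div_one]
  nlinarith [sq_nonneg ‖v‖]

/-- Letting r → 0 in the gap estimate makes every gap 1/(n+1) μ-null. Since u ≥ 0 also holds q.e.,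
hence μ-a.e., equality with ψ forces ψ = ψ⁺ there. -/
theorem RepresentsLip.ae_eq_obstacle (hA : Admissible s Ω)
    (hg : IsKernel g gLow gUp γLow γUp) (hμ : RepresentsLip s g Ω u.val μ)
    (hψ : QuasiCont s Ω ψ) (hu : IsObstacleSol s g Ω ψ u.val) (hf : IsQCRep s Ω u.val f) :
    ∀ᵐ x ∂μ, f x = ψ x ∧ f x = max (ψ x) 0 := by
  have hΩ : ∀ᵐ x ∂μ, x ∈ Ω := hμ.radon.compl_null
  have h1 : ∀ᵐ x ∂μ, ∀ n : ℕ, ¬ (x ∈ Ω ∧ ψ x + 1 / ((n : ℝ) + 1) < f x) := by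
    rw [ae_all_iff]
    intro n
    rw [ae_iff]
    simp only [not_not]
    refine eq_zero_of_forall_le_ofReal (c := γUp * ‖u.grad‖ * 2) fun r hr => ?_
    rw [mul_assoc]
    exact hμ.measure_gap_le hA hg hψ hu hf Nat.one_div_pos_of_nat hr
  have h2 : ∀ᵐ x ∂μ, ψ x ≤ f x := hμ.ae_of_ocap hA hg (by
    simp only [not_le]
    exact (hA.mem_obstacleSet_iff hψ u hf).1 hu.1)
  have h3 : ∀ᵐ x ∂μ, 0 ≤ f x := hμ.ae_of_ocap hA hg (by
    simp only [not_le]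
    exact hA.ocap_lt_eq_zero_of_ae (hA.quasiCont_of_continuous continuous_const) hf.1 hA.isOpen
      subset_rfl (by
        filter_upwards [hA.sol_nonneg hg hψ hu, (hA.isQCRep_iff.1 hf).2] with x k1 k2 hx
        rw [k2 hx]; exact k1))
  filter_upwards [hΩ, h1, h2, h3] with x k0 k1 k2 k3
  have e : f x = ψ x := by
    refine le_antisymm ?_ k2
    by_contra! h
    obtain ⟨n, hn⟩ := exists_nat_one_div_lt (sub_pos.2 h)
    exact k1 n ⟨k0, by linarith⟩
  exact ⟨e, by rw [max_eq_left (e ▸ k3), e]⟩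

end Concentration

end

section

variable {d : ℕ} {s : ℝ} {Ω : Set (E d)} {g : E d → E d → ℝ → ℝ} {gLow gUp γLow γUp : ℝ}
  {u : HS s Ω} {ψ f φ : E d → ℝ}

/-! ### Strong minimum principle -/

section Positivity

theorem tendsto_L2_of_dominated {f : ℕ → L2 d} {g : L2 d} {b : E d → ℝ}
    (hb : Integrable fun x => b x ^ 2) (h : ∀ n, ∀ᵐ x, |f n x - g x| ≤ b x)
    (hlim : ∀ᵐ x, Tendsto (fun n => f n x) atTop (𝓝 (g x))) : Tendsto f atTop (𝓝 g) := by
  have e : ∀ n, ‖f n - g‖ ^ 2 = ∫ x, (f n x - g x) ^ 2 := by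
    intro n
    rw [← real_inner_self_eq_norm_sq, L2.inner_def]
    refine integral_congr_ae ?_
    filter_upwards [Lp.coeFn_sub (f n) g] with x hx
    rw [hx, Pi.sub_apply, pow_two]
    rfl
  have h1 : Tendsto (fun n => ∫ x, (f n x - g x) ^ 2) atTop (𝓝 (∫ _ : E d, (0 : ℝ))) := by
    refine tendsto_integral_of_dominated_convergence (fun x => b x ^ 2)
      (fun n => (((Lp.aestronglyMeasurable (f n)).sub (Lp.aestronglyMeasurable g)).pow 2)) hb
      (fun n => ?_) ?_
    · filter_upwards [h n] with x hx
      rw [Real.norm_eq_abs, abs_pow]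
      gcongr
    · filter_upwards [hlim] with x hx
      have := (hx.sub_const (g x)).pow 2
      rwa [sub_self, zero_pow two_ne_zero] at this
  rw [integral_zero] at h1
  simp_rw [← e] at h1
  rw [tendsto_iff_norm_sub_tendsto_zero]
  have h2 := (Real.continuous_sqrt.tendsto 0).comp h1
  rw [Real.sqrt_zero] at h2
  refine h2.congr fun n => ?_
  exact Real.sqrt_sq (norm_nonneg _)

/-- Pointwise Caccioppoli inequality for the truncations `(1 - a)⁺`. -/
theorem truncation_mul_le (t t' : ℝ) {a a' : ℝ} (ha : 0 ≤ a) (ha' : 0 ≤ a') :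
    (a - a') * (t * (t * max (1 - a) 0) - t' * (t' * max (1 - a') 0)) ≤
      (t - t') ^ 2 - (t * max (1 - a) 0 - t' * max (1 - a') 0) ^ 2 := by
  rcases le_total 1 a with h | h <;> rcases le_total 1 a' with h' | h'
  · rw [max_eq_right (by linarith), max_eq_right (by linarith)]
    nlinarith [sq_nonneg (t - t')]
  · rw [max_eq_right (by linarith : 1 - a ≤ 0), max_eq_left (by linarith : 0 ≤ 1 - a')]
    have h1 : 0 ≤ t' ^ 2 * (1 - a') * (a - 1) := by
      have := sub_nonneg.2 h; have := sub_nonneg.2 h'; positivity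
    nlinarith [sq_nonneg (t - t')]
  · rw [max_eq_left (by linarith : 0 ≤ 1 - a), max_eq_right (by linarith : 1 - a' ≤ 0)]
    have h1 : 0 ≤ t ^ 2 * (1 - a) * (a' - 1) := by
      have := sub_nonneg.2 h; have := sub_nonneg.2 h'; positivity
    nlinarith [sq_nonneg (t - t')]
  · rw [max_eq_left (by linarith : 0 ≤ 1 - a), max_eq_left (by linarith : 0 ≤ 1 - a')]
    have h1 : (1 - a) * (1 - a') ≤ 1 := by nlinarith
    have h2 := mul_le_mul_of_nonneg_right h1 (sq_nonneg (t - t'))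
    nlinarith

set_option maxHeartbeats 400000 in
-- Test the supersolution with φ²(1 - cu)⁺. The pointwise inequality, multiplied by the frozen
-- weight, bounds the energy of φ(1 - cu)⁺ by that of φ, uniformly in c.
theorem Admissible.exists_truncation (hA : Admissible s Ω) (hg : IsKernel g gLow gUp γLow γUp)
    (hpos : ∀ v : HS s Ω, (∀ᵐ x, 0 ≤ v.val x) → 0 ≤ opL s g u.val v.val)
    (hu0 : ∀ᵐ x, 0 ≤ u.val x) (hφ : LipC Ω φ) (hφ0 : ∀ x, 0 ≤ φ x) {t : HS s Ω}
    (ht : t.val =ᵐ[volume] φ) {c : ℝ} (hc : 0 < c) :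
    ∃ p : HS s Ω, (p.val =ᵐ[volume] fun x => φ x * max (1 - c * u.val x) 0) ∧
      γLow * ‖p.grad‖ ^ 2 ≤ γUp * ‖t.grad‖ ^ 2 := by
  obtain ⟨m, hm⟩ := HS.exists_mul hA.dim_pos hA.pos hA.lt_one hA.isOpen hφ u
  obtain ⟨p, hp, -⟩ := (t - c • m).exists_pos hA.dim_pos hA.pos hA.lt_one hA.isOpen
  have hp' : p.val =ᵐ[volume] fun x => φ x * max (1 - c * u.val x) 0 := by
    filter_upwards [hp, HS.val_sub t (c • m), HS.val_smul c m, hm, ht] with x h1 h2 h3 h4 h5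
    rw [h1, h2, h3, h4, h5, mul_max_of_nonneg _ _ (hφ0 x), mul_zero]
    ring_nf
  obtain ⟨q, hq⟩ := HS.exists_mul hA.dim_pos hA.pos hA.lt_one hA.isOpen hφ p
  refine ⟨p, hp', ?_⟩
  -- A version of u that is nonnegative at every point, as the pointwise inequality requires.
  set U : E d → ℝ := fun x => max (u.val x) 0
  have hU : u.val =ᵐ[volume] U := by
    filter_upwards [hu0] with x hx
    exact (max_eq_left hx).symm
  have hpU : p.val =ᵐ[volume] fun x => φ x * max (1 - c * U x) 0 := by
    filter_upwards [hp', hU] with x h1 h2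
    rw [h1, h2]
  have hqU : q.val =ᵐ[volume] fun x => φ x * (φ x * max (1 - c * U x) 0) := by
    filter_upwards [hq, hpU] with x h1 h2
    rw [h1, h2]
  have h0 := hpos q (by
    filter_upwards [hqU] with x hx
    rw [hx]
    exact mul_nonneg (hφ0 x) (mul_nonneg (hφ0 x) (le_max_right _ _)))
  have h1 : c * opL s g u.val q.val ≤ γUp * ‖t.grad‖ ^ 2 - γLow * ‖p.grad‖ ^ 2 := by
    rw [opL_eq_integral (γLow := γLow), HS.norm_grad_sq, HS.norm_grad_sq, ← integral_const_mul,
      ← integral_const_mul, ← integral_const_mul,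
      ← integral_sub (t.integrable_dq_sq.const_mul _) (p.integrable_dq_sq.const_mul _)]
    refine integral_mono_ae ((hg.integrable_opL u q).const_mul _)
      ((t.integrable_dq_sq.const_mul _).sub (p.integrable_dq_sq.const_mul _)) ?_
    filter_upwards [hg.frozenWeight_bounds (s := s), dq_congr s hU, dq_congr s hpU,
      dq_congr s hqU, dq_congr s ht] with z k1 k2 k3 k4 k5
    obtain ⟨k1, k1'⟩ := k1 u.val
    rw [k2, k3, k4, k5]
    unfold dq
    set W := radialWeight d s ‖z.1 - z.2‖
    set k := frozenWeight s g γLow u.val z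
    have e1 := truncation_mul_le (φ z.1) (φ z.2) (mul_nonneg hc.le (le_max_right (u.val z.1) 0))
      (mul_nonneg hc.le (le_max_right (u.val z.2) 0))
    change (c * U z.1 - c * U z.2) * (φ z.1 * (φ z.1 * max (1 - c * U z.1) 0) -
      φ z.2 * (φ z.2 * max (1 - c * U z.2) 0)) ≤ (φ z.1 - φ z.2) ^ 2 -
      (φ z.1 * max (1 - c * U z.1) 0 - φ z.2 * max (1 - c * U z.2) 0) ^ 2 at e1
    set P := φ z.1 * max (1 - c * U z.1) 0 - φ z.2 * max (1 - c * U z.2) 0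
    set Q := φ z.1 * (φ z.1 * max (1 - c * U z.1) 0) - φ z.2 * (φ z.2 * max (1 - c * U z.2) 0)
    have hk : 0 ≤ k := hg.γLow_pos.le.trans k1
    have e2 : k * ((c * U z.1 - c * U z.2) * Q) ≤ γUp * (φ z.1 - φ z.2) ^ 2 - γLow * P ^ 2 := by
      have i1 := mul_le_mul_of_nonneg_left e1 hk
      have i2 := mul_le_mul_of_nonneg_right k1' (sq_nonneg (φ z.1 - φ z.2))
      have i3 := mul_le_mul_of_nonneg_right k1 (sq_nonneg P)
      linarith
    have e3 := mul_le_mul_of_nonneg_right e2 (sq_nonneg W)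
    calc c * (k * ((U z.1 - U z.2) * W) * (Q * W)) =
        k * ((c * U z.1 - c * U z.2) * Q) * W ^ 2 := by ring
      _ ≤ _ := e3
      _ = _ := by ring
  have := mul_nonneg hc.le h0
  linarith

theorem radialWeight_pos {r : ℝ} (hr : 0 < r) : 0 < radialWeight d s r := by
  unfold radialWeight
  have := Real.rpow_pos_of_pos hr s
  have := Real.sqrt_pos.2 (pow_pos hr d)
  positivity

set_option maxHeartbeats 400000 in
/-- If the cut-off of the zero set of a nonnegative supersolution belongs to the energy space,
then either the supersolution or the cut-off vanishes. -/
theorem IsKernel.zero_set_null (hg : IsKernel g gLow gUp γLow γUp)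
    (hpos : ∀ v : HS s Ω, (∀ᵐ x, 0 ≤ v.val x) → 0 ≤ opL s g u.val v.val)
    (hu0 : ∀ᵐ x, 0 ≤ u.val x) (hu : u ≠ 0) (hφ0 : ∀ x, 0 ≤ φ x) {z : HS s Ω}
    (hz : z.val =ᵐ[volume] fun x => if u.val x ≤ 0 then φ x else 0) : z = 0 := by
  set U : E d → ℝ := fun x => max (u.val x) 0
  have hU : u.val =ᵐ[volume] U := by
    filter_upwards [hu0] with x hx
    exact (max_eq_left hx).symm
  set Z : E d → ℝ := fun x => if U x ≤ 0 then φ x else 0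
  have hZ : z.val =ᵐ[volume] Z := by
    filter_upwards [hz, hU] with x h1 h2
    simp only [Z, h1, ← h2]
  have hU0 : ∀ x, 0 ≤ U x := fun x => le_max_right _ _
  have hZ0 : ∀ x, 0 ≤ Z x := fun x => by
    simp only [Z]; split_ifs
    exacts [hφ0 x, le_rfl]
  have h0 := hpos z (by
    filter_upwards [hZ] with x hx
    rw [hx]; exact hZ0 x)
  rw [opL_eq_integral (γLow := γLow)] at h0
  -- Z lives only where U vanishes, so the increments never have the same sign. The integrand is
  -- then nonpositive with nonnegative integral, hence zero a.e.
  have hmul : ∀ x y, (U x - U y) * (Z x - Z y) ≤ 0 := by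
    intro x y
    have hx := hU0 x
    have hy := hU0 y
    simp only [Z]
    split_ifs with h1 h2 h2
    · rw [le_antisymm h1 hx, le_antisymm h2 hy]; simp
    · have := hφ0 x; nlinarith
    · have := hφ0 y; nlinarith
    · simp
  have hle : ∀ᵐ p : E d × E d, frozenWeight s g γLow u.val p * dq s u.val p * dq s z.val p ≤ 0 := by
    filter_upwards [hg.frozenWeight_bounds (s := s), dq_congr s hU, dq_congr s hZ] with p k1 k2 k3
    rw [k2, k3]
    unfold dq
    have hk := hg.γLow_pos.le.trans (k1 u.val).1
    have := mul_nonpos_of_nonneg_of_nonpos (mul_nonneg hk (sq_nonneg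
      (radialWeight d s ‖p.1 - p.2‖))) (hmul p.1 p.2)
    linarith
  have hzero : ∀ᵐ p : E d × E d,
      frozenWeight s g γLow u.val p * dq s u.val p * dq s z.val p = 0 := by
    have h1 : ∫ p : E d × E d, -(frozenWeight s g γLow u.val p * dq s u.val p * dq s z.val p) = 0 := by
      refine le_antisymm (by rw [integral_neg]; linarith) (integral_nonneg_of_ae ?_)
      filter_upwards [hle] with p hp
      exact neg_nonneg.2 hp
    have h2 := (integral_eq_zero_iff_of_nonneg_ae (by
      filter_upwards [hle] with p hp
      exact neg_nonneg.2 hp) (hg.integrable_opL u z).neg).1 h1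
    filter_upwards [h2] with p hp
    exact neg_eq_zero.1 hp
  -- On this product set the integrand is strictly negative, so the product is null and one of the
  -- factors is. Nonlocality is decisive: every pair of points interacts.
  have hnull : (volume : Measure (E d × E d)) ({x | 0 < Z x} ×ˢ {x | 0 < U x}) = 0 := by
    have : ∀ᵐ p : E d × E d, ¬ (p ∈ {x | 0 < Z x} ×ˢ {x | 0 < U x}) := by
      filter_upwards [hzero, hg.frozenWeight_bounds (s := s), dq_congr s hU, dq_congr s hZ]
        with p k0 k1 k2 k3
      rintro ⟨hp1, hp2⟩
      have hp1 : 0 < Z p.1 := hp1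
      have hp2 : 0 < U p.2 := hp2
      have hU1 : U p.1 = 0 := by
        by_contra h
        have : ¬ U p.1 ≤ 0 := fun h' => h (le_antisymm h' (hU0 _))
        simp [Z, this] at hp1
      have hZ2 : Z p.2 = 0 := if_neg (not_le.2 hp2)
      have hne : p.1 ≠ p.2 := fun h => by rw [h, hZ2] at hp1; exact lt_irrefl _ hp1
      have hW : 0 < radialWeight d s ‖p.1 - p.2‖ := radialWeight_pos (norm_sub_pos_iff.2 hne)
      have hk := hg.γLow_pos.trans_le (k1 u.val).1
      rw [k2, k3] at k0
      unfold dq at k0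
      rw [hU1, hZ2] at k0
      have : 0 < frozenWeight s g γLow u.val p * (U p.2 * radialWeight d s ‖p.1 - p.2‖) *
        (Z p.1 * radialWeight d s ‖p.1 - p.2‖) := by positivity
      linarith
    exact measure_eq_zero_iff_ae_notMem.2 this
  rw [Measure.volume_eq_prod, Measure.prod_prod, mul_eq_zero] at hnull
  have hU' : volume {x | 0 < U x} ≠ 0 := by
    intro h
    refine hu (HS.val_injective ?_)
    rw [map_zero]
    refine Lp.ext ?_
    have h' : ∀ᵐ x, ¬ 0 < U x := by rw [ae_iff]; simpa using h
    filter_upwards [hU, h', Lp.coeFn_zero ℝ 2 (volume : Measure (E d))] with x k1 k2 k3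
    rw [k1, k3]
    exact le_antisymm (not_lt.1 k2) (hU0 x)
  have hZ' : ∀ᵐ x, ¬ 0 < Z x := by
    rw [ae_iff]; simpa using hnull.resolve_right hU'
  refine HS.val_injective ?_
  rw [map_zero]
  refine Lp.ext ?_
  filter_upwards [hZ, hZ', Lp.coeFn_zero ℝ 2 (volume : Measure (E d))] with x k1 k2 k3
  rw [k1, k3]
  exact le_antisymm (not_lt.1 k2) (hZ0 x)

set_option maxHeartbeats 400000 in
/-- Strong minimum principle: a nonnegative supersolution that does not vanish identically is
positive outside a set of capacity zero. -/
theorem Admissible.ocap_nonpos_eq_zero (hA : Admissible s Ω) (hg : IsKernel g gLow gUp γLow γUp)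
    (hpos : ∀ v : HS s Ω, (∀ᵐ x, 0 ≤ v.val x) → 0 ≤ opL s g u.val v.val)
    (hu0 : ∀ᵐ x, 0 ≤ u.val x) (hu : u ≠ 0) (hf : IsQCRep s Ω u.val f) :
    ocap s Ω {x | x ∈ Ω ∧ f x ≤ 0} = 0 := by
  classical
  have key : ∀ φ, LipC Ω φ → (∀ x, 0 ≤ φ x) →
      ocap s Ω {x | x ∈ Ω ∧ f x ≤ 0 ∧ 1 ≤ φ x} = 0 := by
    intro φ hφ hφ0
    obtain ⟨t, ht⟩ := hφ.exists_HS hA.dim_pos hA.pos hA.lt_one hA.isOpen (s := s)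
    obtain ⟨P, hP, hP'⟩ := HS.exists_norm_le_grad (s := s) hA.dim_pos hA.pos hA.isOpen hA.bounded
    choose p hp hpb using fun n : ℕ => hA.exists_truncation hg hpos hu0 hφ hφ0 ht
      (Nat.cast_add_one_pos n)
    have h0 := hg.γLow_pos
    have hbd : ∀ n, ‖p n‖ ≤ √(P * (γUp * ‖t.grad‖ ^ 2 / γLow)) := fun n => by
      refine Real.le_sqrt_of_sq_le ((hP' _).trans (mul_le_mul_of_nonneg_left ?_ hP.le))
      rw [le_div_iff₀ h0, mul_comm]
      exact hpb n
    have hZm : MemLp (fun x => if u.val x ≤ 0 then φ x else 0) 2 (volume : Measure (E d)) := by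
      refine hφ.memLp.mono (Measurable.ite (measurableSet_le u.measurable_val measurable_const)
        hφ.measurable measurable_const).aestronglyMeasurable (Eventually.of_forall fun x => ?_)
      split_ifs
      · exact le_rfl
      · rw [norm_zero]; exact norm_nonneg _
    -- As c = n + 1 grows, φ(1 - cu)⁺ tends to φ on {u = 0} and to 0 elsewhere. With the uniform
    -- energy bound this puts the cut-off of the zero set in the space.
    have hlim : Tendsto (fun n => (p n).val) atTop (𝓝 (hZm.toLp _)) := by
      refine tendsto_L2_of_dominated (b := φ) hφ.memLp.integrable_sq (fun n => ?_) ?_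
      · filter_upwards [hp n, hZm.coeFn_toLp, hu0] with x k1 k2 k3
        rw [k1, k2]
        have i1 : max (1 - ((n : ℝ) + 1) * u.val x) 0 ≤ 1 :=
          max_le (by have : 0 ≤ ((n : ℝ) + 1) * u.val x := by positivity
                     linarith) zero_le_one
        have i2 := le_max_right (1 - ((n : ℝ) + 1) * u.val x) 0
        have i3 := mul_le_mul_of_nonneg_left i1 (hφ0 x)
        have i4 := mul_nonneg (hφ0 x) i2
        have := hφ0 x
        split_ifs <;> rw [abs_le] <;> constructor <;> linarith
      · have hp' := ae_all_iff.2 hp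
        filter_upwards [hp', hZm.coeFn_toLp, hu0] with x k1 k2 k3
        simp only [k1, k2]
        split_ifs with h
        · rw [le_antisymm h k3]
          simp
        · obtain ⟨N, hN⟩ := exists_nat_gt (1 / u.val x)
          refine tendsto_const_nhds.congr' ?_
          filter_upwards [eventually_ge_atTop N] with n hn
          have hn' : (N : ℝ) ≤ n := Nat.cast_le.2 hn
          rw [div_lt_iff₀ (not_le.1 h)] at hN
          rw [max_eq_right, mul_zero]
          have := not_le.1 h
          nlinarith
    obtain ⟨z, hz, -, hzC⟩ := HS.exists_val_eq_of_tendsto hbd hlim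
    have hz0 : z = 0 := hg.zero_set_null hpos hu0 hu hφ0 (by rw [hz]; exact hZm.coeFn_toLp)
    -- L² convergence to 0 says nothing about sets of measure zero. But every truncation lies above
    -- this indicator, a closed convex constraint that the limit 0 inherits, so the set has capacity
    -- zero.
    set ψ : E d → ℝ := fun x => if f x ≤ 0 ∧ 1 ≤ φ x then 1 else 0
    have hmem : ∀ n, p n ∈ qeAbove s Ω ψ := fun n => by
      refine ⟨fun x => φ x * max (1 - ((n : ℝ) + 1) * f x) 0, hA.isQCRep_comp₂
        (hA.isQCRep_of_continuous hφ.continuous ht) hf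
        (F := fun y => y.1 * max (1 - ((n : ℝ) + 1) * y.2) 0) (by fun_prop) ?_, ?_⟩
      · filter_upwards [hp n, ht] with x k1 k2
        rw [k1, k2]
      · refine ocap_null_mono ?_ ocap_empty
        rintro x ⟨-, hlt⟩
        exfalso
        refine absurd hlt (not_lt.2 ?_)
        simp only [ψ]
        split_ifs with h
        · have : 1 ≤ max (1 - ((n : ℝ) + 1) * f x) 0 := le_trans (by
            have : ((n : ℝ) + 1) * f x ≤ 0 := mul_nonpos_of_nonneg_of_nonpos (by positivity) h.1
            linarith) (le_max_left _ _)
          exact one_le_mul_of_one_le_of_one_le h.2 this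
        · exact mul_nonneg (hφ0 x) (le_max_right _ _)
    have h1 := hzC _ hA.isClosed_qeAbove hA.convex_qeAbove (Eventually.of_forall hmem)
    rw [hz0] at h1
    have h2 : IsQCRep s Ω (0 : HS s Ω).val fun _ => 0 :=
      hA.isQCRep_of_continuous continuous_const (by rw [map_zero]; exact Lp.coeFn_zero ℝ 2 _)
    refine ocap_null_mono ?_ ((hA.mem_qeAbove_iff h2).1 h1)
    rintro x ⟨hx, h⟩
    refine ⟨hx, ?_⟩
    simp only [ψ, h, and_self, if_true, zero_lt_one]
  obtain ⟨K, h1, h2, -, h4⟩ := exists_compact_exhaustion hA.isOpen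
  choose θ k1 k2 k3 k4 using fun n => exists_lipC_one hA.isOpen (h1 n) (h2 n)
  refine ocap_null_mono ?_ (hA.ocap_null_iUnion fun n => key (θ n) (k1 n) (k2 n))
  rintro x ⟨hx, hfx⟩
  have hx' := hx
  rw [← h4] at hx'
  obtain ⟨n, hn⟩ := mem_iUnion.1 hx'
  exact mem_iUnion.2 ⟨n, hx, hfx, (k4 n x hn).ge⟩

/-- If u were 0, then ψ ≤ 0 q.e. Otherwise u > 0 q.e. by the minimum principle, and at points where
u > 0, equality with ψ and equality with ψ⁺ mean the same. -/
theorem Admissible.coincidence_sets (hA : Admissible s Ω) (hg : IsKernel g gLow gUp γLow γUp)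
    (hψ : QuasiCont s Ω ψ) (hu : IsObstacleSol s g Ω ψ u.val)
    (hne : ¬ QE s Ω fun x => ψ x ≤ 0) (hf : IsQCRep s Ω u.val f) :
    QE s Ω fun x => f x = ψ x ↔ f x = max (ψ x) 0 := by
  have hu0 : u ≠ 0 := by
    rintro rfl
    have h2 : IsQCRep s Ω (0 : HS s Ω).val fun _ => 0 :=
      hA.isQCRep_of_continuous continuous_const (by rw [map_zero]; exact Lp.coeFn_zero ℝ 2 _)
    refine hne (hA.qe_of_ocap ?_)
    simp only [not_le]
    exact (hA.mem_obstacleSet_iff hψ _ h2).1 hu.1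
  refine hA.qe_of_ocap (ocap_null_mono ?_ (hA.ocap_nonpos_eq_zero hg
    (fun v hv => hA.opL_nonneg hψ hu hv) (hA.sol_nonneg hg hψ hu) hu0 hf))
  rintro x ⟨hx, h⟩
  refine ⟨hx, ?_⟩
  by_contra! hlt
  refine h ⟨fun e => ?_, fun e => ?_⟩
  · rw [max_eq_left (e ▸ hlt.le), e]
  · rcases le_total (ψ x) 0 with h0 | h0
    · rw [max_eq_right h0] at e; linarith
    · rwa [max_eq_left h0] at e

end Positivity

end

end FracObstacle

end

/-! ### The main theorem -/

theorem mainTheorem11 {d : ℕ} (hd : 0 < d) {s : ℝ} (hs0 : 0 < s) (hs1 : s < 1)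
    (Ω : Set (E d)) (hΩ : IsOpen Ω) (hΩb : Bornology.IsBounded Ω)
    (g : E d → E d → ℝ → ℝ) (gLow gUp γLow γUp : ℝ) (hg : IsKernel g gLow gUp γLow γUp)
    (ψ : E d → ℝ) (hψ : MemL2Cap s Ω ψ) :
    (∀ v ∈ Hs0 s Ω, ∃ f, IsQCRep s Ω v f) ∧
    ∃ u : L2 d, IsObstacleSol s g Ω ψ u ∧
      (∀ w : L2 d, IsObstacleSol s g Ω ψ w → w = u) ∧
      (∀ᵐ x, 0 ≤ u x) ∧
      hsNorm s u ≤ γUp / γLow * l2CapNorm s Ω (fun x => max (ψ x) 0) ∧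
      (¬ QE s Ω (fun x => ψ x ≤ 0) →
        ∀ f, IsQCRep s Ω u f → QE s Ω (fun x => f x = ψ x ↔ f x = max (ψ x) 0)) ∧
      ∃ μ : Measure (E d), Represents s g Ω u μ ∧
        (∀ ν : Measure (E d), Represents s g Ω u ν → ν = μ) ∧
        (∀ f, IsQCRep s Ω u f → ∀ᵐ x ∂μ, f x = ψ x ∧ f x = max (ψ x) 0) ∧
        (∀ A : Set (E d), MeasurableSet A → closure A ⊆ Ω →
          μ A ≤ ENNReal.ofReal (γUp ^ 2 / γLow ^ (3 / 2 : ℝ)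
              * l2CapNorm s Ω (fun x => max (ψ x) 0))
            * capG s g Ω A ^ (1 / 2 : ℝ)) ∧
        (∀ A : Set (E d), MeasurableSet A → A ⊆ Ω →
          (capS s Ω A = 0 ∨ capG s g Ω A = 0) → μ A = 0) := by
  have hA : Admissible s Ω := ⟨hd, hs0, hs1, hΩ, hΩb⟩
  refine ⟨fun v hv => ?_, ?_⟩
  · obtain ⟨w, rfl⟩ := HS.exists_val_eq hd hs0 hs1 hv
    obtain ⟨f, -, -, hf, -⟩ := hA.exists_rep w
    exact ⟨f, hf⟩
  obtain ⟨u, hu, huniq⟩ := hA.exists_obstacleSol hg hψ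
  have hnorm := hA.hsNorm_sol_le hg hψ hu
  obtain ⟨μ, hμ⟩ := hA.exists_representsLip hg u fun v hv => hA.opL_nonneg hψ.1 hu hv
  refine ⟨u.val, hu, huniq, hA.sol_nonneg hg hψ.1 hu, hnorm,
    fun hne f hf => hA.coincidence_sets hg hψ.1 hu hne hf, μ, hμ.represents hA hg,
    fun ν hν => hA.eq_of_represents hμ hν, fun f hf => hμ.ae_eq_obstacle hA hg hψ.1 hu hf,
    fun A hAm hAΩ => ?_, fun A hAm hAΩ h => hμ.measure_null_of_cap hA hg hAm hAΩ h⟩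
  rw [HS.hsNorm_val] at hnorm
  exact hμ.measure_le_capG hA hg hnorm hAm (subset_closure.trans hAΩ)
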